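/- **Setting.** Let $\mathcal K$ be a finite-dimensional and $\mathcal H_{\mathrm R}$ an arbitrary complex Hilbert space, $K$ a self-adjoint operator on $\mathcal K$, $H_{\mathrm R}$ a (possibly unbounded) self-adjoint operator on $\mathcal H_{\mathrm R}$, and $V:\mathcal K\to\mathcal H_{\mathrm R}$ linear. For $\lambda\in\mathbb R$ consider on $\mathcal H=\mathcal K\oplus\mathcal H_{\mathrm R}$ the Friedrichs operator $$H_\lambda=\begin{bmatrix}K&\lambda V^*\\ \lambda V&H_{\mathrm R}\end{bmatrix},\qquad \mathrm{Dom}\,H_\lambda=\mathcal K\oplus\mathrm{Dom}\,H_{\mathrm R}.$$ Assume $\int_{\mathbb R}\|V^*e^{-itH_{\mathrm R}}V\|\,dt<\infty$, and assume that for every $k\in\mathrm{sp}\,K$ there are an open set $I_k\ni k$, a Hilbert space $\mathfrak h_k$ and a unitary identification $\mathrm{Ran}\,1_{I_k}(H_{\mathrm R})\simeq L^2(I_k;\mathfrak h_k)\simeq\mathfrak h_k\otimes L^2(I_k,dx)$ under which $1_{I_k}(H_{\mathrm R})H_{\mathrm R}$ is multiplication by $x\in I_k$ and $1_{I_k}(H_{\mathrm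 R})V\varphi$ is the function $x\mapsto v(x)\varphi$ for all $\varphi\in\mathcal K$, where $I_k\ni x\mapsto v(x)\in B(\mathcal K,\mathfrak h_k)$ is measurable and continuous at $k$; the sets $I_k$ are pairwise disjoint. With $1_k(K)$ the spectral projection of $K$ onto the eigenvalue $k$, define the level shift operator and $\nu$ by $$\Upsilon=-i\sum_{k\in\mathrm{sp}K}\int_0^\infty 1_k(K)V^*e^{-it(H_{\mathrm R}-k)}V1_k(K)\,dt,\qquad \nu=(2\pi)^{1/2}\bigoplus_k v(k)1_k(K):\mathcal K\to\mathfrak h:=\bigoplus_k\mathfrak h_k .$$ Let $\mathcal Z_{\mathrm R}=L^2(\mathbb R;\mathfrak h)\simeq \mathfrak h\otimes L^2(\mathbb R)$, $\mathcal Z=\mathcal K\oplus\mathcal Z_{\mathrm R}$, let $I_{\mathcal K},I_{\mathrm R}$ be the embeddings of $\mathcal K,\mathcal Z_{\mathrm R}$ into $\mathcal Z$, let $Z_{\mathrm R}$ be multiplication by $x$ on $\mathcal Z_{\mathrm R}$, extended by $0$ to $\mathcal K$ (so $e^{itZ_{\mathrm R}}$ is the identity on $\mathcal K$), and $(1|g=\int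 g(x)\,dx$, with $|1)$ its adjoint in the sense of forms. For $\lambda>0$ let $J_\lambda:\mathcal Z\to\mathcal H$ be the partial isometry that is the identity on $\mathcal K$ and maps $g=(g_k)_k\in\mathcal Z_{\mathrm R}$ to $\sum_kJ_{\lambda,k}g_k$, where $J_{\lambda,k}g_k\in L^2(I_k;\mathfrak h_k)\simeq\mathrm{Ran}\,1_{I_k}(H_{\mathrm R})$ is $(J_{\lambda,k}g_k)(y)=\lambda^{-1}g_k\big((y-k)/\lambda^2\big)$, $y\in I_k$. **Theorem (Extended weak coupling limit for Friedrichs operators).** There is a strongly continuous unitary group $U_t=e^{-itZ}$, $t\in\mathbb R$, on $\mathcal Z$ (necessarily unique) which for $t\ge0$ is given, as a sesquilinear form on the vectors of $\mathcal Z$ whose $\mathcal Z_{\mathrm R}$-component is in $L^2\cap L^1$, by $$\begin{aligned}U_t={}&I_{\mathrm R}e^{-itZ_{\mathrm R}}I_{\mathrm R}^*+I_{\mathcal K}e^{-it\Upsilon}I_{\mathcal K}^*\\ &-i(2\pi)^{-1/2}I_{\mathcal K}\int_0^tdu\,e^{-i(t-u)\Upsilon}\nu^*\otimes(1|\,e^{-iuZ_{\mathrm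 R}}I_{\mathrm R}^* -i(2\pi)^{-1/2}I_{\mathrm R}\int_0^tdu\,e^{-i(t-u)Z_{\mathrm R}}\,\nu\otimes|1)\,e^{-iu\Upsilon}I_{\mathcal K}^*\\ &-(2\pi)^{-1}I_{\mathrm R}\int_{u_1,u_2\ge0,\;u_1+u_2\le t}du_1du_2\,e^{-iu_2Z_{\mathrm R}}\,\nu\otimes|1)\,e^{-i(t-u_2-u_1)\Upsilon}\,\nu^*\otimes(1|\,e^{-iu_1Z_{\mathrm R}}I_{\mathrm R}^* .\end{aligned}$$ It is a unitary dilation of $e^{-it\Upsilon}$, that is, $I_{\mathcal K}^*e^{-itZ}I_{\mathcal K}=e^{-it\Upsilon}$ for $t\ge0$, and for all $t,t_0\in\mathbb R$ $$\mathrm{s}^*\text{-}\lim_{\lambda\searrow0}J_\lambda^*\,e^{i\lambda^{-2}tH_0}\,e^{-i\lambda^{-2}(t-t_0)H_\lambda}\,e^{-i\lambda^{-2}t_0H_0}\,J_\lambda=e^{itZ_{\mathrm R}}\,e^{-i(t-t_0)Z}\,e^{-it_0Z_{\mathrm R}},$$ where $\mathrm{s}^*\text{-}\lim A_\lambda=A$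 means $A_\lambda\psi\to A\psi$ and $A_\lambda^*\psi\to A^*\psi$ for every vector $\psi$. -/

import Mathlib

open MeasureTheory Filter Topology ContinuousLinearMap
open scoped ENNReal SchwartzMap FourierTransform InnerProductSpace

noncomputable section

namespace WeakCoupling

/-! ### Unitary groups and functional calculus of self-adjoint operators -/

section Abstract

variable {E : Type*} [NormedAddCommGroup E] [InnerProductSpace ℂ E] [CompleteSpace E]

/-- A strongly continuous one-parameter unitary group. -/
structure IsUnitaryGroup (U : ℝ → E →L[ℂ] E) : Prop where
  map_zero : U 0 = 1
  map_add : ∀ s t, U (s + t) = U s * U t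
  mem_unitary : ∀ t, U t ∈ unitary (E →L[ℂ] E)
  continuous : ∀ x, Continuous fun t => U t x

/-- `-iA` is the infinitesimal generator of `U`, domains included:
`x ∈ dom A` and `A x = y` if and only if `t ↦ U t x` has derivative `-i y` at `0`. -/
def IsGeneratedBy (U : ℝ → E →L[ℂ] E) (A : E →ₗ.[ℂ] E) : Prop :=
  ∀ x y : E, (x, y) ∈ A.graph ↔ HasDerivAt (fun t => U t x) (-Complex.I • y) 0

/-- The unitary group `t ↦ e^{-itA}` of a (possibly unbounded) self-adjoint operator `A`: the one
and only strongly continuous unitary group whose generator is `-iA`. -/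
def expI (A : E →ₗ.[ℂ] E) : ℝ → E →L[ℂ] E :=
  Classical.epsilon fun U => IsUnitaryGroup U ∧ IsGeneratedBy U A

/-- The vector `f(A) x = ∫ 𝓕f(t) e^{2πitA} x dt` for a Schwartz function `f`. -/
def schwartzCalculus (A : E →ₗ.[ℂ] E) (f : 𝓢(ℝ, ℂ)) (x : E) : E :=
  ∫ t : ℝ, 𝓕 (f : ℝ → ℂ) t • expI A (-(2 * Real.pi * t)) x

/-- For an *open* set `I`, the range of the spectral projection `1_I(A)` of a self-adjoint `A`:
the closed span of the vectors `f(A) x` with `f` smooth and compactly supported in `I`. (For open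
`I`, the indicator `1_I` is a pointwise limit of an increasing sequence of such `f`.) -/
def spectralSubspace (A : E →ₗ.[ℂ] E) (I : Set ℝ) : Submodule ℂ E :=
  (Submodule.span ℂ {y | ∃ (f : 𝓢(ℝ, ℂ)) (x : E), HasCompactSupport (f : ℝ → ℂ) ∧
    tsupport (f : ℝ → ℂ) ⊆ I ∧ y = schwartzCalculus A f x}).topologicalClosure

instance (A : E →ₗ.[ℂ] E) (I : Set ℝ) : CompleteSpace (spectralSubspace A I) :=
  Submodule.topologicalClosure.completeSpace _

/-- The spectral projection `1_I(A)` for open `I`. -/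
def spectralProjection (A : E →ₗ.[ℂ] E) (I : Set ℝ) : E →L[ℂ] E :=
  (spectralSubspace A I).starProjection

/-- Convergence in the strong* sense: both `A_a → B` and `A_a* → B*` strongly. -/
def StrongStarTendsto {α : Type*} (A : α → E →L[ℂ] E) (l : Filter α) (B : E →L[ℂ] E) : Prop :=
  ∀ x, Tendsto (fun a => A a x) l (𝓝 (B x)) ∧
    Tendsto (fun a => adjoint (A a) x) l (𝓝 (adjoint B x))

/-- `e^{-itB}` for a bounded operator `B`. -/
def bexpI (B : E →L[ℂ] E) (t : ℝ) : E →L[ℂ] E := NormedSpace.exp ((-(Complex.I * t)) • B)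

end Abstract

/-! ### Hilbert direct sums and `L²` operators -/

section Sums

variable {E F E' F' : Type*}
  [NormedAddCommGroup E] [InnerProductSpace ℂ E] [NormedAddCommGroup F] [InnerProductSpace ℂ F]
  [NormedAddCommGroup E'] [InnerProductSpace ℂ E'] [NormedAddCommGroup F'] [InnerProductSpace ℂ F']

/-- `A ⊕ B : E ⊕ F → E' ⊕ F'` between Hilbert direct sums. -/
def directSum (A : E →L[ℂ] E') (B : F →L[ℂ] F') :
    WithLp 2 (E × F) →L[ℂ] WithLp 2 (E' × F') :=
  ((WithLp.prodContinuousLinearEquiv 2 ℂ E' F').symm : E' × F' →L[ℂ] WithLp 2 (E' × F')) ∘L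
    A.prodMap B ∘L
    (WithLp.prodContinuousLinearEquiv 2 ℂ E F : WithLp 2 (E × F) →L[ℂ] E × F)

/-- The embedding of the first summand into `E ⊕ F`. -/
def inlL : E →L[ℂ] WithLp 2 (E × F) :=
  ((WithLp.prodContinuousLinearEquiv 2 ℂ E F).symm : E × F →L[ℂ] WithLp 2 (E × F)) ∘L
    ContinuousLinearMap.inl ℂ E F

theorem memLp_char_smul (t : ℝ) (g : Lp E 2 (volume : Measure ℝ)) :
    MemLp (fun x : ℝ => Complex.exp (Complex.I * t * x) • g x) 2 volume := by
  refine (Lp.memLp g).of_le ?_ (ae_of_all _ fun x => ?_)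
  · exact (Continuous.aestronglyMeasurable (by fun_prop)).smul (Lp.aestronglyMeasurable g)
  · rw [norm_smul, mul_assoc, mul_comm, mul_comm Complex.I]
    norm_cast
    rw [Complex.norm_exp_ofReal_mul_I, mul_one]

/-- The operator `e^{itx}` of multiplication on `L²(ℝ; E)`. -/
def mulChar (t : ℝ) : Lp E 2 (volume : Measure ℝ) →L[ℂ] Lp E 2 (volume : Measure ℝ) :=
  LinearMap.mkContinuous
    { toFun := fun g => (memLp_char_smul t g).toLp _
      map_add' := fun f g => by
        rw [← MemLp.toLp_add, MemLp.toLp_eq_toLp_iff]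
        filter_upwards [Lp.coeFn_add f g] with x hx
        simp only [hx, Pi.add_apply, smul_add]
      map_smul' := fun c f => by
        rw [RingHom.id_apply, ← MemLp.toLp_const_smul, MemLp.toLp_eq_toLp_iff]
        filter_upwards [Lp.coeFn_smul c f] with x hx
        simp [hx, smul_comm c] } 1 fun g => by
      rw [one_mul]
      refine Lp.norm_le_norm_of_ae_le ?_
      filter_upwards [(memLp_char_smul t g).coeFn_toLp] with x hx
      change ‖((memLp_char_smul t g).toLp _ : ℝ → E) x‖ ≤ _
      rw [hx, norm_smul, mul_assoc, mul_comm Complex.I]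
      norm_cast
      rw [Complex.norm_exp_ofReal_mul_I, one_mul]

theorem eLpNorm_rescale {lam : ℝ} (hlam : 0 < lam) (k : ℝ) (I : Set ℝ)
    (g : Lp E 2 (volume : Measure ℝ)) :
    MemLp (fun y : ℝ => g ((y - k) / lam ^ 2)) 2 (volume.restrict I) ∧
    eLpNorm (fun y : ℝ => g ((y - k) / lam ^ 2)) 2 (volume.restrict I) ≤
      ENNReal.ofReal lam * eLpNorm g 2 volume := by
  have h2 : (0 : ℝ) < lam ^ 2 := by positivity
  have hT : Measurable fun y : ℝ => (y - k) / lam ^ 2 := by fun_prop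
  have hmap : Measure.map (fun y : ℝ => (y - k) / lam ^ 2) volume
      = ENNReal.ofReal (lam ^ 2) • (volume : Measure ℝ) := by
    have : (fun y : ℝ => (y - k) / lam ^ 2)
        = (fun y : ℝ => (lam ^ 2)⁻¹ * y) ∘ fun y : ℝ => y - k := by
      funext y; simp [div_eq_inv_mul]
    rw [this, ← Measure.map_map (by fun_prop) (by fun_prop),
      (measurePreserving_sub_right volume k).map_eq, Real.map_volume_mul_left (by positivity),
      inv_inv, abs_of_pos h2]
  have hg : MemLp g 2 (Measure.map (fun y : ℝ => (y - k) / lam ^ 2) volume) := by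
    rw [hmap]; exact (Lp.memLp g).smul_measure ENNReal.ofReal_ne_top
  have hc := hg.comp_of_map hT.aemeasurable
  refine ⟨hc.mono_measure Measure.restrict_le_self, ?_⟩
  calc eLpNorm (fun y : ℝ => g ((y - k) / lam ^ 2)) 2 (volume.restrict I)
      ≤ eLpNorm (g ∘ fun y : ℝ => (y - k) / lam ^ 2) 2 volume :=
        eLpNorm_mono_measure _ Measure.restrict_le_self
    _ = eLpNorm g 2 (ENNReal.ofReal (lam ^ 2) • volume) := by
        rw [← hmap, eLpNorm_map_measure hg.1 hT.aemeasurable]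
    _ ≤ _ := by
        rw [eLpNorm_smul_measure_of_ne_top (by simp)]
        rw [ENNReal.ofReal_pow hlam.le, ← ENNReal.rpow_natCast, ← ENNReal.rpow_mul]
        simp

theorem quasiMeasurePreserving_rescale {lam : ℝ} (hlam : 0 < lam) (k : ℝ) :
    Measure.QuasiMeasurePreserving (fun y : ℝ => (y - k) / lam ^ 2) := by
  have h2 : (lam ^ 2 : ℝ)⁻¹ ≠ 0 := by positivity
  have : (fun y : ℝ => (y - k) / lam ^ 2)
      = (fun y : ℝ => (lam ^ 2)⁻¹ * y) ∘ fun y : ℝ => y - k := by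
    funext y; simp [div_eq_inv_mul]
  rw [this]
  refine Measure.QuasiMeasurePreserving.comp ⟨by fun_prop, ?_⟩
    (measurePreserving_sub_right volume k).quasiMeasurePreserving
  rw [Real.map_volume_mul_left h2]
  exact Measure.smul_absolutelyContinuous

/-- The partial isometry `L²(ℝ; E) → L²(I; E)`, `(J g)(y) = λ⁻¹ g((y - k) / λ²)` for `λ > 0`
(and the irrelevant value `0` for `λ ≤ 0`). -/
def rescale (lam k : ℝ) (I : Set ℝ) :
    Lp E 2 (volume : Measure ℝ) →L[ℂ] Lp E 2 (volume.restrict I) :=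
  if hlam : 0 < lam then
    ((lam⁻¹ : ℝ) : ℂ) • LinearMap.mkContinuous
      { toFun := fun g => (eLpNorm_rescale hlam k I g).1.toLp _
        map_add' := fun f g => by
          rw [← MemLp.toLp_add, MemLp.toLp_eq_toLp_iff]
          exact ae_restrict_of_ae ((quasiMeasurePreserving_rescale hlam k).ae (Lp.coeFn_add f g))
        map_smul' := fun c f => by
          rw [RingHom.id_apply, ← MemLp.toLp_const_smul, MemLp.toLp_eq_toLp_iff]
          exact ae_restrict_of_ae ((quasiMeasurePreserving_rescale hlam k).ae (Lp.coeFn_smul c f)) }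
      lam fun g => by
        change ‖(eLpNorm_rescale hlam k I g).1.toLp _‖ ≤ _
        rw [Lp.norm_toLp, Lp.norm_def]
        refine (ENNReal.toReal_mono ?_ (eLpNorm_rescale hlam k I g).2).trans ?_
        · exact ENNReal.mul_ne_top ENNReal.ofReal_ne_top (Lp.eLpNorm_ne_top g)
        · rw [ENNReal.toReal_mul, ENNReal.toReal_ofReal hlam.le]
  else 0

end Sums

/-! ### Friedrichs operators -/

section Friedrichs

variable {𝒦 ℋ : Type*}
  [NormedAddCommGroup 𝒦] [InnerProductSpace ℂ 𝒦] [CompleteSpace 𝒦] [FiniteDimensional ℂ 𝒦]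
  [NormedAddCommGroup ℋ] [InnerProductSpace ℂ ℋ] [CompleteSpace ℋ]

theorem finite_spectrum_real (K : 𝒦 →L[ℂ] 𝒦) : (spectrum ℝ K).Finite := by
  have h : (spectrum ℂ K).Finite := by
    rw [← AlgEquiv.spectrum_eq (Module.End.toContinuousLinearMap 𝒦).symm K]
    exact Module.End.finite_spectrum _
  rw [← spectrum.preimage_algebraMap ℂ]
  exact h.preimage (FaithfulSMul.algebraMap_injective ℝ ℂ).injOn

instance (K : 𝒦 →L[ℂ] 𝒦) : Fintype (spectrum ℝ K) := (finite_spectrum_real K).fintype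

/-- The Friedrichs operator `H_λ = [[K, λV*], [λV, H_R]]` on `𝒦 ⊕ ℋ_R`,
with domain `𝒦 ⊕ dom H_R`. -/
def friedrichs (K : 𝒦 →L[ℂ] 𝒦) (HR : ℋ →ₗ.[ℂ] ℋ) (V : 𝒦 →L[ℂ] ℋ) (lam : ℝ) :
    WithLp 2 (𝒦 × ℋ) →ₗ.[ℂ] WithLp 2 (𝒦 × ℋ) where
  domain := HR.domain.comap (WithLp.sndₗ 2 ℂ 𝒦 ℋ)
  toFun :=
    { toFun := fun x => WithLp.toLp 2
        (K x.1.fst + (lam : ℂ) • adjoint V x.1.snd, (lam : ℂ) • V x.1.fst + HR ⟨x.1.snd, x.2⟩)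
      map_add' := fun x y => by
        have h : HR ⟨(x + y).1.snd, (x + y).2⟩ = HR ⟨x.1.snd, x.2⟩ + HR ⟨y.1.snd, y.2⟩ :=
          HR.map_add ⟨x.1.snd, x.2⟩ ⟨y.1.snd, y.2⟩
        rw [h, ← WithLp.toLp_add]
        simp only [Submodule.coe_add, WithLp.add_fst, WithLp.add_snd, map_add, smul_add,
          Prod.mk_add_mk]
        congr 2 <;> abel
      map_smul' := fun c x => by
        have h : HR ⟨(c • x).1.snd, (c • x).2⟩ = c • HR ⟨x.1.snd, x.2⟩ :=
          HR.map_smul c ⟨x.1.snd, x.2⟩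
        rw [h, RingHom.id_apply, ← WithLp.toLp_smul]
        simp only [Submodule.coe_smul, WithLp.smul_fst, WithLp.smul_snd, map_smul, smul_add,
          Prod.smul_mk, smul_comm c (lam : ℂ)] }

/-- `1_k(K)`: the orthogonal projection onto the eigenspace of `K` for the eigenvalue `k`. -/
def eigenProjection (K : 𝒦 →L[ℂ] 𝒦) (k : ℝ) : 𝒦 →L[ℂ] 𝒦 :=
  (Module.End.eigenspace (K : 𝒦 →ₗ[ℂ] 𝒦) (k : ℂ)).starProjection

/-- The level shift operator
`Υ = -i ∑_{k ∈ sp K} ∫_0^∞ 1_k(K) V* e^{-it(H_R - k)} V 1_k(K) dt`. -/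
def levelShift (K : 𝒦 →L[ℂ] 𝒦) (HR : ℋ →ₗ.[ℂ] ℋ) (V : 𝒦 →L[ℂ] ℋ) : 𝒦 →L[ℂ] 𝒦 :=
  -Complex.I • ∑ k : spectrum ℝ K, ∫ t in Set.Ioi (0 : ℝ),
    Complex.exp (Complex.I * t * (k : ℝ)) •
      (eigenProjection K k ∘L adjoint V ∘L expI HR t ∘L V ∘L eigenProjection K k)

variable {K : 𝒦 →L[ℂ] 𝒦} {𝔥 : spectrum ℝ K → Type*} [∀ k, NormedAddCommGroup (𝔥 k)]
  [∀ k, InnerProductSpace ℂ (𝔥 k)] [∀ k, CompleteSpace (𝔥 k)]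

/-- The reservoir and the interaction are regular near the spectrum of `K`. Each `k ∈ sp K` has an
open neighbourhood `I k`, the `I k` are disjoint, and the unitary `W k` identifies
`L²(I k; 𝔥 k) ≃ 𝔥 k ⊗ L²(I k)` with `Ran 1_{I k}(H_R)` so that the part of `H_R` in this subspace
becomes multiplication by the variable `x ∈ I k`, and `1_{I k}(H_R) V` becomes `φ ↦ v(·) φ` with
`v` measurable and continuous at `k`. (The values of `v k` off `I k` play no role.) -/
structure IsRegularNearSpectrum (HR : ℋ →ₗ.[ℂ] ℋ) (V : 𝒦 →L[ℂ] ℋ) (I : spectrum ℝ K → Set ℝ)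
    (W : ∀ k, Lp (𝔥 k) 2 (volume.restrict (I k)) →ₗᵢ[ℂ] ℋ) (v : ∀ k, ℝ → 𝒦 →L[ℂ] 𝔥 k) :
    Prop where
  isOpen : ∀ k, IsOpen (I k)
  mem : ∀ k : spectrum ℝ K, (k : ℝ) ∈ I k
  disjoint : Pairwise fun k l => Disjoint (I k) (I l)
  range_eq : ∀ k, LinearMap.range (W k).toLinearMap = spectralSubspace HR (I k)
  mul : ∀ k (f g : Lp (𝔥 k) 2 (volume.restrict (I k))),
    (W k f, W k g) ∈ HR.graph ↔ ∀ᵐ x ∂volume.restrict (I k), g x = (x : ℂ) • f x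
  interaction : ∀ k φ, ∃ f : Lp (𝔥 k) 2 (volume.restrict (I k)),
    (∀ᵐ x ∂volume.restrict (I k), f x = v k x φ) ∧ spectralProjection HR (I k) (V φ) = W k f
  measurable : ∀ k, AEStronglyMeasurable (v k) (volume.restrict (I k))
  continuousAt : ∀ k : spectrum ℝ K, ContinuousAt (v k) k

/-- `ν = (2π)^{1/2} ⊕_k v(k) 1_k(K) : 𝒦 → 𝔥 = ⊕_k 𝔥 k`. -/
def nu (v : ∀ k, ℝ → 𝒦 →L[ℂ] 𝔥 k) : 𝒦 →L[ℂ] PiLp 2 𝔥 :=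
  ((PiLp.continuousLinearEquiv 2 ℂ 𝔥).symm : (∀ k, 𝔥 k) →L[ℂ] PiLp 2 𝔥) ∘L
    ContinuousLinearMap.pi fun k : spectrum ℝ K =>
      (Real.sqrt (2 * Real.pi) : ℂ) • (v k k ∘L eigenProjection K k)

/-- The identification operator `J_λ : 𝒦 ⊕ L²(ℝ; 𝔥) → 𝒦 ⊕ ℋ_R`: the identity on `𝒦`, and
`g ↦ ∑_k W_k J_{λ,k} g_k` on `L²(ℝ; 𝔥)`. -/
def identification (I : spectrum ℝ K → Set ℝ)
    (W : ∀ k, Lp (𝔥 k) 2 (volume.restrict (I k)) →ₗᵢ[ℂ] ℋ) (lam : ℝ) :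
    WithLp 2 (𝒦 × Lp (PiLp 2 𝔥) 2 (volume : Measure ℝ)) →L[ℂ] WithLp 2 (𝒦 × ℋ) :=
  directSum (ContinuousLinearMap.id ℂ 𝒦)
    (∑ k, (W k).toContinuousLinearMap ∘L rescale lam k (I k) ∘L
      (PiLp.proj 2 𝔥 k : PiLp 2 𝔥 →L[ℂ] 𝔥 k).compLpL 2 volume)

end Friedrichs

/-! ### The unitary dilation as a singular Friedrichs group -/

section Dilation

variable {𝒦 𝔥 : Type*}
  [NormedAddCommGroup 𝒦] [InnerProductSpace ℂ 𝒦] [CompleteSpace 𝒦]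
  [NormedAddCommGroup 𝔥] [InnerProductSpace ℂ 𝔥] [CompleteSpace 𝔥]

/-- `1 ⊕ e^{itZ_R}` on `𝒦 ⊕ L²(ℝ; 𝔥)`, where `Z_R` is multiplication by `x` on `L²(ℝ; 𝔥)`. -/
def expZR (t : ℝ) : WithLp 2 (𝒦 × Lp 𝔥 2 (volume : Measure ℝ)) →L[ℂ]
    WithLp 2 (𝒦 × Lp 𝔥 2 (volume : Measure ℝ)) :=
  directSum (ContinuousLinearMap.id ℂ 𝒦) (mulChar t)

/-- `(1| e^{-iuZ_R} g = ∫ e^{-iux} g(x) dx ∈ 𝔥`. -/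
def oneBra (u : ℝ) (g : Lp 𝔥 2 (volume : Measure ℝ)) : 𝔥 :=
  ∫ x : ℝ, Complex.exp (-(Complex.I * u * x)) • g x

/-- The sesquilinear form of the singular Friedrichs group at time `t ≥ 0`, for vectors whose
second component is in `L² ∩ L¹`. With `ψ = (a, f)` and `ψ' = (b, g)` it is the sum of
`(f | e^{-itZ_R} g)`, `(a | e^{-itΥ} b)`,
`-i (2π)^{-1/2} ∫_0^t (a | e^{-i(t-u)Υ} ν* ⊗ (1| e^{-iuZ_R} g) du`,
`-i (2π)^{-1/2} ∫_0^t (f | e^{-i(t-u)Z_R} ν ⊗ |1) e^{-iuΥ} b) du` and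
`-(2π)^{-1} ∫∫_{u₁, u₂ ≥ 0, u₁ + u₂ ≤ t}
  (f | e^{-iu₂Z_R} ν ⊗ |1) e^{-i(t-u₂-u₁)Υ} ν* ⊗ (1| e^{-iu₁Z_R} g) du₁ du₂`,
where `(f | e^{-iuZ_R} ν ⊗ |1) b) = ((1| e^{iuZ_R} f | ν b)`. -/
def dilationForm (Υ : 𝒦 →L[ℂ] 𝒦) (ν : 𝒦 →L[ℂ] 𝔥) (t : ℝ)
    (ψ ψ' : WithLp 2 (𝒦 × Lp 𝔥 2 (volume : Measure ℝ))) : ℂ :=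
  ⟪ψ.snd, mulChar (-t) ψ'.snd⟫_ℂ + ⟪ψ.fst, bexpI Υ t ψ'.fst⟫_ℂ
  - Complex.I * (Real.sqrt (2 * Real.pi) : ℂ)⁻¹ * (∫ u in (0 : ℝ)..t,
      ⟪ψ.fst, bexpI Υ (t - u) (adjoint ν (oneBra u ψ'.snd))⟫_ℂ)
  - Complex.I * (Real.sqrt (2 * Real.pi) : ℂ)⁻¹ * (∫ u in (0 : ℝ)..t,
      ⟪oneBra (-(t - u)) ψ.snd, ν (bexpI Υ u ψ'.fst)⟫_ℂ)
  - (2 * Real.pi : ℂ)⁻¹ * (∫ u₂ in (0 : ℝ)..t, ∫ u₁ in (0 : ℝ)..(t - u₂),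
      ⟪oneBra (-u₂) ψ.snd, ν (bexpI Υ (t - u₂ - u₁) (adjoint ν (oneBra u₁ ψ'.snd)))⟫_ℂ)

/-- `U t = e^{-itZ}` is the singular Friedrichs group of `(Υ, ν)`: a strongly continuous unitary
group on `𝒦 ⊕ L²(ℝ; 𝔥)` that for `t ≥ 0` extends the form `dilationForm Υ ν t`. As the domain of
the form is dense, there is at most one such group. -/
structure IsSingularFriedrichsGroup (Υ : 𝒦 →L[ℂ] 𝒦) (ν : 𝒦 →L[ℂ] 𝔥)
    (U : ℝ → WithLp 2 (𝒦 × Lp 𝔥 2 (volume : Measure ℝ)) →L[ℂ]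
      WithLp 2 (𝒦 × Lp 𝔥 2 (volume : Measure ℝ))) : Prop where
  isUnitaryGroup : IsUnitaryGroup U
  form : ∀ t, 0 ≤ t → ∀ ψ ψ' : WithLp 2 (𝒦 × Lp 𝔥 2 (volume : Measure ℝ)),
    Integrable ψ.snd → Integrable ψ'.snd → ⟪ψ, U t ψ'⟫_ℂ = dilationForm Υ ν t ψ ψ'

/-- `U` is a unitary dilation of the semigroup `e^{-itΥ}`, `t ≥ 0`: `I_𝒦* U_t I_𝒦 = e^{-itΥ}`. -/
def IsDilation (Υ : 𝒦 →L[ℂ] 𝒦)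
    (U : ℝ → WithLp 2 (𝒦 × Lp 𝔥 2 (volume : Measure ℝ)) →L[ℂ]
      WithLp 2 (𝒦 × Lp 𝔥 2 (volume : Measure ℝ))) : Prop :=
  IsUnitaryGroup U ∧ ∀ t, 0 ≤ t → adjoint inlL ∘L U t ∘L inlL = bexpI Υ t

end Dilation

end WeakCoupling

end

open MeasureTheory Filter Topology ContinuousLinearMap
open scoped ENNReal SchwartzMap FourierTransform InnerProductSpace

noncomputable section

namespace WeakCoupling



/-! ### Self-adjoint operators and their resolvents -/

section SelfAdjoint

variable {E : Type*} [NormedAddCommGroup E] [InnerProductSpace ℂ E] [CompleteSpace E]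
  {A : E →ₗ.[ℂ] E}

theorem mem_graph_iff_of_isSelfAdjoint (hA : IsSelfAdjoint A) (x y : E) :
    (x, y) ∈ A.graph ↔ ∀ z w, (z, w) ∈ A.graph → ⟪w, x⟫_ℂ = ⟪z, y⟫_ℂ := by
  have h := LinearPMap.adjoint_graph_eq_graph_adjoint hA.dense_domain
  rw [LinearPMap.isSelfAdjoint_def.mp hA] at h
  rw [h, Submodule.mem_adjoint_iff]
  rw [← h]
  simp only [sub_eq_zero]

theorem exists_mem_graph {x : E} (hx : x ∈ A.domain) : ∃ y, (x, y) ∈ A.graph :=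
  ⟨A ⟨x, hx⟩, A.mem_graph ⟨x, hx⟩⟩

theorem mem_domain_of_mem_graph {x y : E} (h : (x, y) ∈ A.graph) : x ∈ A.domain := by
  obtain ⟨z, hz, -⟩ := (LinearPMap.mem_graph_iff A).mp h
  have hz' : (z : E) = x := hz
  exact hz' ▸ z.2

theorem symm_of_isSelfAdjoint (hA : IsSelfAdjoint A) {x y z w : E} (h : (x, y) ∈ A.graph)
    (h' : (z, w) ∈ A.graph) : ⟪w, x⟫_ℂ = ⟪z, y⟫_ℂ :=
  (mem_graph_iff_of_isSelfAdjoint hA x y).mp h z w h'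

theorem graph_ext {x x' y y' : E} (h : (x, y) ∈ A.graph) (hx : x = x') (hy : y = y') :
    (x', y') ∈ A.graph := hx ▸ hy ▸ h

theorem graph_add_mem {x x' y y' : E} (h : (x, y) ∈ A.graph) (h' : (x', y') ∈ A.graph) :
    (x + x', y + y') ∈ A.graph := A.graph.add_mem h h'

theorem graph_smul_mem {x y : E} (c : ℂ) (h : (x, y) ∈ A.graph) :
    (c • x, c • y) ∈ A.graph := A.graph.smul_mem c h

theorem norm_sq_add_smul_I (hA : IsSelfAdjoint A) (n : ℝ) {x y : E} (h : (x, y) ∈ A.graph) :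
    ‖y + ((n : ℂ) * Complex.I) • x‖ ^ 2 = ‖y‖ ^ 2 + n ^ 2 * ‖x‖ ^ 2 := by
  have h1 := symm_of_isSelfAdjoint hA h h
  rw [@norm_add_sq ℂ, norm_smul, inner_smul_right]
  have h2 : (⟪y, x⟫_ℂ).im = 0 := by
    have := congrArg Complex.im h1
    rw [← inner_conj_symm x y, Complex.conj_im] at this
    linarith
  have h3 : RCLike.re ((n : ℂ) * Complex.I * ⟪y, x⟫_ℂ) = 0 := by
    simp [h2]
  rw [h3]
  simp [mul_pow]

theorem exists_resolvent_eq (hA : IsSelfAdjoint A) {n : ℝ} (hn : n ≠ 0) (y : E) :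
    ∃ x, (x, y - ((n : ℂ) * Complex.I) • x) ∈ A.graph := by
  let ℓ : A.graph →L[ℂ] E :=
    (ContinuousLinearMap.snd ℂ E E + ((n : ℂ) * Complex.I) • ContinuousLinearMap.fst ℂ E E) ∘L
      A.graph.subtypeL
  have hℓ : ∀ p : A.graph, ‖ℓ p‖ ^ 2 = ‖p.1.2‖ ^ 2 + n ^ 2 * ‖p.1.1‖ ^ 2 := fun p =>
    norm_sq_add_smul_I hA n p.2
  have hcl : IsClosed (A.graph : Set (E × E)) := hA.isClosed
  have : CompleteSpace A.graph := hcl.completeSpace_coe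
  have hanti : AntilipschitzWith (1 + Real.toNNReal |n|⁻¹) ℓ := by
    refine ContinuousLinearMap.antilipschitz_of_bound ℓ fun p => ?_
    have hn' : 0 < |n| := abs_pos.mpr hn
    have h1 : ‖p.1.2‖ ≤ ‖ℓ p‖ := by
      refine le_of_sq_le_sq ?_ (norm_nonneg _)
      rw [hℓ]; nlinarith [sq_nonneg (n * ‖p.1.1‖)]
    have h2 : |n| * ‖p.1.1‖ ≤ ‖ℓ p‖ := by
      refine le_of_sq_le_sq ?_ (norm_nonneg _)
      rw [hℓ, mul_pow, sq_abs]; nlinarith [sq_nonneg (‖p.1.2‖)]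
    have h3 : ‖p.1.1‖ ≤ |n|⁻¹ * ‖ℓ p‖ := by
      rw [inv_mul_eq_div, le_div_iff₀ hn']; linarith
    have h4 : ‖p‖ = max ‖p.1.1‖ ‖p.1.2‖ := rfl
    have h5 : (0 : ℝ) ≤ |n|⁻¹ := by positivity
    have h6 : ((1 + Real.toNNReal |n|⁻¹ : NNReal) : ℝ) = 1 + |n|⁻¹ := by
      simp
    rw [h4, h6]
    have h7 := norm_nonneg (ℓ p)
    refine max_le ?_ ?_ <;> nlinarith
  have hrange : IsClosed (LinearMap.range (ℓ : A.graph →ₗ[ℂ] E) : Set E) := by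
    rw [LinearMap.coe_range]
    exact hanti.isClosed_range ℓ.uniformContinuous
  have : CompleteSpace (LinearMap.range (ℓ : A.graph →ₗ[ℂ] E)) := hrange.completeSpace_coe
  have htop : LinearMap.range (ℓ : A.graph →ₗ[ℂ] E) = ⊤ := by
    rw [← Submodule.orthogonal_eq_bot_iff, Submodule.eq_bot_iff]
    intro z hz
    rw [Submodule.mem_orthogonal] at hz
    have h1 : (z, ((n : ℂ) * Complex.I) • z) ∈ A.graph := by
      rw [mem_graph_iff_of_isSelfAdjoint hA]
      intro x w hxw
      have := hz (w + ((n : ℂ) * Complex.I) • x) ⟨⟨(x, w), hxw⟩, rfl⟩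
      rw [inner_add_left, inner_smul_left] at this
      rw [inner_smul_right]
      simp only [map_mul, Complex.conj_ofReal, Complex.conj_I] at this
      linear_combination this
    have h2 := symm_of_isSelfAdjoint hA h1 h1
    rw [inner_smul_left, inner_smul_right, inner_self_eq_norm_sq_to_K] at h2
    simp only [map_mul, Complex.conj_ofReal, Complex.conj_I] at h2
    have h3 : ((n : ℂ) * Complex.I) * ((‖z‖ : ℂ) ^ 2) = 0 := by
      have h2' : ((n : ℂ) * -Complex.I) * ((‖z‖ : ℂ) ^ 2) = (n * Complex.I) * ((‖z‖ : ℂ) ^ 2) := h2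
      linear_combination (-1 / 2 : ℂ) * h2'
    have h4 : ((n : ℂ) * Complex.I) ≠ 0 := by simp [hn]
    simpa using (mul_eq_zero.mp h3).resolve_left h4
  have : y ∈ LinearMap.range (ℓ : A.graph →ₗ[ℂ] E) := htop ▸ Submodule.mem_top
  obtain ⟨p, hp⟩ := this
  refine ⟨p.1.1, graph_ext p.2 rfl ?_⟩
  rw [← hp]
  simp [ℓ]

theorem resolvent_unique (hA : IsSelfAdjoint A) {n : ℝ} (hn : n ≠ 0) {y x x' : E}
    (h : (x, y - ((n : ℂ) * Complex.I) • x) ∈ A.graph)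
    (h' : (x', y - ((n : ℂ) * Complex.I) • x') ∈ A.graph) : x = x' := by
  have h1 := A.graph.sub_mem h h'
  have h2 := norm_sq_add_smul_I hA n h1
  have h3 : y - ((n : ℂ) * Complex.I) • x - (y - ((n : ℂ) * Complex.I) • x') +
      ((n : ℂ) * Complex.I) • (x - x') = 0 := by module
  rw [h3, norm_zero] at h2
  have h4 : n ^ 2 * ‖x - x'‖ ^ 2 = 0 := by
    have := sq_nonneg ‖y - ((n : ℂ) * Complex.I) • x - (y - ((n : ℂ) * Complex.I) • x')‖
    have h5 : 0 ≤ n ^ 2 * ‖x - x'‖ ^ 2 := by positivity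
    nlinarith
  have h5 : ‖x - x'‖ = 0 := by simpa [hn] using h4
  exact sub_eq_zero.mp (norm_eq_zero.mp h5)

/-- The resolvent `(A + i n)⁻¹` of a self-adjoint operator, for real `n ≠ 0`. -/
theorem exists_resolvent (hA : IsSelfAdjoint A) {n : ℝ} (hn : n ≠ 0) :
    ∃ R : E →L[ℂ] E, (∀ y, (R y, y - ((n : ℂ) * Complex.I) • R y) ∈ A.graph) ∧
      ∀ y, ‖R y‖ ≤ |n|⁻¹ * ‖y‖ := by
  choose r hr using exists_resolvent_eq hA hn
  have hbd : ∀ y, ‖r y‖ ≤ |n|⁻¹ * ‖y‖ := fun y => by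
    have h2 := norm_sq_add_smul_I hA n (hr y)
    rw [sub_add_cancel] at h2
    rw [inv_mul_eq_div, le_div_iff₀ (abs_pos.mpr hn)]
    refine le_of_sq_le_sq ?_ (norm_nonneg _)
    rw [h2, mul_pow, sq_abs]
    nlinarith [sq_nonneg ‖y - ((n : ℂ) * Complex.I) • r y‖]
  refine ⟨LinearMap.mkContinuous
    { toFun := r
      map_add' := fun x y => ?_
      map_smul' := fun c x => ?_ } _ hbd, hr, hbd⟩
  · refine resolvent_unique hA hn (hr _) (graph_ext (graph_add_mem (hr x) (hr y)) rfl ?_)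
    module
  · refine resolvent_unique hA hn (hr _) (graph_ext (graph_smul_mem c (hr x)) rfl ?_)
    simp only [RingHom.id_apply]
    module

end SelfAdjoint

/-! ### Bounded generators -/

section Bounded

variable {E : Type*} [NormedAddCommGroup E] [InnerProductSpace ℂ E] [CompleteSpace E]

theorem bexpI_zero (B : E →L[ℂ] E) : bexpI B 0 = 1 := by
  simp [bexpI]

theorem bexpI_add (B : E →L[ℂ] E) (s t : ℝ) : bexpI B (s + t) = bexpI B s * bexpI B t := by
  let _ : NormedAlgebra ℚ (E →L[ℂ] E) := NormedAlgebra.restrictScalars ℚ ℂ _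
  rw [bexpI, bexpI, bexpI, ← NormedSpace.exp_add_of_commute]
  · congr 1
    push_cast
    module
  · exact ((Commute.refl B).smul_left _).smul_right _

theorem bexpI_mul_neg (B : E →L[ℂ] E) (t : ℝ) : bexpI B t * bexpI B (-t) = 1 := by
  rw [← bexpI_add, add_neg_cancel, bexpI_zero]

theorem commute_bexpI {B C : E →L[ℂ] E} (h : Commute C B) (t : ℝ) : Commute C (bexpI B t) :=
  (h.smul_right _).exp_right

theorem hasDerivAt_bexpI (B : E →L[ℂ] E) (t : ℝ) :
    HasDerivAt (bexpI B) (-Complex.I • (B * bexpI B t)) t := by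
  have h := hasDerivAt_exp_smul_const' (𝕂 := ℝ) (-Complex.I • B) t
  have hfun : bexpI B = fun u : ℝ => NormedSpace.exp (u • (-Complex.I • B)) := by
    funext u
    rw [bexpI]
    congr 1
    rw [← Complex.coe_smul, smul_smul]
    congr 1
    ring
  rw [hfun]
  exact h.congr_deriv (smul_mul_assoc _ _ _)

theorem continuous_bexpI (B : E →L[ℂ] E) : Continuous (bexpI B) :=
  continuous_iff_continuousAt.mpr fun t => (hasDerivAt_bexpI B t).continuousAt

theorem hasDerivAt_apply {F : Type*} [NormedAddCommGroup F] [InnerProductSpace ℂ F]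
    {T : ℝ → E →L[ℂ] F} {T' : E →L[ℂ] F} {u : ℝ → E} {u' : E} {t : ℝ}
    (hT : HasDerivAt T T' t) (hu : HasDerivAt u u' t) :
    HasDerivAt (fun s => T s (u s)) (T' (u t) + T t u') t := by
  have h1 : HasDerivAt (fun s => (T s).restrictScalars ℝ) (T'.restrictScalars ℝ) t :=
    (ContinuousLinearMap.restrictScalarsL ℂ E F ℝ ℝ).hasFDerivAt.comp_hasDerivAt t hT
  exact h1.clm_apply hu

theorem hasDerivAt_bexpI_apply (B : E →L[ℂ] E) (x : E) (t : ℝ) :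
    HasDerivAt (fun u => bexpI B u x) (-Complex.I • bexpI B t (B x)) t := by
  have h := hasDerivAt_apply (hasDerivAt_bexpI B t) (hasDerivAt_const t x)
  refine h.congr_deriv ?_
  rw [(commute_bexpI (Commute.refl B) t).eq]
  simp

theorem bexpI_mem_unitary {B : E →L[ℂ] E} (hB : IsSelfAdjoint B) (t : ℝ) :
    bexpI B t ∈ unitary (E →L[ℂ] E) := by
  let _ : NormedAlgebra ℚ (E →L[ℂ] E) := NormedAlgebra.restrictScalars ℚ ℂ _
  refine NormedSpace.exp_mem_unitary_of_mem_skewAdjoint ?_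
  rw [skewAdjoint.mem_iff, star_smul, hB.star_eq, ← neg_smul]
  congr 1
  simp

theorem norm_map_of_mem_unitary {U : E →L[ℂ] E} (hU : U ∈ unitary (E →L[ℂ] E)) (x : E) :
    ‖U x‖ = ‖x‖ :=
  ContinuousLinearMap.norm_map_of_mem_unitary hU x

theorem norm_bexpI_sub_le {B : E →L[ℂ] E} (hB : IsSelfAdjoint B) (x : E) (s t : ℝ) :
    ‖bexpI B t x - bexpI B s x‖ ≤ ‖B x‖ * |t - s| := by
  refine Convex.norm_image_sub_le_of_norm_hasDerivWithin_le (s := Set.univ)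
    (fun u _ => (hasDerivAt_bexpI_apply B x u).hasDerivWithinAt) (fun u _ => ?_) convex_univ
    (Set.mem_univ _) (Set.mem_univ _)
  rw [norm_smul, norm_map_of_mem_unitary (bexpI_mem_unitary hB u)]
  simp

theorem norm_bexpI_sub_bexpI_le {B C : E →L[ℂ] E} (hB : IsSelfAdjoint B) (hC : IsSelfAdjoint C)
    (hBC : Commute B C) (x : E) (t : ℝ) :
    ‖bexpI B t x - bexpI C t x‖ ≤ ‖B x - C x‖ * |t| := by
  let _ : NormedAlgebra ℚ (E →L[ℂ] E) := NormedAlgebra.restrictScalars ℚ ℂ _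
  have h1 : bexpI B t = bexpI C t * bexpI (B - C) t := by
    rw [bexpI, bexpI, bexpI, ← NormedSpace.exp_add_of_commute]
    · congr 1
      module
    · exact (((hBC.symm.sub_right (Commute.refl C))).smul_left _).smul_right _
  have h2 := norm_bexpI_sub_le (hB.sub hC) x 0 t
  rw [bexpI_zero, sub_zero] at h2
  rw [h1]
  calc ‖(bexpI C t * bexpI (B - C) t) x - bexpI C t x‖
      = ‖bexpI C t (bexpI (B - C) t x - x)‖ := by simp
    _ = ‖bexpI (B - C) t x - x‖ := norm_map_of_mem_unitary (bexpI_mem_unitary hC t) _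
    _ ≤ _ := by simpa using h2

end Bounded

/-! ### Stone's theorem -/

section Stone

variable {E : Type*} [NormedAddCommGroup E] [InnerProductSpace ℂ E] [CompleteSpace E]
  {A : E →ₗ.[ℂ] E}

/-- Bounded self-adjoint commuting approximations of a self-adjoint operator. -/
theorem exists_yosida (hA : IsSelfAdjoint A) : ∃ B : ℕ → E →L[ℂ] E,
    (∀ n, IsSelfAdjoint (B n)) ∧ (∀ n m, Commute (B n) (B m)) ∧
    ∀ x y, (x, y) ∈ A.graph → Tendsto (fun n => B n x) atTop (𝓝 y) := by
  have hR : ∀ n : ℝ, ∃ R : E →L[ℂ] E, n ≠ 0 →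
      (∀ y, (R y, y - ((n : ℂ) * Complex.I) • R y) ∈ A.graph) ∧
        ∀ y, ‖R y‖ ≤ |n|⁻¹ * ‖y‖ := fun n => by
    by_cases hn : n = 0
    · exact ⟨0, fun h => absurd hn h⟩
    · obtain ⟨R, h⟩ := exists_resolvent hA hn
      exact ⟨R, fun _ => h⟩
  choose R hR using hR
  have hcomm : ∀ n m : ℝ, n ≠ 0 → m ≠ 0 → Commute (R n) (R m) := by
    intro n m hn hm
    ext y
    have h1 := (hR m hm).1 y
    have h2 := (hR n hn).1 (R m y)
    have h3 : R m y + (((m - n : ℝ) : ℂ) * Complex.I) • R n (R m y) = R n y := by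
      refine resolvent_unique hA hn ?_ ((hR n hn).1 y)
      refine graph_ext (graph_add_mem h1 (graph_smul_mem (((m - n : ℝ) : ℂ) * Complex.I) h2))
        rfl ?_
      push_cast
      module
    refine resolvent_unique hA hm (y := R n y) ?_ ((hR m hm).1 (R n y))
    refine graph_ext h2 rfl ?_
    change _ = R n y - ((m : ℂ) * Complex.I) • R n (R m y)
    rw [← h3]
    push_cast
    module
  have hadj : ∀ n : ℝ, n ≠ 0 → star (R n) = R (-n) := by
    intro n hn
    rw [ContinuousLinearMap.star_eq_adjoint]
    refine ((ContinuousLinearMap.eq_adjoint_iff _ _).mpr fun x y => ?_).symm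
    have h1 := (hR n hn).1 y
    have h2 := (hR (-n) (neg_ne_zero.mpr hn)).1 x
    have h3 := symm_of_isSelfAdjoint hA h1 h2
    rw [inner_sub_left, inner_sub_right, inner_smul_left, inner_smul_right] at h3
    simp only [Complex.ofReal_neg, map_mul, map_neg, Complex.conj_ofReal, Complex.conj_I] at h3
    linear_combination -h3
  have hstrong : ∀ (σ : ℝ), σ = 1 ∨ σ = -1 → ∀ x : E,
      Tendsto (fun n : ℕ => ((σ * (n + 1) : ℝ) * Complex.I : ℂ) • R (σ * (n + 1)) x)
        atTop (𝓝 x) := by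
    intro σ hσ
    have habs : ∀ n : ℕ, |σ * ((n : ℝ) + 1)| = n + 1 := fun n => by
      have : (0 : ℝ) < n + 1 := by positivity
      rw [abs_mul, abs_of_pos this]
      rcases hσ with h | h <;> rw [h] <;> simp
    have hσ0 : ∀ n : ℕ, σ * ((n : ℝ) + 1) ≠ 0 := fun n => by
      rw [← abs_pos, habs]
      positivity
    have hbd : ∀ (n : ℕ) (x : E),
        ‖((σ * (n + 1) : ℝ) * Complex.I : ℂ) • R (σ * (n + 1)) x‖ ≤ ‖x‖ := fun n x => by
      have h1 := (hR _ (hσ0 n)).2 x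
      rw [habs] at h1
      rw [norm_smul]
      have h2 : ‖((σ * (n + 1) : ℝ) * Complex.I : ℂ)‖ = n + 1 := by
        rw [norm_mul, Complex.norm_I, mul_one, Complex.norm_real, Real.norm_eq_abs, habs]
      rw [h2]
      have h3 : (0 : ℝ) < n + 1 := by positivity
      calc ((n : ℝ) + 1) * ‖R (σ * (n + 1)) x‖ ≤ (n + 1) * (((n : ℝ) + 1)⁻¹ * ‖x‖) := by gcongr
        _ = ‖x‖ := by field_simp
    have hdom : ∀ x ∈ A.domain, Tendsto (fun n : ℕ =>
        ((σ * (n + 1) : ℝ) * Complex.I : ℂ) • R (σ * (n + 1)) x) atTop (𝓝 x) := by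
      intro x hx
      obtain ⟨y, hy⟩ := exists_mem_graph hx
      have hkey : ∀ n : ℕ, ((σ * (n + 1) : ℝ) * Complex.I : ℂ) • R (σ * (n + 1)) x - x =
          -R (σ * (n + 1)) y := fun n => by
        have h1 := (hR _ (hσ0 n)).1 (y + ((σ * (n + 1) : ℝ) * Complex.I : ℂ) • x)
        have h2 : R (σ * (n + 1)) (y + ((σ * (n + 1) : ℝ) * Complex.I : ℂ) • x) = x :=
          resolvent_unique hA (hσ0 n) h1 (graph_ext hy rfl (by module))
        rw [map_add, map_smul] at h2
        nth_rewrite 2 [← h2]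
        module
      rw [tendsto_iff_norm_sub_tendsto_zero]
      refine squeeze_zero (fun _ => norm_nonneg _) (fun n => ?_)
        (g := fun n : ℕ => ((n : ℝ) + 1)⁻¹ * ‖y‖) ?_
      · rw [hkey, norm_neg]
        have := (hR _ (hσ0 n)).2 y
        rwa [habs] at this
      · have := (tendsto_one_div_add_atTop_nhds_zero_nat (𝕜 := ℝ)).mul_const ‖y‖
        simpa using this
    intro x
    rw [Metric.tendsto_atTop]
    intro ε hε
    obtain ⟨z, hz, hxz⟩ := Metric.dense_iff.mp hA.dense_domain x (ε / 3) (by positivity)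
    obtain ⟨N, hN⟩ := Metric.tendsto_atTop.mp (hdom z hxz) (ε / 3) (by positivity)
    refine ⟨N, fun n hn => ?_⟩
    have h1 := hN n hn
    have h2 := hbd n (x - z)
    rw [map_sub, smul_sub] at h2
    rw [Metric.mem_ball, dist_comm, dist_eq_norm] at hz
    rw [dist_eq_norm] at h1 ⊢
    set a := ((σ * (n + 1) : ℝ) * Complex.I : ℂ) • R (σ * (n + 1)) x
    set b := ((σ * (n + 1) : ℝ) * Complex.I : ℂ) • R (σ * (n + 1)) z
    calc ‖a - x‖ = ‖(a - b) + (b - z) - (x - z)‖ := by congr 1; abel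
      _ ≤ ‖a - b‖ + ‖b - z‖ + ‖x - z‖ := (norm_sub_le _ _).trans (by gcongr; exact norm_add_le _ _)
      _ < ε := by linarith
  refine ⟨fun n => (((n + 1 : ℝ) ^ 2 / 2 : ℝ) : ℂ) • (R (1 * (n + 1)) + R (-1 * (n + 1))),
    fun n => ?_, fun n m => ?_, fun x y hxy => ?_⟩
  · have h0 : (1 * ((n : ℝ) + 1)) ≠ 0 := by positivity
    have h1 := hadj _ h0
    have h2 : star (R (-1 * ((n : ℝ) + 1))) = R (1 * (n + 1)) := by
      rw [← star_star (R (1 * ((n : ℝ) + 1))), h1]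
      congr 2; ring
    rw [IsSelfAdjoint, star_smul, star_add, h1, h2]
    have h3 : -(1 * ((n : ℝ) + 1)) = -1 * (n + 1) := by ring
    rw [h3, add_comm (R (-1 * ((n : ℝ) + 1)))]
    congr 1
    simp
  · have h0 : ∀ n : ℕ, (1 * ((n : ℝ) + 1)) ≠ 0 := fun n => by positivity
    have h1 : ∀ n : ℕ, (-1 * ((n : ℝ) + 1)) ≠ 0 := fun n => by
      have := h0 n
      simp only [one_mul, neg_mul, ne_eq, neg_eq_zero] at this ⊢
      exact this
    refine Commute.smul_left (Commute.smul_right (Commute.add_left ?_ ?_) _) _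
    · exact (hcomm _ _ (h0 n) (h0 m)).add_right (hcomm _ _ (h0 n) (h1 m))
    · exact (hcomm _ _ (h1 n) (h0 m)).add_right (hcomm _ _ (h1 n) (h1 m))
  · have h0 : ∀ σ : ℝ, σ = 1 ∨ σ = -1 → ∀ n : ℕ,
        R (σ * ((n : ℝ) + 1)) (y + ((σ * (n + 1) : ℝ) * Complex.I : ℂ) • x) = x := by
      intro σ hσ n
      have h00 : σ * ((n : ℝ) + 1) ≠ 0 := by
        have : (0 : ℝ) < n + 1 := by positivity
        rcases hσ with h | h <;> rw [h] <;> simp only [one_mul, neg_mul, ne_eq, neg_eq_zero] <;>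
          exact this.ne'
      exact resolvent_unique hA h00 ((hR _ h00).1 _) (graph_ext hxy rfl (by module))
    have h2 := ((hstrong 1 (Or.inl rfl) y).add (hstrong (-1) (Or.inr rfl) y)).const_smul
      ((1 / 2 : ℝ) : ℂ)
    have h3 : ((1 / 2 : ℝ) : ℂ) • (y + y) = y := by
      push_cast
      module
    rw [h3] at h2
    refine h2.congr fun n => ?_
    have h4 := h0 1 (Or.inl rfl) n
    have h5 := h0 (-1) (Or.inr rfl) n
    rw [map_add, map_smul] at h4 h5
    have h6 : R (1 * ((n : ℝ) + 1)) y = x - ((1 * (n + 1) : ℝ) * Complex.I : ℂ) •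
        R (1 * ((n : ℝ) + 1)) x := eq_sub_of_add_eq h4
    have h7 : R (-1 * ((n : ℝ) + 1)) y = x - ((-1 * (n + 1) : ℝ) * Complex.I : ℂ) •
        R (-1 * ((n : ℝ) + 1)) x := eq_sub_of_add_eq h5
    rw [h6, h7]
    simp only [smul_sub, smul_add, smul_smul, smul_apply, add_apply]
    generalize R (1 * ((n : ℝ) + 1)) x = p
    generalize R (-1 * ((n : ℝ) + 1)) x = q
    push_cast
    match_scalars <;> ring_nf <;> simp [Complex.I_sq] <;> ring

theorem IsUnitaryGroup.norm_map {U : ℝ → E →L[ℂ] E} (hU : IsUnitaryGroup U) (t : ℝ) (x : E) :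
    ‖U t x‖ = ‖x‖ :=
  norm_map_of_mem_unitary (hU.mem_unitary t) x

theorem IsUnitaryGroup.neg_apply_self {U : ℝ → E →L[ℂ] E} (hU : IsUnitaryGroup U) (t : ℝ) (x : E) :
    U (-t) (U t x) = x := by
  have h := hU.map_add (-t) t
  rw [neg_add_cancel, hU.map_zero] at h
  exact (DFunLike.congr_fun h x).symm

theorem IsUnitaryGroup.apply_neg_self {U : ℝ → E →L[ℂ] E} (hU : IsUnitaryGroup U) (t : ℝ) (x : E) :
    U t (U (-t) x) = x := by
  have h := hU.neg_apply_self (-t) x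
  rwa [neg_neg] at h

theorem IsUnitaryGroup.inner_map {U : ℝ → E →L[ℂ] E} (hU : IsUnitaryGroup U) (t : ℝ) (x y : E) :
    ⟪U t x, U t y⟫_ℂ = ⟪x, y⟫_ℂ :=
  ContinuousLinearMap.inner_map_map_of_mem_unitary (hU.mem_unitary t) x y

theorem IsUnitaryGroup.inner_neg {U : ℝ → E →L[ℂ] E} (hU : IsUnitaryGroup U) (t : ℝ) (x y : E) :
    ⟪U (-t) x, y⟫_ℂ = ⟪x, U t y⟫_ℂ := by
  rw [← hU.inner_map t (U (-t) x) y, hU.apply_neg_self]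

theorem IsUnitaryGroup.adjoint_eq {U : ℝ → E →L[ℂ] E} (hU : IsUnitaryGroup U) (t : ℝ) :
    adjoint (U t) = U (-t) :=
  ((ContinuousLinearMap.eq_adjoint_iff _ _).mpr fun x y => hU.inner_neg t x y).symm

/-- A pointwise limit of linear isometries is continuous in the parameter if the orbits of a dense
set are. -/
theorem continuous_orbit_of_dense {F : Type*} [NormedAddCommGroup F] [InnerProductSpace ℂ F]
    {U : ℝ → E →L[ℂ] F} (hU : ∀ t x, ‖U t x‖ ≤ ‖x‖) {S : Set E} (hS : Dense S)
    (h : ∀ x ∈ S, Continuous fun t => U t x) (x : E) : Continuous fun t => U t x := by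
  obtain ⟨z, hz, hlim⟩ := mem_closure_iff_seq_limit.mp (hS x)
  refine TendstoUniformly.continuous (F := fun n t => U t (z n)) (p := atTop) ?_
    (Frequently.of_forall fun n => h _ (hz n))
  rw [Metric.tendstoUniformly_iff]
  intro ε hε
  filter_upwards [Metric.tendsto_nhds.mp hlim ε hε] with n hn t
  rw [dist_eq_norm, ← map_sub]
  refine (hU t _).trans_lt ?_
  rwa [dist_comm, dist_eq_norm] at hn

theorem exists_unitaryGroup (hA : IsSelfAdjoint A) :
    ∃ U : ℝ → E →L[ℂ] E, IsUnitaryGroup U ∧ IsGeneratedBy U A := by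
  obtain ⟨B, hBsa, hBcomm, hBlim⟩ := exists_yosida hA
  have hiso : ∀ n t x, ‖bexpI (B n) t x‖ = ‖x‖ := fun n t x =>
    norm_map_of_mem_unitary (bexpI_mem_unitary (hBsa n) t) x
  have hcauchy : ∀ t x, CauchySeq fun n => bexpI (B n) t x := by
    intro t x
    rw [Metric.cauchySeq_iff]
    intro ε hε
    obtain ⟨z, hz, hzd⟩ := Metric.dense_iff.mp hA.dense_domain x (ε / 4) (by positivity)
    obtain ⟨y, hy⟩ := exists_mem_graph hzd
    have h1 := ((hBlim z y hy).cauchySeq)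
    rw [Metric.cauchySeq_iff] at h1
    obtain ⟨N, hN⟩ := h1 (ε / (4 * (|t| + 1))) (by positivity)
    refine ⟨N, fun m hm n hn => ?_⟩
    have h2 := hN m hm n hn
    rw [dist_eq_norm] at h2 ⊢
    rw [Metric.mem_ball, dist_comm, dist_eq_norm] at hz
    have h3 := norm_bexpI_sub_bexpI_le (hBsa m) (hBsa n) (hBcomm m n) z t
    have h4 : ‖B m z - B n z‖ * |t| ≤ ε / 4 := by
      calc ‖B m z - B n z‖ * |t| ≤ ε / (4 * (|t| + 1)) * (|t| + 1) := by
            gcongr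
            linarith
        _ = ε / 4 := by field_simp
    have h5 : ‖bexpI (B m) t x - bexpI (B m) t z‖ = ‖x - z‖ := by rw [← map_sub, hiso]
    have h6 : ‖bexpI (B n) t x - bexpI (B n) t z‖ = ‖x - z‖ := by rw [← map_sub, hiso]
    calc ‖bexpI (B m) t x - bexpI (B n) t x‖
        = ‖(bexpI (B m) t x - bexpI (B m) t z) + (bexpI (B m) t z - bexpI (B n) t z) -
            (bexpI (B n) t x - bexpI (B n) t z)‖ := by congr 1; abel
      _ ≤ ‖bexpI (B m) t x - bexpI (B m) t z‖ + ‖bexpI (B m) t z - bexpI (B n) t z‖ +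
            ‖bexpI (B n) t x - bexpI (B n) t z‖ :=
          (norm_sub_le _ _).trans (by gcongr; exact norm_add_le _ _)
      _ < ε := by rw [h5, h6]; linarith
  choose f hf using fun t x => cauchySeq_tendsto_of_complete (hcauchy t x)
  let U : ℝ → E →L[ℂ] E := fun t =>
    continuousLinearMapOfTendsto (g := fun n => bexpI (B n) t) (f := f t)
      (tendsto_pi_nhds.mpr (hf t))
  have hU : ∀ t x, Tendsto (fun n => bexpI (B n) t x) atTop (𝓝 (U t x)) := hf
  have hUiso : ∀ t x, ‖U t x‖ = ‖x‖ := fun t x =>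
    tendsto_nhds_unique (hU t x).norm (by simp only [hiso]; exact tendsto_const_nhds)
  have hU0 : U 0 = 1 := by
    ext x
    refine tendsto_nhds_unique (hU 0 x) ?_
    simp only [bexpI_zero]
    exact tendsto_const_nhds
  have hUmul : ∀ t {z : ℕ → E} {x : E}, Tendsto z atTop (𝓝 x) →
      Tendsto (fun n => bexpI (B n) t (z n)) atTop (𝓝 (U t x)) := by
    intro t z x hz
    have h1 : Tendsto (fun n => bexpI (B n) t (z n) - bexpI (B n) t x) atTop (𝓝 0) := by
      rw [tendsto_zero_iff_norm_tendsto_zero]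
      simp only [← map_sub, hiso]
      exact tendsto_iff_norm_sub_tendsto_zero.mp hz
    simpa using h1.add (hU t x)
  have hUadd : ∀ s t, U (s + t) = U s * U t := by
    intro s t
    ext x
    refine tendsto_nhds_unique (hU (s + t) x) ?_
    simp only [bexpI_add]
    exact hUmul s (hU t x)
  have hlip : ∀ x y, (x, y) ∈ A.graph → ∀ s t, ‖U t x - U s x‖ ≤ ‖y‖ * |t - s| := by
    intro x y hxy s t
    refine le_of_tendsto_of_tendsto' ((hU t x).sub (hU s x)).norm
      ((hBlim x y hxy).norm.mul_const _) fun n => norm_bexpI_sub_le (hBsa n) x s t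
  have hcont : ∀ x, Continuous fun t => U t x := by
    refine continuous_orbit_of_dense (fun t x => (hUiso t x).le) hA.dense_domain fun x hx => ?_
    obtain ⟨y, hy⟩ := exists_mem_graph hx
    refine (LipschitzWith.of_dist_le_mul (K := ‖y‖₊) fun s t => ?_).continuous
    rw [dist_eq_norm, Real.dist_eq]
    exact hlip x y hy t s
  have hgrp : IsUnitaryGroup U := by
    refine ⟨hU0, hUadd, fun t => ?_, hcont⟩
    have hadj : adjoint (U t) * U t = 1 := by
      have := (ContinuousLinearMap.norm_map_iff_adjoint_comp_self (U t)).mp (hUiso t)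
      exact this
    have hinv : U t * U (-t) = 1 := by rw [← hUadd, add_neg_cancel, hU0]
    have heq : adjoint (U t) = U (-t) := by
      calc adjoint (U t) = adjoint (U t) * (U t * U (-t)) := by rw [hinv, mul_one]
        _ = U (-t) := by rw [← mul_assoc, hadj, one_mul]
    rw [Unitary.mem_iff, star_eq_adjoint]
    exact ⟨hadj, heq ▸ hinv⟩
  have hderiv : ∀ x y, (x, y) ∈ A.graph → HasDerivAt (fun t => U t x) (-Complex.I • y) 0 := by
    intro x y hxy
    have hint : ∀ t, U t x - x = ∫ s in (0 : ℝ)..t, -Complex.I • U s y := by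
      intro t
      have h1 : ∀ n, bexpI (B n) t x - x = ∫ s in (0 : ℝ)..t, -Complex.I • bexpI (B n) s (B n x) := by
        intro n
        rw [intervalIntegral.integral_eq_sub_of_hasDerivAt
          (fun s _ => hasDerivAt_bexpI_apply (B n) x s), bexpI_zero]
        · simp
        · refine Continuous.intervalIntegrable ?_ _ _
          exact (((continuous_bexpI (B n)).clm_apply continuous_const).const_smul _)
      have h2 := (hU t x).sub_const x
      simp only [h1] at h2
      refine tendsto_nhds_unique h2 ?_
      obtain ⟨C, hC⟩ := (hBlim x y hxy).norm.bddAbove_range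
      refine intervalIntegral.tendsto_integral_filter_of_dominated_convergence (fun _ => C)
        (Eventually.of_forall fun n => ?_) (Eventually.of_forall fun n => ?_)
        intervalIntegrable_const (ae_of_all _ fun s _ => ?_)
      · refine Continuous.aestronglyMeasurable ?_
        exact (((continuous_bexpI (B n)).clm_apply continuous_const).const_smul _)
      · refine ae_of_all _ fun s _ => ?_
        rw [norm_smul, hiso]
        simpa using hC ⟨n, rfl⟩
      · exact (hUmul s (hBlim x y hxy)).const_smul _
    have h3 : (fun t => U t x) = fun t => x + ∫ s in (0 : ℝ)..t, -Complex.I • U s y := by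
      funext t
      rw [← hint]
      abel
    rw [h3]
    have hc : Continuous fun s => -Complex.I • U s y := (hcont y).const_smul _
    have h4 := (intervalIntegral.integral_hasDerivAt_right (hc.intervalIntegrable 0 0)
      (hc.stronglyMeasurableAtFilter _ _) hc.continuousAt).const_add x
    simpa [hU0] using h4
  refine ⟨U, hgrp, fun x y => ⟨hderiv x y, fun h => ?_⟩⟩
  rw [mem_graph_iff_of_isSelfAdjoint hA]
  intro z w hzw
  have h1 := (hderiv z w hzw).inner ℂ h
  simp only [hgrp.inner_map] at h1
  have h2 := h1.unique (hasDerivAt_const _ _)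
  have h0 : ∀ x, U 0 x = x := fun x => by rw [hU0]; rfl
  simp only [h0, inner_smul_left, inner_smul_right] at h2
  simp only [map_neg, Complex.conj_I, neg_neg, neg_mul] at h2
  have h3 : Complex.I * (⟪w, x⟫_ℂ - ⟪z, y⟫_ℂ) = 0 := by linear_combination h2
  simpa [sub_eq_zero] using h3

theorem isUnitaryGroup_expI (hA : IsSelfAdjoint A) : IsUnitaryGroup (expI A) :=
  (Classical.epsilon_spec (exists_unitaryGroup hA)).1

theorem isGeneratedBy_expI (hA : IsSelfAdjoint A) : IsGeneratedBy (expI A) A :=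
  (Classical.epsilon_spec (exists_unitaryGroup hA)).2

end Stone

/-! ### Evolution equations -/

section Evolution

variable {E : Type*} [NormedAddCommGroup E] [InnerProductSpace ℂ E] [CompleteSpace E]
  {A B : E →ₗ.[ℂ] E}

theorem IsUnitaryGroup.continuous_apply {U : ℝ → E →L[ℂ] E} (hU : IsUnitaryGroup U)
    {X : Type*} [TopologicalSpace X] {φ : X → ℝ} {u : X → E} (hφ : Continuous φ)
    (hu : Continuous u) : Continuous fun s => U (φ s) (u s) := by
  rw [continuous_iff_continuousAt]
  intro s
  have h1 : Tendsto (fun r => U (φ r) (u r - u s)) (𝓝 s) (𝓝 0) := by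
    rw [tendsto_zero_iff_norm_tendsto_zero]
    simp only [hU.norm_map]
    exact tendsto_iff_norm_sub_tendsto_zero.mp hu.continuousAt
  have h2 : Tendsto (fun r => U (φ r) (u s)) (𝓝 s) (𝓝 (U (φ s) (u s))) :=
    ((hU.continuous (u s)).comp hφ).continuousAt
  have h3 := h1.add h2
  simp only [map_sub, sub_add_cancel, zero_add] at h3
  exact h3

theorem IsUnitaryGroup.hasDerivAt {U : ℝ → E →L[ℂ] E} (hU : IsUnitaryGroup U) {x y : E}
    (h : HasDerivAt (fun t => U t x) y 0) (t : ℝ) : HasDerivAt (fun s => U s x) (U t y) t := by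
  have h1 : HasDerivAt (fun s => U (s - t) x) y t := by
    have h0 : HasDerivAt (fun s => U s x) y (t - t) := by rwa [sub_self]
    have h1 := HasDerivAt.scomp (h := fun s => s - t) t h0 ((hasDerivAt_id t).sub_const t)
    rwa [one_smul] at h1
  have h2 := hasDerivAt_apply (hasDerivAt_const t (U t)) h1
  simp only [zero_apply, zero_add] at h2
  refine h2.congr_of_eventuallyEq (Eventually.of_forall fun s => ?_)
  have : s = t + (s - t) := by ring
  change U s x = (U t * U (s - t)) x
  rw [← hU.map_add, ← this]

theorem hasDerivAt_expI (hA : IsSelfAdjoint A) {x y : E} (h : (x, y) ∈ A.graph) (t : ℝ) :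
    HasDerivAt (fun s => expI A s x) (-Complex.I • expI A t y) t := by
  have h1 := (isUnitaryGroup_expI hA).hasDerivAt ((isGeneratedBy_expI hA x y).mp h) t
  simpa using h1

theorem expI_mem_graph (hA : IsSelfAdjoint A) {x y : E} (h : (x, y) ∈ A.graph) (t : ℝ) :
    (expI A t x, expI A t y) ∈ A.graph := by
  rw [isGeneratedBy_expI hA]
  have h1 := hasDerivAt_apply (hasDerivAt_const 0 (expI A t)) ((isGeneratedBy_expI hA x y).mp h)
  simp only [zero_apply, zero_add, map_smul] at h1
  refine h1.congr_of_eventuallyEq (Eventually.of_forall fun s => ?_)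
  change (expI A s * expI A t) x = (expI A t * expI A s) x
  rw [← (isUnitaryGroup_expI hA).map_add, ← (isUnitaryGroup_expI hA).map_add, add_comm]

theorem hasDerivAt_inner_expI (hA : IsSelfAdjoint A) {w w' : E} (hw : (w, w') ∈ A.graph)
    {z : ℝ → E} {y c : E} {t : ℝ} (hz : HasDerivAt z (-Complex.I • (y + c)) t)
    (hzy : (z t, y) ∈ A.graph) :
    HasDerivAt (fun s => ⟪expI A s w, z s⟫_ℂ) (-Complex.I * ⟪expI A t w, c⟫_ℂ) t := by
  refine ((hasDerivAt_expI hA hw t).inner ℂ hz).congr_deriv ?_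
  have h1 := symm_of_isSelfAdjoint hA hzy (expI_mem_graph hA hw t)
  simp only [inner_smul_right, inner_smul_left, inner_add_right, h1]
  simp
  ring

/-- A solution of `z' = -i A z` is given by the unitary group. -/
theorem eq_expI_of_hasDerivAt (hA : IsSelfAdjoint A) {z y : ℝ → E}
    (hz : ∀ t, HasDerivAt z (-Complex.I • y t) t) (hzy : ∀ t, (z t, y t) ∈ A.graph) (t : ℝ) :
    z t = expI A t (z 0) := by
  have hU := isUnitaryGroup_expI hA
  have key : expI A (-t) (z t) = z 0 := by
    refine hA.dense_domain.eq_of_inner_right ℂ fun w hw => ?_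
    obtain ⟨w', hw'⟩ := exists_mem_graph hw
    have hd : ∀ s, HasDerivAt (fun s => ⟪expI A s w, z s⟫_ℂ) 0 s := fun s => by
      have h0 : HasDerivAt z (-Complex.I • (y s + 0)) s := by simpa using hz s
      simpa using hasDerivAt_inner_expI hA hw' h0 (hzy s)
    have hc := is_const_of_deriv_eq_zero (fun s => (hd s).differentiableAt)
      (fun s => (hd s).deriv) t 0
    rw [← hU.inner_map t, hU.apply_neg_self]
    simpa [hU.map_zero] using hc
  rw [← key, hU.apply_neg_self]

/-- Duhamel's formula for a bounded perturbation `B = A + C`. -/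
theorem hasDerivAt_expI_neg_expI (hA : IsSelfAdjoint A) (hB : IsSelfAdjoint B) (C : E →L[ℂ] E)
    (hC : ∀ x y, (x, y) ∈ B.graph → (x, y - C x) ∈ A.graph) (x : E) (t : ℝ) :
    HasDerivAt (fun s => expI A (-s) (expI B s x))
      (-Complex.I • expI A (-t) (C (expI B t x))) t := by
  have hUA := isUnitaryGroup_expI hA
  have hUB := isUnitaryGroup_expI hB
  have hcont : ∀ x, Continuous fun s => -Complex.I • expI A (-s) (C (expI B s x)) := fun x =>
    (hUA.continuous_apply continuous_neg (C.continuous.comp (hUB.continuous x))).const_smul _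
  have hdom : ∀ x ∈ B.domain, ∀ t, expI A (-t) (expI B t x) - x =
      ∫ s in (0 : ℝ)..t, -Complex.I • expI A (-s) (C (expI B s x)) := by
    intro x hx t
    obtain ⟨y, hy⟩ := exists_mem_graph hx
    refine hA.dense_domain.eq_of_inner_right ℂ fun w hw => ?_
    obtain ⟨w', hw'⟩ := exists_mem_graph hw
    have hd : ∀ s, HasDerivAt (fun s => ⟪expI A s w, expI B s x⟫_ℂ)
        ⟪w, -Complex.I • expI A (-s) (C (expI B s x))⟫_ℂ s := fun s => by
      have h0 := hasDerivAt_expI hB hy s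
      have h1 := hasDerivAt_inner_expI hA hw' (z := fun s => expI B s x)
        (y := expI B s y - C (expI B s x)) (c := C (expI B s x)) (t := s)
        (by rwa [sub_add_cancel]) (hC _ _ (expI_mem_graph hB hy s))
      refine h1.congr_deriv ?_
      rw [inner_smul_right, ← hUA.inner_map s w, hUA.apply_neg_self]
    have h2 := intervalIntegral.integral_eq_sub_of_hasDerivAt (a := 0) (b := t) (fun s _ => hd s)
      (Continuous.intervalIntegrable (continuous_const.inner (hcont x)) 0 t)
    have h3 := (innerSL ℂ w).intervalIntegral_comp_comm
      ((hcont x).intervalIntegrable (μ := volume) 0 t)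
    simp only [innerSL_apply_apply] at h3
    rw [← h3, h2, inner_sub_right, ← hUA.inner_map t w, hUA.apply_neg_self]
    simp [hUA.map_zero, hUB.map_zero]
  have hall : ∀ t, expI A (-t) (expI B t x) =
      x + ∫ s in (0 : ℝ)..t, -Complex.I • expI A (-s) (C (expI B s x)) := by
    intro t
    obtain ⟨z, hz, hlim⟩ := mem_closure_iff_seq_limit.mp (hB.dense_domain x)
    have h1 : ∀ s : ℝ, Tendsto (fun n => expI B s (z n)) atTop (𝓝 (expI B s x)) := fun s =>
      ((expI B s).continuous.tendsto x).comp hlim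
    rw [← sub_eq_iff_eq_add']
    refine tendsto_nhds_unique
      ((((expI A (-t)).continuous.tendsto _).comp (h1 t)).sub hlim) ?_
    refine Tendsto.congr (fun n => (hdom (z n) (hz n) t).symm) ?_
    obtain ⟨M, hM⟩ := hlim.norm.bddAbove_range
    refine intervalIntegral.tendsto_integral_filter_of_dominated_convergence
      (fun _ => ‖C‖ * M) (Eventually.of_forall fun n => (hcont (z n)).aestronglyMeasurable)
      (Eventually.of_forall fun n => ae_of_all _ fun s _ => ?_)
      intervalIntegrable_const (ae_of_all _ fun s _ => ?_)
    · rw [norm_smul, hUA.norm_map, norm_neg, Complex.norm_I, one_mul]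
      refine (C.le_opNorm _).trans ?_
      rw [hUB.norm_map]
      gcongr
      exact hM ⟨n, rfl⟩
    · exact ((((expI A (-s)) ∘L C).continuous.tendsto _).comp (h1 s)).const_smul _
  rw [funext hall]
  exact (intervalIntegral.integral_hasDerivAt_right ((hcont x).intervalIntegrable 0 t)
      ((hcont x).stronglyMeasurableAtFilter _ _) (hcont x).continuousAt).const_add x

end Evolution

/-! ### Friedrichs operators are self-adjoint -/

section FriedrichsSelfAdjoint

variable {𝒦 ℋ : Type*}
  [NormedAddCommGroup 𝒦] [InnerProductSpace ℂ 𝒦] [CompleteSpace 𝒦] [FiniteDimensional ℂ 𝒦]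
  [NormedAddCommGroup ℋ] [InnerProductSpace ℂ ℋ] [CompleteSpace ℋ]
  {K : 𝒦 →L[ℂ] 𝒦} {HR : ℋ →ₗ.[ℂ] ℋ}

theorem isSelfAdjoint_of_mem_graph_iff {E : Type*} [NormedAddCommGroup E] [InnerProductSpace ℂ E]
    [CompleteSpace E] {A : E →ₗ.[ℂ] E} (hd : Dense (A.domain : Set E))
    (h : ∀ x y, (x, y) ∈ A.graph ↔ ∀ z w, (z, w) ∈ A.graph → ⟪w, x⟫_ℂ = ⟪z, y⟫_ℂ) :
    IsSelfAdjoint A := by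
  rw [LinearPMap.isSelfAdjoint_def]
  refine LinearPMap.eq_of_eq_graph ?_
  rw [LinearPMap.adjoint_graph_eq_graph_adjoint hd]
  ext ⟨x, y⟩
  rw [Submodule.mem_adjoint_iff, h]
  simp only [sub_eq_zero]

theorem mem_friedrichs_graph_iff (V : 𝒦 →L[ℂ] ℋ) (lam : ℝ) (x y : WithLp 2 (𝒦 × ℋ)) :
    (x, y) ∈ (friedrichs K HR V lam).graph ↔ ∃ w, (x.snd, w) ∈ HR.graph ∧
      y = WithLp.toLp 2 (K x.fst + (lam : ℂ) • adjoint V x.snd, (lam : ℂ) • V x.fst + w) := by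
  rw [LinearPMap.mem_graph_iff]
  constructor
  · rintro ⟨z, hz, hy⟩
    have hz' : (z : WithLp 2 (𝒦 × ℋ)) = x := hz
    subst hz'
    exact ⟨HR ⟨z.1.snd, z.2⟩, HR.mem_graph ⟨z.1.snd, z.2⟩, hy.symm⟩
  · rintro ⟨w, hw, hy⟩
    have hx : x.snd ∈ HR.domain := mem_domain_of_mem_graph hw
    refine ⟨⟨x, hx⟩, rfl, ?_⟩
    have hw' : HR ⟨x.snd, hx⟩ = w :=
      LinearPMap.mem_graph_snd_inj' HR (HR.mem_graph ⟨x.snd, hx⟩) hw rfl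
    change _ = y
    rw [hy, ← hw']
    rfl

theorem isSelfAdjoint_friedrichs (hK : IsSelfAdjoint K) (hHR : IsSelfAdjoint HR)
    (V : 𝒦 →L[ℂ] ℋ) (lam : ℝ) : IsSelfAdjoint (friedrichs K HR V lam) := by
  have hKs : ∀ x y, ⟪K x, y⟫_ℂ = ⟪x, K y⟫_ℂ := fun x y =>
    (ContinuousLinearMap.isSelfAdjoint_iff_isSymmetric.mp hK) x y
  refine isSelfAdjoint_of_mem_graph_iff ?_ fun x y => ⟨fun h z w h' => ?_, fun h => ?_⟩
  · have h1 : Dense ((WithLp.sndₗ 2 ℂ 𝒦 ℋ) ⁻¹' (HR.domain : Set ℋ)) := by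
      have hopen : IsOpenMap (WithLp.sndₗ 2 ℂ 𝒦 ℋ) := by
        have : (WithLp.sndₗ 2 ℂ 𝒦 ℋ : WithLp 2 (𝒦 × ℋ) → ℋ) =
            Prod.snd ∘ (WithLp.prodContinuousLinearEquiv 2 ℂ 𝒦 ℋ) := rfl
        rw [this]
        exact isOpenMap_snd.comp (WithLp.prodContinuousLinearEquiv 2 ℂ 𝒦 ℋ).toHomeomorph.isOpenMap
      exact hHR.dense_domain.preimage hopen
    exact h1
  · rw [mem_friedrichs_graph_iff] at h h'
    obtain ⟨a, ha, rfl⟩ := h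
    obtain ⟨b, hb, rfl⟩ := h'
    have h1 := symm_of_isSelfAdjoint hHR ha hb
    simp only [WithLp.prod_inner_apply, inner_add_left, inner_add_right, inner_smul_left,
      inner_smul_right, Complex.conj_ofReal, hKs, ContinuousLinearMap.adjoint_inner_left,
      ContinuousLinearMap.adjoint_inner_right]
    simp only [WithLp.ofLp_fst, WithLp.ofLp_snd]
    linear_combination h1
  · rw [mem_friedrichs_graph_iff]
    have hfst : ∀ φ : 𝒦, ⟪K φ, x.fst⟫_ℂ + (lam : ℂ) * ⟪V φ, x.snd⟫_ℂ = ⟪φ, y.fst⟫_ℂ := fun φ => by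
      have h1 := h (WithLp.toLp 2 (φ, 0)) _ ((mem_friedrichs_graph_iff V lam _ _).mpr
        ⟨0, HR.graph.zero_mem, rfl⟩)
      simpa [WithLp.prod_inner_apply, inner_smul_left, -Complex.coe_smul] using h1
    have hsnd : ∀ z w, (z, w) ∈ HR.graph →
        (lam : ℂ) * ⟪z, V x.fst⟫_ℂ + ⟪w, x.snd⟫_ℂ = ⟪z, y.snd⟫_ℂ := fun z w hzw => by
      have h1 := h (WithLp.toLp 2 (0, z)) _ ((mem_friedrichs_graph_iff V lam _ _).mpr
        ⟨w, hzw, rfl⟩)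
      simpa [WithLp.prod_inner_apply, inner_smul_left, ContinuousLinearMap.adjoint_inner_left,
        -Complex.coe_smul] using h1
    refine ⟨y.snd - (lam : ℂ) • V x.fst, ?_, ?_⟩
    · rw [mem_graph_iff_of_isSelfAdjoint hHR]
      intro z w hzw
      rw [inner_sub_right, inner_smul_right, ← hsnd z w hzw]
      ring
    · have h1 : y.fst = K x.fst + (lam : ℂ) • adjoint V x.snd := by
        refine ext_inner_left ℂ fun φ => ?_
        rw [← hfst φ, inner_add_right, inner_smul_right, hKs,
          ContinuousLinearMap.adjoint_inner_right]
      rw [← h1, add_sub_cancel]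
      rfl

theorem directSum_apply {E F E' F' : Type*}
    [NormedAddCommGroup E] [InnerProductSpace ℂ E] [NormedAddCommGroup F] [InnerProductSpace ℂ F]
    [NormedAddCommGroup E'] [InnerProductSpace ℂ E'] [NormedAddCommGroup F']
    [InnerProductSpace ℂ F'] (A : E →L[ℂ] E') (B : F →L[ℂ] F') (x : WithLp 2 (E × F)) :
    directSum A B x = WithLp.toLp 2 (A x.fst, B x.snd) := rfl

theorem hasDerivAt_toLp {E F : Type*} [NormedAddCommGroup E] [InnerProductSpace ℂ E]
    [NormedAddCommGroup F] [InnerProductSpace ℂ F] {a : ℝ → E} {b : ℝ → F} {a' : E} {b' : F}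
    {t : ℝ} (ha : HasDerivAt a a' t) (hb : HasDerivAt b b' t) :
    HasDerivAt (fun s => WithLp.toLp 2 (a s, b s)) (WithLp.toLp 2 (a', b')) t :=
  (((WithLp.prodContinuousLinearEquiv 2 ℂ E F).symm : E × F →L[ℂ] WithLp 2 (E × F)).restrictScalars
    ℝ).hasFDerivAt.comp_hasDerivAt t (ha.prodMk hb)

theorem hasDerivAt_fst {E F : Type*} [NormedAddCommGroup E] [InnerProductSpace ℂ E]
    [NormedAddCommGroup F] [InnerProductSpace ℂ F] {a : ℝ → WithLp 2 (E × F)}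
    {a' : WithLp 2 (E × F)} {t : ℝ} (ha : HasDerivAt a a' t) :
    HasDerivAt (fun s => (a s).fst) a'.fst t :=
  ((ContinuousLinearMap.fst ℂ E F ∘L (WithLp.prodContinuousLinearEquiv 2 ℂ E F :
    WithLp 2 (E × F) →L[ℂ] E × F)).restrictScalars ℝ).hasFDerivAt.comp_hasDerivAt t ha

theorem hasDerivAt_snd {E F : Type*} [NormedAddCommGroup E] [InnerProductSpace ℂ E]
    [NormedAddCommGroup F] [InnerProductSpace ℂ F] {a : ℝ → WithLp 2 (E × F)}
    {a' : WithLp 2 (E × F)} {t : ℝ} (ha : HasDerivAt a a' t) :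
    HasDerivAt (fun s => (a s).snd) a'.snd t :=
  ((ContinuousLinearMap.snd ℂ E F ∘L (WithLp.prodContinuousLinearEquiv 2 ℂ E F :
    WithLp 2 (E × F) →L[ℂ] E × F)).restrictScalars ℝ).hasFDerivAt.comp_hasDerivAt t ha

theorem expI_friedrichs_zero (hK : IsSelfAdjoint K) (hHR : IsSelfAdjoint HR) (V : 𝒦 →L[ℂ] ℋ)
    (t : ℝ) : expI (friedrichs K HR V 0) t = directSum (bexpI K t) (expI HR t) := by
  have h0 := isSelfAdjoint_friedrichs hK hHR V 0
  have hU := isUnitaryGroup_expI h0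
  have hUR := isUnitaryGroup_expI hHR
  refine DFunLike.coe_injective (Continuous.ext_on h0.dense_domain
    (ContinuousLinearMap.continuous _) (ContinuousLinearMap.continuous _) fun x hx => ?_)
  obtain ⟨y, hy⟩ := exists_mem_graph hx
  rw [mem_friedrichs_graph_iff] at hy
  obtain ⟨w, hw, hy⟩ := hy
  have h1 := eq_expI_of_hasDerivAt h0 (z := fun s => directSum (bexpI K s) (expI HR s) x)
    (y := fun s => WithLp.toLp 2 (bexpI K s (K x.fst), expI HR s w)) (fun s => ?_) (fun s => ?_) t
  · have h2 : directSum (bexpI K 0) (expI HR 0) x = x := by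
      rw [directSum_apply, bexpI_zero, hUR.map_zero]
      rfl
    rw [h2] at h1
    exact h1.symm
  · simp only [directSum_apply]
    exact hasDerivAt_toLp (hasDerivAt_bexpI_apply K x.fst s) (hasDerivAt_expI hHR hw s)
  · rw [mem_friedrichs_graph_iff]
    refine ⟨expI HR s w, expI_mem_graph hHR hw s, ?_⟩
    simp only [directSum_apply, Complex.ofReal_zero, zero_smul, add_zero, zero_add]
    congr 2
    exact (DFunLike.congr_fun (commute_bexpI (Commute.refl K) s).eq x.fst).symm

end FriedrichsSelfAdjoint

/-! ### Multiplication operators on `L²(ℝ, μ; E)` -/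

section Multiplication

variable {E : Type*} [NormedAddCommGroup E] [InnerProductSpace ℂ E] {μ : Measure ℝ}

theorem norm_exp_I_mul (t x : ℝ) : ‖Complex.exp (Complex.I * t * x)‖ = 1 := by
  rw [mul_assoc, mul_comm Complex.I]
  norm_cast
  exact Complex.norm_exp_ofReal_mul_I _

theorem memLp_char_smul_measure (t : ℝ) (g : Lp E 2 μ) :
    MemLp (fun x : ℝ => Complex.exp (Complex.I * t * x) • g x) 2 μ := by
  refine (Lp.memLp g).of_le ?_ (ae_of_all _ fun x => ?_)
  · exact (Continuous.aestronglyMeasurable (by fun_prop)).smul (Lp.aestronglyMeasurable g)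
  · rw [norm_smul, norm_exp_I_mul, one_mul]

/-- The operator `e^{itx}` of multiplication on `L²(ℝ, μ; E)`. -/
def charOn (μ : Measure ℝ) (t : ℝ) : Lp E 2 μ →L[ℂ] Lp E 2 μ :=
  LinearMap.mkContinuous
    { toFun := fun g => (memLp_char_smul_measure t g).toLp _
      map_add' := fun f g => by
        rw [← MemLp.toLp_add, MemLp.toLp_eq_toLp_iff]
        filter_upwards [Lp.coeFn_add f g] with x hx
        simp only [hx, Pi.add_apply, smul_add]
      map_smul' := fun c f => by
        rw [RingHom.id_apply, ← MemLp.toLp_const_smul, MemLp.toLp_eq_toLp_iff]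
        filter_upwards [Lp.coeFn_smul c f] with x hx
        simp [hx, smul_comm c] } 1 fun g => by
      rw [one_mul]
      refine Lp.norm_le_norm_of_ae_le ?_
      filter_upwards [(memLp_char_smul_measure t g).coeFn_toLp] with x hx
      change ‖((memLp_char_smul_measure t g).toLp _ : ℝ → E) x‖ ≤ _
      rw [hx, norm_smul, norm_exp_I_mul, one_mul]

theorem coeFn_charOn (t : ℝ) (g : Lp E 2 μ) :
    charOn μ t g =ᵐ[μ] fun x => Complex.exp (Complex.I * t * x) • g x :=
  (memLp_char_smul_measure t g).coeFn_toLp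

theorem mulChar_eq_charOn (t : ℝ) : (mulChar t : Lp E 2 volume →L[ℂ] _) = charOn volume t := rfl

theorem norm_charOn (t : ℝ) (g : Lp E 2 μ) : ‖charOn μ t g‖ = ‖g‖ := by
  refine le_antisymm (Lp.norm_le_norm_of_ae_le ?_) (Lp.norm_le_norm_of_ae_le ?_) <;>
  · filter_upwards [coeFn_charOn t g] with x hx
    rw [hx, norm_smul, norm_exp_I_mul, one_mul]

theorem charOn_zero : (charOn μ 0 : Lp E 2 μ →L[ℂ] Lp E 2 μ) = 1 := by
  ext1 g
  refine Lp.ext ?_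
  filter_upwards [coeFn_charOn 0 g] with x hx
  rw [hx]
  simp

theorem charOn_add (s t : ℝ) :
    (charOn μ (s + t) : Lp E 2 μ →L[ℂ] Lp E 2 μ) = charOn μ s * charOn μ t := by
  ext1 g
  refine Lp.ext ?_
  change _ =ᵐ[μ] charOn μ s (charOn μ t g)
  filter_upwards [coeFn_charOn (s + t) g, coeFn_charOn t g, coeFn_charOn s (charOn μ t g)]
    with x h1 h2 h3
  rw [h1, h3, h2, smul_smul, ← Complex.exp_add]
  congr 2
  push_cast
  ring

theorem inner_charOn_neg (t : ℝ) (f g : Lp E 2 μ) :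
    ⟪charOn μ (-t) f, g⟫_ℂ = ⟪f, charOn μ t g⟫_ℂ := by
  rw [L2.inner_def, L2.inner_def]
  refine integral_congr_ae ?_
  filter_upwards [coeFn_charOn (-t) f, coeFn_charOn t g] with x h1 h2
  rw [h1, h2, inner_smul_left, inner_smul_right, ← Complex.exp_conj]
  congr 2
  simp

theorem adjoint_charOn [CompleteSpace E] (t : ℝ) :
    adjoint (charOn μ t : Lp E 2 μ →L[ℂ] Lp E 2 μ) = charOn μ (-t) :=
  ((ContinuousLinearMap.eq_adjoint_iff _ _).mpr fun x y => inner_charOn_neg t x y).symm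

/-- The functions in `L²(ℝ, μ; E)` vanishing outside of a bounded interval. -/
def boundedSupport (E : Type*) [NormedAddCommGroup E] [InnerProductSpace ℂ E] (μ : Measure ℝ) :
    Submodule ℂ (Lp E 2 μ) where
  carrier := {f | ∃ R : ℝ, ∀ᵐ x ∂μ, R < |x| → f x = 0}
  zero_mem' := ⟨0, by filter_upwards [Lp.coeFn_zero E 2 μ] with x hx _; simpa using hx⟩
  add_mem' := by
    rintro f g ⟨R, hR⟩ ⟨S, hS⟩
    refine ⟨max R S, ?_⟩
    filter_upwards [hR, hS, Lp.coeFn_add f g] with x h1 h2 h3 hx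
    rw [h3, Pi.add_apply, h1 ((le_max_left _ _).trans_lt hx), h2 ((le_max_right _ _).trans_lt hx),
      add_zero]
  smul_mem' := by
    rintro c f ⟨R, hR⟩
    refine ⟨R, ?_⟩
    filter_upwards [hR, Lp.coeFn_smul c f] with x h1 h2 hx
    rw [h2, Pi.smul_apply, h1 hx, smul_zero]

theorem dense_boundedSupport [CompleteSpace E] :
    Dense (boundedSupport E μ : Set (Lp E 2 μ)) := by
  rw [Submodule.dense_iff_topologicalClosure_eq_top, Submodule.topologicalClosure_eq_top_iff,
    Submodule.eq_bot_iff]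
  intro f hf
  rw [Submodule.mem_orthogonal] at hf
  have hzero : ∀ n : ℕ, ∀ᵐ x : ℝ ∂μ, |x| ≤ n → f x = 0 := by
    intro n
    have hms : MeasurableSet {x : ℝ | |x| ≤ n} := measurableSet_le (by fun_prop) (by fun_prop)
    have hmem : MemLp ({x : ℝ | |x| ≤ n}.indicator f) 2 μ := (Lp.memLp f).indicator hms
    have h1 := hf (hmem.toLp _) ⟨n, by
      filter_upwards [hmem.coeFn_toLp] with x hx hn
      rw [hx, Set.indicator_of_notMem]
      simpa using hn⟩
    rw [L2.inner_def] at h1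
    have h2 : ∀ᵐ x ∂μ, ⟪(hmem.toLp _ : ℝ → E) x, f x⟫_ℂ =
        (({x : ℝ | |x| ≤ n}.indicator (fun x => ‖f x‖ ^ 2) x : ℝ) : ℂ) := by
      filter_upwards [hmem.coeFn_toLp] with x hx
      rw [hx]
      by_cases hxn : x ∈ {x : ℝ | |x| ≤ n}
      · simp only [Set.indicator_of_mem hxn, inner_self_eq_norm_sq_to_K]
        norm_cast
      · simp [Set.indicator_of_notMem hxn]
    rw [integral_congr_ae h2, integral_complex_ofReal, Complex.ofReal_eq_zero,
      integral_eq_zero_iff_of_nonneg] at h1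
    · filter_upwards [h1] with x hx hxn
      rw [Set.indicator_of_mem (s := {x : ℝ | |x| ≤ n}) hxn] at hx
      simpa using hx
    · exact fun x => Set.indicator_nonneg (fun _ _ => by positivity) _
    · exact ((Lp.memLp f).integrable_norm_pow (by simp)).indicator hms
  refine Lp.ext ?_
  filter_upwards [ae_all_iff.mpr hzero, Lp.coeFn_zero E 2 μ] with x hx h0
  obtain ⟨n, hn⟩ := exists_nat_ge |x|
  rw [h0, hx n hn, Pi.zero_apply]

theorem hasDerivAt_charOn [CompleteSpace E] {f g : Lp E 2 μ} (hf : f ∈ boundedSupport E μ)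
    (hfg : ∀ᵐ x ∂μ, g x = (x : ℂ) • f x) (t : ℝ) :
    HasDerivAt (fun s => charOn μ (-s) f) (-Complex.I • charOn μ (-t) g) t := by
  obtain ⟨R, hR⟩ := hf
  have h0 : HasDerivAt (fun s => charOn μ (-s) f) (-Complex.I • g) 0 := by
    rw [hasDerivAt_iff_isLittleO_nhds_zero]
    have hbig : (fun h : ℝ => charOn μ (-(0 + h)) f - charOn μ (-0) f - h • (-Complex.I • g))
        =O[𝓝 0] fun h => h ^ 2 := by
      refine Asymptotics.IsBigO.of_bound ((|R| + 1) ^ 2 * ‖f‖) ?_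
      have hsmall : ∀ᶠ h : ℝ in 𝓝 0, |h| * (|R| + 1) < 1 := by
        have : ContinuousAt (fun h : ℝ => |h| * (|R| + 1)) 0 := by fun_prop
        exact this.eventually_lt continuousAt_const (by simp)
      filter_upwards [hsmall] with h hh
      have hb : ‖charOn μ (-(0 + h)) f - charOn μ (-0) f - h • (-Complex.I • g)‖ ≤
          (|h| * (|R| + 1)) ^ 2 * ‖f‖ := by
        refine Lp.norm_le_mul_norm_of_ae_le_mul ?_
        rw [neg_zero, charOn_zero, zero_add]
        have e1 := Lp.coeFn_sub (charOn μ (-h) f - (1 : Lp E 2 μ →L[ℂ] Lp E 2 μ) f)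
          (h • (-Complex.I • g))
        have e2 := Lp.coeFn_sub (charOn μ (-h) f) ((1 : Lp E 2 μ →L[ℂ] Lp E 2 μ) f)
        have e3 := Lp.coeFn_smul h (-Complex.I • g)
        have e4 := Lp.coeFn_smul (-Complex.I) g
        filter_upwards [e1, e2, e3, e4, coeFn_charOn (-h) f, hR, hfg] with x h1 h2 h3 h4 h5 h6 h7
        rw [h1, Pi.sub_apply, h2, Pi.sub_apply, h3, Pi.smul_apply, h4, Pi.smul_apply, h5, h7]
        change ‖_ - f x - _‖ ≤ _
        by_cases hx : R < |x|
        · rw [h6 hx]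
          simp
        · have hx' : |x| ≤ |R| + 1 := by
            have := le_abs_self R
            linarith [not_lt.mp hx]
          set z : ℂ := Complex.I * ((-h : ℝ) : ℂ) * x with hz
          have hzn : ‖z‖ = |h| * |x| := by simp [hz]
          have hz1 : ‖z‖ ≤ 1 := by
            rw [hzn]
            refine le_trans ?_ hh.le
            gcongr
          have h8 : Complex.exp z • f x - f x - h • -Complex.I • (x : ℂ) • f x =
              (Complex.exp z - 1 - z) • f x := by
            rw [← Complex.coe_smul h, hz]
            push_cast
            module
          rw [h8, norm_smul]
          refine mul_le_mul_of_nonneg_right ((Complex.norm_exp_sub_one_sub_id_le hz1).trans ?_)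
            (norm_nonneg _)
          rw [hzn]
          gcongr
      refine hb.trans (le_of_eq ?_)
      rw [mul_pow, sq_abs, Real.norm_of_nonneg (sq_nonneg h)]
      ring
    refine hbig.trans_isLittleO ?_
    simpa using Asymptotics.isLittleO_pow_pow (𝕜 := ℝ) (one_lt_two)
  have h1 : HasDerivAt (fun s => charOn μ (-(s - t)) f) (-Complex.I • g) t := by
    have h0' : HasDerivAt (fun s => charOn μ (-s) f) (-Complex.I • g) (t - t) := by
      rwa [sub_self]
    have h1 := HasDerivAt.scomp (h := fun s => s - t) t h0' ((hasDerivAt_id t).sub_const t)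
    rwa [one_smul] at h1
  have h2 := hasDerivAt_apply (hasDerivAt_const t (charOn μ (-t) : Lp E 2 μ →L[ℂ] Lp E 2 μ)) h1
  simp only [zero_apply, zero_add, map_smul] at h2
  refine h2.congr_of_eventuallyEq (Eventually.of_forall fun s => ?_)
  change charOn μ (-s) f = (charOn μ (-t) * charOn μ (-(s - t)) : Lp E 2 μ →L[ℂ] Lp E 2 μ) f
  rw [← charOn_add]
  congr 2
  ring

theorem exists_mul_of_boundedSupport {f : Lp E 2 μ} (hf : f ∈ boundedSupport E μ) :
    ∃ g : Lp E 2 μ, ∀ᵐ x ∂μ, g x = (x : ℂ) • f x := by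
  obtain ⟨R, hR⟩ := hf
  have hm : MemLp (fun x : ℝ => (x : ℂ) • f x) 2 μ := by
    refine (Lp.memLp f).of_le_mul (c := |R|) ?_ ?_
    · exact (Continuous.aestronglyMeasurable (by fun_prop)).smul (Lp.aestronglyMeasurable f)
    · filter_upwards [hR] with x hx
      by_cases h : R < |x|
      · rw [hx h]
        simp
      · rw [norm_smul, Complex.norm_real, Real.norm_eq_abs]
        exact mul_le_mul_of_nonneg_right ((not_lt.mp h).trans (le_abs_self R)) (norm_nonneg _)
  exact ⟨hm.toLp _, hm.coeFn_toLp⟩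

end Multiplication

/-! ### Spectral representations -/

section Spectral

variable {ℋ 𝔥 : Type*} [NormedAddCommGroup ℋ] [InnerProductSpace ℂ ℋ] [CompleteSpace ℋ]
  [NormedAddCommGroup 𝔥] [InnerProductSpace ℂ 𝔥] [CompleteSpace 𝔥]
  {HR : ℋ →ₗ.[ℂ] ℋ} {I : Set ℝ} {W : Lp 𝔥 2 (volume.restrict I) →ₗᵢ[ℂ] ℋ}

theorem expI_apply_of_mul (hHR : IsSelfAdjoint HR)
    (hmul : ∀ f g : Lp 𝔥 2 (volume.restrict I),
      (W f, W g) ∈ HR.graph ↔ ∀ᵐ x ∂volume.restrict I, g x = (x : ℂ) • f x)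
    (t : ℝ) (f : Lp 𝔥 2 (volume.restrict I)) :
    expI HR t (W f) = W (charOn _ (-t) f) := by
  refine DFunLike.congr_fun (f := expI HR t ∘L W.toContinuousLinearMap)
    (g := W.toContinuousLinearMap ∘L charOn _ (-t)) (DFunLike.coe_injective (Continuous.ext_on
      (dense_boundedSupport (E := 𝔥) (μ := volume.restrict I))
    (ContinuousLinearMap.continuous _) (ContinuousLinearMap.continuous _) fun f hf => ?_)) f
  obtain ⟨g, hg⟩ := exists_mul_of_boundedSupport hf
  have h1 := eq_expI_of_hasDerivAt hHR (z := fun s => W (charOn _ (-s) f))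
    (y := fun s => W (charOn _ (-s) g)) (fun s => ?_) (fun s => ?_) t
  · simp only [neg_zero, charOn_zero] at h1
    exact h1.symm
  · have h2 := hasDerivAt_apply (hasDerivAt_const s W.toContinuousLinearMap)
      (hasDerivAt_charOn hf hg s)
    simpa using h2
  · rw [hmul]
    filter_upwards [hg, coeFn_charOn (-s) f, coeFn_charOn (-s) g] with x h1 h2 h3
    rw [h3, h1, h2, smul_comm]

theorem integrable_schwartzCalculus (hHR : IsSelfAdjoint HR) (φ : 𝓢(ℝ, ℂ)) (x : ℋ) :
    Integrable fun t : ℝ => 𝓕 (φ : ℝ → ℂ) t • expI HR (-(2 * Real.pi * t)) x := by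
  have h1 : Integrable (𝓕 (φ : ℝ → ℂ)) := by
    rw [← SchwartzMap.fourier_coe]
    exact (𝓕 φ).integrable
  refine (h1.norm.mul_const ‖x‖).mono' ?_ (ae_of_all _ fun t => ?_)
  · refine h1.aestronglyMeasurable.smul (Continuous.aestronglyMeasurable ?_)
    exact ((isUnitaryGroup_expI hHR).continuous x).comp (by fun_prop)
  · rw [norm_smul, (isUnitaryGroup_expI hHR).norm_map]

theorem inner_schwartzCalculus (hHR : IsSelfAdjoint HR) (φ : 𝓢(ℝ, ℂ)) (x y : ℋ) :
    ⟪y, schwartzCalculus HR φ x⟫_ℂ =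
      ∫ t : ℝ, 𝓕 (φ : ℝ → ℂ) t * ⟪y, expI HR (-(2 * Real.pi * t)) x⟫_ℂ := by
  rw [schwartzCalculus, ← integral_inner (integrable_schwartzCalculus hHR φ x)]
  simp only [inner_smul_right]

theorem inner_schwartzCalculus_of_mul (hHR : IsSelfAdjoint HR)
    (hmul : ∀ f g : Lp 𝔥 2 (volume.restrict I),
      (W f, W g) ∈ HR.graph ↔ ∀ᵐ x ∂volume.restrict I, g x = (x : ℂ) • f x)
    (φ : 𝓢(ℝ, ℂ)) (g : Lp 𝔥 2 (volume.restrict I)) (x : ℋ) :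
    ⟪W g, schwartzCalculus HR φ x⟫_ℂ =
      ∫ y in I, φ y * ⟪g y, (adjoint W.toContinuousLinearMap x : ℝ → 𝔥) y⟫_ℂ := by
  have hU := isUnitaryGroup_expI hHR
  set h := adjoint W.toContinuousLinearMap x with hh
  have h1 : Integrable (𝓕 (φ : ℝ → ℂ)) := by
    rw [← SchwartzMap.fourier_coe]
    exact (𝓕 φ).integrable
  have h2 : ∀ t : ℝ, ⟪W g, expI HR (-(2 * Real.pi * t)) x⟫_ℂ =
      VectorFourier.fourierIntegral Real.fourierChar (volume.restrict I) (-innerₗ ℝ)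
        (fun y => ⟪g y, h y⟫_ℂ) t := by
    intro t
    have e1 := hU.inner_neg (-(2 * Real.pi * t)) (W g) x
    rw [neg_neg] at e1
    have e2 : ⟪W (charOn _ (-(2 * Real.pi * t)) g), x⟫_ℂ =
        ⟪charOn _ (-(2 * Real.pi * t)) g, h⟫_ℂ := by
      rw [hh, ContinuousLinearMap.adjoint_inner_right]
      rfl
    rw [← e1, expI_apply_of_mul hHR hmul, e2, L2.inner_def, VectorFourier.fourierIntegral]
    refine integral_congr_ae ?_
    filter_upwards [coeFn_charOn (-(2 * Real.pi * t)) g] with y hy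
    rw [hy, inner_smul_left, ← Complex.exp_conj, Circle.smul_def, Real.fourierChar_apply,
      smul_eq_mul]
    congr 2
    simp [map_ofNat]
    ring
  have h3 := VectorFourier.integral_fourierIntegral_smul_eq_flip (μ := volume)
    (ν := volume.restrict I) (L := -innerₗ ℝ) Real.continuous_fourierChar
    (by simp only [LinearMap.neg_apply, innerₗ_apply_apply]; fun_prop) h1
    (L2.integrable_inner (𝕜 := ℂ) g h)
  rw [inner_schwartzCalculus hHR]
  simp only [h2]
  have hflip : (-innerₗ ℝ : ℝ →ₗ[ℝ] ℝ →ₗ[ℝ] ℝ).flip = -innerₗ ℝ := by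
    ext
    simp
  rw [hflip] at h3
  simp only [smul_eq_mul] at h3
  rw [← h3]
  refine integral_congr_ae (ae_of_all _ fun y => ?_)
  have h4 : 𝓕⁻ (𝓕 φ) = φ := FourierTransform.fourierInv_fourier_eq φ
  have h5 : (𝓕⁻ (𝓕 φ) : 𝓢(ℝ, ℂ)) y = VectorFourier.fourierIntegral Real.fourierChar volume
      (-innerₗ ℝ) (𝓕 (φ : ℝ → ℂ)) y := by
    rw [SchwartzMap.fourierInv_coe, SchwartzMap.fourier_coe]
    rfl
  rw [h4] at h5
  simp only [h5]

/-- Vectors represented on `I` are orthogonal to the spectral subspace of a disjoint set. -/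
theorem inner_eq_zero_of_disjoint (hHR : IsSelfAdjoint HR)
    (hmul : ∀ f g : Lp 𝔥 2 (volume.restrict I),
      (W f, W g) ∈ HR.graph ↔ ∀ᵐ x ∂volume.restrict I, g x = (x : ℂ) • f x)
    {I' : Set ℝ} (hd : Disjoint I' I) (g : Lp 𝔥 2 (volume.restrict I)) {y : ℋ}
    (hy : y ∈ spectralSubspace HR I') : ⟪W g, y⟫_ℂ = 0 := by
  have hle : spectralSubspace HR I' ≤ (Submodule.span ℂ {W g})ᗮ := by
    refine Submodule.topologicalClosure_minimal _ (Submodule.span_le.mpr ?_)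
      (Submodule.isClosed_orthogonal _)
    rintro _ ⟨φ, x, -, hφ, rfl⟩
    rw [SetLike.mem_coe, Submodule.mem_orthogonal_singleton_iff_inner_right,
      inner_schwartzCalculus_of_mul hHR hmul]
    refine setIntegral_eq_zero_of_forall_eq_zero fun z hz => ?_
    have : φ z = 0 := by
      refine image_eq_zero_of_notMem_tsupport fun h => ?_
      exact Set.disjoint_left.mp hd (hφ h) hz
    rw [this, zero_mul]
  exact (Submodule.mem_orthogonal_singleton_iff_inner_right).mp (hle hy)

end Spectral

/-! ### The dissipation identity -/

section Dissipation

variable {𝒦 ℋ : Type*}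
  [NormedAddCommGroup 𝒦] [InnerProductSpace ℂ 𝒦] [CompleteSpace 𝒦] [FiniteDimensional ℂ 𝒦]
  [NormedAddCommGroup ℋ] [InnerProductSpace ℂ ℋ] [CompleteSpace ℋ]
  {K : 𝒦 →L[ℂ] 𝒦} {HR : ℋ →ₗ.[ℂ] ℋ} {V : 𝒦 →L[ℂ] ℋ}
  {𝔥 : spectrum ℝ K → Type*} [∀ k, NormedAddCommGroup (𝔥 k)]
  [∀ k, InnerProductSpace ℂ (𝔥 k)] [∀ k, CompleteSpace (𝔥 k)]
  {I : spectrum ℝ K → Set ℝ} {W : ∀ k, Lp (𝔥 k) 2 (volume.restrict (I k)) →ₗᵢ[ℂ] ℋ}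
  {v : ∀ k, ℝ → 𝒦 →L[ℂ] 𝔥 k}

theorem IsRegularNearSpectrum.inner_apply (hreg : IsRegularNearSpectrum HR V I W v)
    (k : spectrum ℝ K) (φ : 𝒦) (f : Lp (𝔥 k) 2 (volume.restrict (I k))) :
    ⟪V φ, W k f⟫_ℂ = ∫ y in I k, ⟪v k y φ, f y⟫_ℂ := by
  obtain ⟨g, hg, hPV⟩ := hreg.interaction k φ
  have h1 : W k f ∈ spectralSubspace HR (I k) := by
    rw [← hreg.range_eq k]
    exact ⟨f, rfl⟩
  have h2 : ⟪V φ, W k f⟫_ℂ = ⟪spectralProjection HR (I k) (V φ), W k f⟫_ℂ := by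
    rw [spectralProjection, Submodule.inner_starProjection_left_eq_right,
      Submodule.starProjection_eq_self_iff.mpr h1]
  rw [h2, hPV, LinearIsometry.inner_map_map, L2.inner_def]
  refine integral_congr_ae ?_
  filter_upwards [hg] with y hy
  rw [hy]

theorem IsRegularNearSpectrum.adjoint_apply (hreg : IsRegularNearSpectrum HR V I W v)
    (k : spectrum ℝ K) (φ : 𝒦) :
    ∀ᵐ y ∂volume.restrict (I k),
      (adjoint (W k).toContinuousLinearMap (V φ) : ℝ → 𝔥 k) y = v k y φ := by
  obtain ⟨g, hg, -⟩ := hreg.interaction k φ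
  have h1 : adjoint (W k).toContinuousLinearMap (V φ) = g := by
    refine ext_inner_right ℂ fun f => ?_
    rw [ContinuousLinearMap.adjoint_inner_left, L2.inner_def]
    refine (hreg.inner_apply k φ f).trans (integral_congr_ae ?_)
    filter_upwards [hg] with y hy
    rw [hy]
  rw [h1]
  exact hg

theorem eq_zero_of_ae_eq_zero_of_continuousAt {F : Type*} [TopologicalSpace F] [T1Space F] [Zero F]
    {f : ℝ → F} {k : ℝ} {U : Set ℝ} (hU : U ∈ 𝓝 k) (hf : ∀ᵐ y, y ∈ U → f y = 0)
    (hc : ContinuousAt f k) : f k = 0 := by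
  by_contra h
  have h1 : ∀ᶠ y in 𝓝 k, f y ≠ 0 := hc.eventually_ne h
  have h2 : {y | f y ≠ 0} ∩ U ∈ 𝓝 k := inter_mem h1 hU
  have h3 : volume ({y | f y ≠ 0} ∩ U) = 0 := by
    refine measure_mono_null (fun y hy => ?_) hf
    simp only [Set.mem_compl_iff, Set.mem_ofPred_eq]
    exact fun h => hy.1 (h hy.2)
  exact (Measure.measure_pos_of_mem_nhds volume h2).ne' h3

theorem integrable_correlation (hHR : IsSelfAdjoint HR)
    (hV : Integrable fun t : ℝ => ‖adjoint V ∘L expI HR t ∘L V‖) (b c : 𝒦) :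
    Integrable fun t : ℝ => ⟪V b, expI HR t (V c)⟫_ℂ := by
  refine (hV.mul_const (‖b‖ * ‖c‖)).mono' ?_ (ae_of_all _ fun t => ?_)
  · exact (continuous_const.inner ((isUnitaryGroup_expI hHR).continuous _)).aestronglyMeasurable
  · have h1 : ⟪V b, expI HR t (V c)⟫_ℂ = ⟪b, (adjoint V ∘L expI HR t ∘L V) c⟫_ℂ := by
      simp [ContinuousLinearMap.adjoint_inner_right]
    rw [h1]
    refine (norm_inner_le_norm _ _).trans ?_
    calc ‖b‖ * ‖(adjoint V ∘L expI HR t ∘L V) c‖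
        ≤ ‖b‖ * (‖adjoint V ∘L expI HR t ∘L V‖ * ‖c‖) := by
          gcongr
          exact ContinuousLinearMap.le_opNorm _ _
      _ = _ := by ring

theorem integral_exp_mul_correlation (hHR : IsSelfAdjoint HR)
    (hV : Integrable fun t : ℝ => ‖adjoint V ∘L expI HR t ∘L V‖)
    (hreg : IsRegularNearSpectrum HR V I W v) (k : spectrum ℝ K) (b : 𝒦) :
    ∫ t : ℝ, Complex.exp (Complex.I * t * (k : ℝ)) * ⟪V b, expI HR t (V b)⟫_ℂ =
      2 * Real.pi * (‖v k k b‖ : ℂ) ^ 2 := by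
  have hcor := integrable_correlation hHR hV b b
  set G : ℝ → ℂ := fun t => ⟪V b, expI HR (-(2 * Real.pi * t)) (V b)⟫_ℂ with hG
  have hπ : -(2 * Real.pi) ≠ 0 := by
    have := Real.pi_pos
    linarith
  have hGint : Integrable G := by
    have h1 := hcor.comp_mul_left' hπ
    refine h1.congr (ae_of_all _ fun t => ?_)
    simp only [hG]
    congr 3
    ring
  have hFG : ∀ y : ℝ, ∫ t : ℝ, Complex.exp (Complex.I * t * y) * ⟪V b, expI HR t (V b)⟫_ℂ =
      2 * Real.pi * 𝓕 G y := by
    intro y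
    have h1 := Measure.integral_comp_mul_left
      (fun t : ℝ => Complex.exp (Complex.I * t * y) * ⟪V b, expI HR t (V b)⟫_ℂ) (-(2 * Real.pi))
    have h2 : 𝓕 G y = ∫ t : ℝ, Complex.exp (Complex.I * ((-(2 * Real.pi) * t : ℝ) : ℂ) * y) *
        ⟪V b, expI HR (-(2 * Real.pi) * t) (V b)⟫_ℂ := by
      rw [Real.fourier_real_eq_integral_exp_smul]
      refine integral_congr_ae (ae_of_all _ fun t => ?_)
      simp only [hG, smul_eq_mul]
      congr 2
      · push_cast
        ring
      · congr 3
        ring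
    have hpos : |(-(2 * Real.pi))⁻¹| = (2 * Real.pi)⁻¹ := by
      rw [abs_inv, abs_neg, abs_of_pos (by positivity)]
    rw [h2, h1, hpos, Complex.real_smul]
    have : (Real.pi : ℂ) ≠ 0 := by exact_mod_cast Real.pi_ne_zero
    rw [← mul_assoc]
    have h3 : (2 : ℂ) * Real.pi * (((2 * Real.pi)⁻¹ : ℝ) : ℂ) = 1 := by
      push_cast
      field_simp
    rw [h3, one_mul]
  rw [hFG]
  congr 1
  have hcont : Continuous (𝓕 G) :=
    VectorFourier.fourierIntegral_continuous Real.continuous_fourierChar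
      (by simp only [innerₗ_apply_apply]; fun_prop) hGint
  have hsub : 𝓕 G k - (‖v k k b‖ : ℂ) ^ 2 = 0 := by
    refine eq_zero_of_ae_eq_zero_of_continuousAt
      (f := fun y : ℝ => 𝓕 G y - (‖v k y b‖ : ℂ) ^ 2) ((hreg.isOpen k).mem_nhds (hreg.mem k)) ?_ ?_
    · obtain ⟨f, hf, -⟩ := hreg.interaction k b
      have hvint : IntegrableOn (fun y : ℝ => (‖v k y b‖ : ℂ) ^ 2) (I k) := by
        have h1 := ((Lp.memLp f).integrable_norm_pow (by simp)).ofReal (𝕜 := ℂ)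
        refine h1.congr ?_
        filter_upwards [hf] with y hy
        rw [hy]
        simp
      refine (hreg.isOpen k).ae_eq_zero_of_integral_contDiff_smul_eq_zero ?_ fun g hg hgc hgI => ?_
      · exact (hcont.locallyIntegrable.locallyIntegrableOn _).sub hvint.locallyIntegrableOn
      · let φ : 𝓢(ℝ, ℂ) := HasCompactSupport.toSchwartzMap (f := fun x => (g x : ℂ))
          (hgc.comp_left (g := fun x : ℝ => (x : ℂ)) (by simp))
          (Complex.ofRealCLM.contDiff.comp hg)
        have hφ : ∀ y, φ y = g y := fun y => rfl
        have hts : tsupport (φ : ℝ → ℂ) = tsupport g := by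
          have : Function.support (φ : ℝ → ℂ) = Function.support g := by
            ext y
            simp [hφ]
          rw [tsupport, tsupport, this]
        have hin : schwartzCalculus HR φ (V b) ∈ spectralSubspace HR (I k) := by
          refine Submodule.le_topologicalClosure _ (Submodule.subset_span ⟨φ, V b, ?_, ?_, rfl⟩)
          · rw [HasCompactSupport, hts]
            exact hgc
          · rw [hts]
            exact hgI
        obtain ⟨f', hf', hPV⟩ := hreg.interaction k b
        have e1 : ⟪V b, schwartzCalculus HR φ (V b)⟫_ℂ =
            ∫ y in I k, φ y * (‖v k y b‖ : ℂ) ^ 2 := by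
          have : ⟪V b, schwartzCalculus HR φ (V b)⟫_ℂ =
              ⟪W k f', schwartzCalculus HR φ (V b)⟫_ℂ := by
            rw [← hPV, spectralProjection, Submodule.inner_starProjection_left_eq_right,
              Submodule.starProjection_eq_self_iff.mpr hin]
          rw [this, inner_schwartzCalculus_of_mul hHR (hreg.mul k)]
          refine integral_congr_ae ?_
          filter_upwards [hf', hreg.adjoint_apply k b] with y h1 h2
          rw [h1, h2, inner_self_eq_norm_sq_to_K]
          rfl
        have e2 : ⟪V b, schwartzCalculus HR φ (V b)⟫_ℂ = ∫ y, φ y * 𝓕 G y := by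
          rw [inner_schwartzCalculus hHR]
          have h3 := VectorFourier.integral_fourierIntegral_smul_eq_flip (μ := volume)
            (ν := volume) (L := innerₗ ℝ) (f := φ) (g := G) Real.continuous_fourierChar
            (by simp only [innerₗ_apply_apply]; fun_prop) φ.integrable hGint
          have hflip : (innerₗ ℝ : ℝ →ₗ[ℝ] ℝ →ₗ[ℝ] ℝ).flip = innerₗ ℝ := by
            ext
            simp
          rw [hflip] at h3
          exact h3
        have e3 : ∫ y in I k, φ y * (‖v k y b‖ : ℂ) ^ 2 =
            ∫ y, (I k).indicator (fun y => φ y * (‖v k y b‖ : ℂ) ^ 2) y :=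
          (integral_indicator (hreg.isOpen k).measurableSet).symm
        have e4 : (I k).indicator (fun y => φ y * (‖v k y b‖ : ℂ) ^ 2) =
            fun y => φ y * (‖v k y b‖ : ℂ) ^ 2 := by
          rw [Set.indicator_eq_self]
          intro y hy
          refine hgI (subset_tsupport _ ?_)
          intro h0
          apply hy
          simp [hφ, h0]
        have hint1 : Integrable fun y => φ y * (‖v k y b‖ : ℂ) ^ 2 := by
          rw [← e4, integrable_indicator_iff (hreg.isOpen k).measurableSet]
          obtain ⟨C, hC⟩ := hgc.exists_bound_of_continuous hg.continuous
          refine Integrable.bdd_mul (c := C) hvint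
            (φ.continuous.aestronglyMeasurable) (ae_of_all _ fun y => ?_)
          rw [hφ, Complex.norm_real]
          exact hC y
        have hint2 : Integrable fun y => φ y * 𝓕 G y := by
          have : Continuous fun y => φ y * 𝓕 G y := φ.continuous.mul hcont
          refine this.integrable_of_hasCompactSupport ?_
          refine HasCompactSupport.mul_right ?_
          rw [HasCompactSupport, hts]
          exact hgc
        have e5 : ∀ y, g y • (𝓕 G y - (‖v k y b‖ : ℂ) ^ 2) =
            φ y * 𝓕 G y - φ y * (‖v k y b‖ : ℂ) ^ 2 := fun y => by
          rw [hφ, Complex.real_smul, mul_sub]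
        simp only [e5]
        rw [integral_sub hint2 hint1, ← e2, e1, e3, e4, sub_self]
    · have h1 : ContinuousAt (fun y => v k y b) k := (hreg.continuousAt k).clm_apply continuousAt_const
      exact hcont.continuousAt.sub ((Complex.continuous_ofReal.continuousAt.comp h1.norm).pow 2)
  exact sub_eq_zero.mp hsub

theorem continuous_correlation (hHR : IsSelfAdjoint HR) :
    Continuous fun t : ℝ => adjoint V ∘L expI HR t ∘L V := by
  rw [continuous_clm_apply]
  intro x
  exact (adjoint V).continuous.comp ((isUnitaryGroup_expI hHR).continuous (V x))

theorem norm_eigenProjection_le (k : ℝ) : ‖eigenProjection K k‖ ≤ 1 :=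
  Submodule.starProjection_norm_le _

theorem integrable_levelShift (hHR : IsSelfAdjoint HR)
    (hV : Integrable fun t : ℝ => ‖adjoint V ∘L expI HR t ∘L V‖) (k : ℝ) :
    Integrable fun t : ℝ => Complex.exp (Complex.I * t * k) •
      (eigenProjection K k ∘L adjoint V ∘L expI HR t ∘L V ∘L eigenProjection K k) := by
  refine hV.mono' ?_ (ae_of_all _ fun t => ?_)
  · have h := continuous_correlation (V := V) hHR
    have hch : Continuous fun t : ℝ => Complex.exp (Complex.I * t * k) := by fun_prop
    refine (hch.smul ?_).aestronglyMeasurable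
    exact continuous_const.clm_comp (h.clm_comp continuous_const)
  · rw [norm_smul, norm_exp_I_mul, one_mul]
    have h1 : eigenProjection K k ∘L adjoint V ∘L expI HR t ∘L V ∘L eigenProjection K k =
        eigenProjection K k ∘L ((adjoint V ∘L expI HR t ∘L V) ∘L eigenProjection K k) := rfl
    rw [h1]
    calc _ ≤ ‖eigenProjection K k‖ * (‖adjoint V ∘L expI HR t ∘L V‖ * ‖eigenProjection K k‖) :=
          (ContinuousLinearMap.opNorm_comp_le _ _).trans
            (mul_le_mul_of_nonneg_left (ContinuousLinearMap.opNorm_comp_le _ _) (norm_nonneg _))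
      _ ≤ 1 * (‖adjoint V ∘L expI HR t ∘L V‖ * 1) := by
          gcongr <;> exact norm_eigenProjection_le k
      _ = _ := by ring

theorem inner_eigenProjection (k : ℝ) (b c : 𝒦) :
    ⟪b, eigenProjection K k c⟫_ℂ = ⟪eigenProjection K k b, c⟫_ℂ :=
  (Submodule.inner_starProjection_left_eq_right _ b c).symm

/-- The level shift operator is dissipative: `2 Im (b | Υ b) = -‖ν b‖²`. -/
theorem two_mul_im_inner_levelShift (hHR : IsSelfAdjoint HR)
    (hV : Integrable fun t : ℝ => ‖adjoint V ∘L expI HR t ∘L V‖)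
    (hreg : IsRegularNearSpectrum HR V I W v) (b : 𝒦) :
    2 * (⟪b, levelShift K HR V b⟫_ℂ).im = -‖nu v b‖ ^ 2 := by
  have hU := isUnitaryGroup_expI hHR
  set P : spectrum ℝ K → 𝒦 := fun k => eigenProjection K k b with hP
  set c : spectrum ℝ K → ℝ → ℂ := fun k t => Complex.exp (Complex.I * t * (k : ℝ)) *
    ⟪V (P k), expI HR t (V (P k))⟫_ℂ with hc
  have hcint : ∀ k, Integrable (c k) := fun k => by
    have hch : Continuous fun t : ℝ => Complex.exp (Complex.I * t * (k : ℝ)) := by fun_prop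
    refine (integrable_correlation hHR hV (P k) (P k)).bdd_mul (c := 1)
      hch.aestronglyMeasurable (ae_of_all _ fun t => ?_)
    rw [norm_exp_I_mul]
  have h1 : ⟪b, levelShift K HR V b⟫_ℂ = -Complex.I * ∑ k, ∫ t in Set.Ioi (0 : ℝ), c k t := by
    rw [levelShift, smul_apply, inner_smul_right, sum_apply, inner_sum]
    congr 1
    refine Finset.sum_congr rfl fun k _ => ?_
    have hi := (integrable_levelShift (K := K) hHR hV (k : ℝ)).restrict (s := Set.Ioi 0)
    have e1 := (ContinuousLinearMap.apply ℂ 𝒦 b).integral_comp_comm hi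
    have e2 := (innerSL ℂ b).integral_comp_comm
      ((ContinuousLinearMap.apply ℂ 𝒦 b).integrable_comp hi)
    rw [e1] at e2
    simp only [ContinuousLinearMap.apply_apply, innerSL_apply_apply] at e2
    rw [← e2]
    refine integral_congr_ae (ae_of_all _ fun t => ?_)
    simp only [smul_apply, inner_smul_right, ContinuousLinearMap.comp_apply,
      inner_eigenProjection, ContinuousLinearMap.adjoint_inner_right, hc, hP]
  have h2 : ∀ k, 2 * (∫ t in Set.Ioi (0 : ℝ), c k t).re = 2 * Real.pi * ‖v k k (P k)‖ ^ 2 := by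
    intro k
    have e1 := integral_exp_mul_correlation hHR hV hreg k (P k)
    have e2 : ∀ t, c k (-t) = (starRingEnd ℂ) (c k t) := fun t => by
      simp only [hc, map_mul, inner_conj_symm, ← Complex.exp_conj]
      rw [← hU.inner_neg (-t) (V (P k)), neg_neg]
      congr 2
      simp
    have e3 : ∫ t in Set.Iic (0 : ℝ), c k t = (starRingEnd ℂ) (∫ t in Set.Ioi (0 : ℝ), c k t) := by
      have := integral_comp_neg_Ioi (0 : ℝ) (c k)
      rw [neg_zero] at this
      rw [← this, ← integral_conj]
      simp only [e2]
    have e4 : ∫ t, c k t = (∫ t in Set.Iic (0 : ℝ), c k t) + ∫ t in Set.Ioi (0 : ℝ), c k t :=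
      (intervalIntegral.integral_Iic_add_Ioi (hcint k).integrableOn (hcint k).integrableOn).symm
    have e5 := congrArg Complex.re (e4.symm.trans e1)
    rw [e3, Complex.add_re, Complex.conj_re] at e5
    have e6 : (2 * Real.pi * (‖v k k (P k)‖ : ℂ) ^ 2).re = 2 * Real.pi * ‖v k k (P k)‖ ^ 2 := by
      rw [← Complex.ofReal_pow, ← Complex.ofReal_ofNat, ← Complex.ofReal_mul, ← Complex.ofReal_mul,
        Complex.ofReal_re]
    rw [e6] at e5
    linarith
  have h3 : ‖nu v b‖ ^ 2 = ∑ k, 2 * Real.pi * ‖v k k (P k)‖ ^ 2 := by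
    rw [PiLp.norm_sq_eq_of_L2]
    refine Finset.sum_congr rfl fun k _ => ?_
    have : (nu v b) k = (Real.sqrt (2 * Real.pi) : ℂ) • v k k (P k) := rfl
    rw [this, norm_smul, mul_pow, Complex.norm_real, Real.norm_eq_abs, sq_abs,
      Real.sq_sqrt (by positivity)]
  rw [h1, h3]
  simp only [← h2]
  rw [← Finset.mul_sum, ← Complex.re_sum]
  simp

end Dissipation

/-! ### Driven linear dynamics -/

section Trajectory

variable {𝒦 𝔥 : Type*}
  [NormedAddCommGroup 𝒦] [InnerProductSpace ℂ 𝒦] [CompleteSpace 𝒦]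
  [NormedAddCommGroup 𝔥] [InnerProductSpace ℂ 𝔥] [CompleteSpace 𝔥]
  (Y : 𝒦 →L[ℂ] 𝒦) (N : 𝒦 →L[ℂ] 𝔥)

/-- `∫₀^τ e^{iξY} N* g(ξ) dξ`. -/
def drive (g : ℝ → 𝔥) (τ : ℝ) : 𝒦 :=
  ∫ ξ in (0 : ℝ)..τ, bexpI Y (-ξ) (adjoint N (g ξ))

/-- The solution of `β' = -i (Y β + N* g)` with `β(0) = b`. -/
def traj (b : 𝒦) (g : ℝ → 𝔥) (τ : ℝ) : 𝒦 :=
  bexpI Y τ (b - Complex.I • drive Y N g τ)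

variable {Y N}

theorem intervalIntegrable_drive {g : ℝ → 𝔥} (hg : LocallyIntegrable g) (a b : ℝ) :
    IntervalIntegrable (fun ξ => bexpI Y (-ξ) (adjoint N (g ξ))) volume a b := by
  have hc : Continuous fun ξ : ℝ => bexpI Y (-ξ) ∘L adjoint N :=
    ((continuous_bexpI Y).comp continuous_neg).clm_comp continuous_const
  obtain ⟨C, hC⟩ := (isCompact_uIcc (a := a) (b := b)).exists_bound_of_continuousOn hc.continuousOn
  have hg' : IntervalIntegrable g volume a b :=
    (hg.integrableOn_isCompact isCompact_uIcc).intervalIntegrable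
  refine (hg'.norm.const_mul C).mono_fun ?_ ?_
  · have h1 := hg.aestronglyMeasurable.restrict (s := Set.uIoc a b)
    have h2 : AEStronglyMeasurable (fun ξ => (bexpI Y (-ξ) ∘L adjoint N, g ξ))
        (volume.restrict (Set.uIoc a b)) := hc.aestronglyMeasurable.prodMk h1
    have hb : Continuous fun p : (𝔥 →L[ℂ] 𝒦) × 𝔥 => p.1 p.2 :=
      isBoundedBilinearMap_apply.continuous
    exact hb.comp_aestronglyMeasurable h2
  · filter_upwards [ae_restrict_mem measurableSet_uIoc] with ξ hξ
    have h1 := hC ξ (Set.uIoc_subset_uIcc hξ)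
    refine ((bexpI Y (-ξ) ∘L adjoint N).le_opNorm (g ξ)).trans ?_
    rw [norm_mul, norm_norm]
    gcongr
    exact h1.trans (le_abs_self _)

theorem continuous_drive {g : ℝ → 𝔥} (hg : LocallyIntegrable g) : Continuous (drive Y N g) :=
  intervalIntegral.continuous_primitive (intervalIntegrable_drive hg) 0

theorem continuous_traj {g : ℝ → 𝔥} (hg : LocallyIntegrable g) (b : 𝒦) :
    Continuous (traj Y N b g) :=
  (continuous_bexpI Y).clm_apply (continuous_const.sub ((continuous_drive hg).const_smul _))

theorem drive_congr {g h : ℝ → 𝔥} {τ : ℝ} (hτ : 0 ≤ τ)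
    (hgh : ∀ᵐ ξ, ξ ∈ Set.Ioc 0 τ → g ξ = h ξ) : drive Y N g τ = drive Y N h τ := by
  refine intervalIntegral.integral_congr_ae ?_
  rw [Set.uIoc_of_le hτ]
  filter_upwards [hgh] with ξ h1 h2
  rw [h1 h2]

theorem traj_congr {g h : ℝ → 𝔥} {τ : ℝ} (hτ : 0 ≤ τ)
    (hgh : ∀ᵐ ξ, ξ ∈ Set.Ioc 0 τ → g ξ = h ξ) (b : 𝒦) : traj Y N b g τ = traj Y N b h τ := by
  rw [traj, traj, drive_congr hτ hgh]

theorem traj_congr_ae {g h : ℝ → 𝔥} (hgh : g =ᵐ[volume] h) (b : 𝒦) (τ : ℝ) :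
    traj Y N b g τ = traj Y N b h τ := by
  rw [traj, traj, drive, drive]
  congr 3
  refine intervalIntegral.integral_congr_ae ?_
  filter_upwards [hgh] with ξ h1 _
  rw [h1]

theorem traj_zero (b : 𝒦) (g : ℝ → 𝔥) : traj Y N b g 0 = b := by
  simp [traj, drive, bexpI_zero]

theorem traj_add {g h : ℝ → 𝔥} (hg : LocallyIntegrable g) (hh : LocallyIntegrable h) (b c : 𝒦)
    (τ : ℝ) : traj Y N (b + c) (g + h) τ = traj Y N b g τ + traj Y N c h τ := by
  have h1 : drive Y N (g + h) τ = drive Y N g τ + drive Y N h τ := by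
    rw [drive, drive, drive, ← intervalIntegral.integral_add (intervalIntegrable_drive hg 0 τ)
      (intervalIntegrable_drive hh 0 τ)]
    simp
  rw [traj, traj, traj, h1, ← map_add]
  congr 1
  module

theorem traj_smul (a : ℂ) (b : 𝒦) (g : ℝ → 𝔥) (τ : ℝ) :
    traj Y N (a • b) (a • g) τ = a • traj Y N b g τ := by
  have h1 : drive Y N (a • g) τ = a • drive Y N g τ := by
    rw [drive, drive, ← intervalIntegral.integral_smul]
    simp
  rw [traj, traj, h1, ← map_smul]
  congr 1
  module

theorem traj_comp_add {g : ℝ → 𝔥} (hg : LocallyIntegrable g) (b : 𝒦) (σ τ : ℝ) :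
    traj Y N b g (τ + σ) = traj Y N (traj Y N b g τ) (fun ξ => g (ξ + τ)) σ := by
  have h1 : drive Y N g (τ + σ) = drive Y N g τ +
      bexpI Y (-τ) (drive Y N (fun ξ => g (ξ + τ)) σ) := by
    rw [drive, drive, drive, ← intervalIntegral.integral_add_adjacent_intervals
      (intervalIntegrable_drive hg 0 τ) (intervalIntegrable_drive hg τ (τ + σ))]
    congr 1
    have hg' : LocallyIntegrable fun ξ => g (ξ + τ) := by
      intro x
      have := (hg (x + τ))
      obtain ⟨s, hs, hs'⟩ := this
      refine ⟨(· + τ) ⁻¹' s, (continuous_add_const τ).continuousAt.preimage_mem_nhds hs, ?_⟩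
      exact (measurePreserving_add_right volume τ).integrableOn_comp_preimage
        (MeasurableEquiv.addRight τ).measurableEmbedding |>.mpr hs'
    rw [← ContinuousLinearMap.intervalIntegral_comp_comm _ (intervalIntegrable_drive hg' 0 σ)]
    have h2 := intervalIntegral.integral_comp_add_right (a := 0) (b := σ)
      (fun ξ => bexpI Y (-ξ) (adjoint N (g ξ))) τ
    rw [zero_add, add_comm σ τ] at h2
    rw [← h2]
    refine intervalIntegral.integral_congr fun ξ _ => ?_
    have h3 : -(ξ + τ) = -τ + -ξ := by ring
    simp only [h3, bexpI_add]
    rfl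
  rw [traj, traj, traj, h1, add_comm τ σ, bexpI_add]
  change bexpI Y σ (bexpI Y τ _) = _
  congr 1
  rw [smul_add, ← sub_sub, map_sub, map_smul]
  congr 2
  exact DFunLike.congr_fun (bexpI_mul_neg Y τ) _

theorem hasDerivAt_traj {g : ℝ → 𝔥} (hg : Continuous g) (b : 𝒦) (τ : ℝ) :
    HasDerivAt (traj Y N b g)
      (-Complex.I • (Y (traj Y N b g τ) + adjoint N (g τ))) τ := by
  have hc : Continuous fun ξ : ℝ => bexpI Y (-ξ) (adjoint N (g ξ)) :=
    ((continuous_bexpI Y).comp continuous_neg).clm_apply ((adjoint N).continuous.comp hg)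
  have h1 : HasDerivAt (drive Y N g) (bexpI Y (-τ) (adjoint N (g τ))) τ :=
    intervalIntegral.integral_hasDerivAt_right (hc.intervalIntegrable _ _)
      (hc.stronglyMeasurableAtFilter _ _) hc.continuousAt
  have h2 := hasDerivAt_apply (hasDerivAt_bexpI Y τ) ((h1.const_smul Complex.I).const_sub b)
  refine h2.congr_deriv ?_
  have h3 : bexpI Y τ (bexpI Y (-τ) (adjoint N (g τ))) = adjoint N (g τ) :=
    DFunLike.congr_fun (bexpI_mul_neg Y τ) _
  rw [map_neg, map_smul, h3, smul_add, neg_smul Complex.I (adjoint N (g τ))]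
  rfl

theorem eq_traj_of_hasDerivAt {g : ℝ → 𝔥} (hg : Continuous g) {β : ℝ → 𝒦}
    (hβ : ∀ τ, HasDerivAt β (-Complex.I • (Y (β τ) + adjoint N (g τ))) τ) (τ : ℝ) :
    β τ = traj Y N (β 0) g τ := by
  have hneg : ∀ ξ, HasDerivAt (fun s => bexpI Y (-s)) (Complex.I • (Y * bexpI Y (-ξ))) ξ := by
    intro ξ
    have := HasDerivAt.scomp (h := fun s : ℝ => -s) ξ (hasDerivAt_bexpI Y (-ξ)) (hasDerivAt_neg ξ)
    simpa [Function.comp_def] using this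
  have hd : ∀ ξ, HasDerivAt (fun s => bexpI Y (-s) (β s))
      (-Complex.I • bexpI Y (-ξ) (adjoint N (g ξ))) ξ := by
    intro ξ
    refine (hasDerivAt_apply (hneg ξ) (hβ ξ)).congr_deriv ?_
    rw [(commute_bexpI (Commute.refl Y) (-ξ)).eq]
    simp only [smul_apply, map_smul, map_add, smul_add]
    change Complex.I • bexpI Y (-ξ) (Y (β ξ)) + _ = _
    module
  have hc : Continuous fun ξ : ℝ => bexpI Y (-ξ) (adjoint N (g ξ)) :=
    ((continuous_bexpI Y).comp continuous_neg).clm_apply ((adjoint N).continuous.comp hg)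
  have h1 := intervalIntegral.integral_eq_sub_of_hasDerivAt (a := 0) (b := τ) (fun s _ => hd s)
    ((hc.const_smul _).intervalIntegrable _ _)
  rw [intervalIntegral.integral_smul, neg_zero, bexpI_zero] at h1
  change _ = _ - β 0 at h1
  have h2 : bexpI Y (-τ) (β τ) = β 0 - Complex.I • drive Y N g τ := by
    rw [drive, eq_add_of_sub_eq h1.symm]
    module
  rw [traj, ← h2]
  exact (DFunLike.congr_fun (bexpI_mul_neg Y τ) _).symm

/-- Energy balance for dissipative `Y`. -/
theorem hasDerivAt_norm_sq_traj (hY : ∀ b, 2 * (⟪b, Y b⟫_ℂ).im = -‖N b‖ ^ 2) {g : ℝ → 𝔥}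
    (hg : Continuous g) (b : 𝒦) (τ : ℝ) :
    HasDerivAt (fun s => ‖traj Y N b g s‖ ^ 2)
      (‖g τ‖ ^ 2 - ‖g τ - Complex.I • N (traj Y N b g τ)‖ ^ 2) τ := by
  have h1 := (hasDerivAt_traj (Y := Y) (N := N) hg b τ).inner ℂ
    (hasDerivAt_traj (Y := Y) (N := N) hg b τ)
  have h2 := (Complex.reCLM.hasFDerivAt (x := ⟪traj Y N b g τ, traj Y N b g τ⟫_ℂ)).comp_hasDerivAt
    τ h1
  have hfun : (fun s => ‖traj Y N b g s‖ ^ 2) =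
      Complex.reCLM ∘ fun s => ⟪traj Y N b g s, traj Y N b g s⟫_ℂ := by
    funext s
    exact (inner_self_eq_norm_sq (𝕜 := ℂ) _).symm
  rw [hfun]
  refine h2.congr_deriv ?_
  set β := traj Y N b g τ
  have e1 := hY β
  have e2 : ⟪β, adjoint N (g τ)⟫_ℂ = ⟪N β, g τ⟫_ℂ := ContinuousLinearMap.adjoint_inner_right _ _ _
  have e3 : ⟪adjoint N (g τ), β⟫_ℂ = (starRingEnd ℂ) ⟪N β, g τ⟫_ℂ := by
    rw [← e2, inner_conj_symm]
  have e4 : ⟪Y β, β⟫_ℂ = (starRingEnd ℂ) ⟪β, Y β⟫_ℂ := (inner_conj_symm _ _).symm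
  rw [@norm_sub_sq ℂ, inner_smul_right, norm_smul, ← inner_conj_symm (g τ)]
  have e5 : (⟪g τ, N β⟫_ℂ).im = -(⟪N β, g τ⟫_ℂ).im := by
    rw [← inner_conj_symm (g τ), Complex.conj_im]
  have e6 : (⟪Y β, β⟫_ℂ).im = -(⟪β, Y β⟫_ℂ).im := by
    rw [e4, Complex.conj_im]
  simp only [inner_smul_left, inner_add_left, inner_add_right, e2, e3, e4]
  simp
  linarith

end Trajectory

/-! ### The scattering step -/

section Step

variable {𝒦 𝔥 : Type*}
  [NormedAddCommGroup 𝒦] [InnerProductSpace ℂ 𝒦] [CompleteSpace 𝒦]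
  [NormedAddCommGroup 𝔥] [InnerProductSpace ℂ 𝔥] [CompleteSpace 𝔥]
  {Y : 𝒦 →L[ℂ] 𝒦} {N : 𝒦 →L[ℂ] 𝔥}

theorem locallyIntegrable_Lp (g : Lp 𝔥 2 (volume : Measure ℝ)) : LocallyIntegrable (g : ℝ → 𝔥) :=
  (Lp.memLp g).locallyIntegrable (by norm_num)

theorem norm_sq_eq_integral {α : Type*} [MeasurableSpace α] {μ : Measure α} (g : Lp 𝔥 2 μ) :
    ‖g‖ ^ 2 = ∫ x, ‖g x‖ ^ 2 ∂μ := by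
  have h1 : (∫ x, ((‖g x‖ ^ 2 : ℝ) : ℂ) ∂μ) = ⟪g, g⟫_ℂ := by
    rw [L2.inner_def]
    refine integral_congr_ae (ae_of_all _ fun x => ?_)
    simp only [inner_self_eq_norm_sq_to_K]
    norm_cast
  rw [integral_complex_ofReal, inner_self_eq_norm_sq_to_K] at h1
  refine Complex.ofReal_injective ?_
  rw [h1, Complex.ofReal_pow]
  rfl

theorem setIntegral_norm_le (g : Lp 𝔥 2 (volume : Measure ℝ)) {T : ℝ} (hT : 0 ≤ T) :
    ∫ ξ in Set.Ioc 0 T, ‖g ξ‖ ≤ ‖g‖ * √T := by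
  rw [integral_norm_eq_lintegral_enorm (Lp.aestronglyMeasurable g).restrict,
    ← eLpNorm_one_eq_lintegral_enorm]
  have h1 := eLpNorm_le_eLpNorm_mul_rpow_measure_univ (p := 1) (q := 2)
    (μ := volume.restrict (Set.Ioc 0 T)) (f := g) (by norm_num)
    (Lp.aestronglyMeasurable g).restrict
  have h2 : eLpNorm g 2 (volume.restrict (Set.Ioc 0 T)) ≤ eLpNorm g 2 volume :=
    eLpNorm_mono_measure _ Measure.restrict_le_self
  have h3 : (volume.restrict (Set.Ioc 0 T)) Set.univ = ENNReal.ofReal T := by simp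
  rw [h3] at h1
  have h4 : (1 / (1 : ℝ≥0∞).toReal - 1 / (2 : ℝ≥0∞).toReal) = (1 / 2 : ℝ) := by norm_num
  rw [h4] at h1
  have h5 := h1.trans (mul_le_mul_left h2 _)
  refine (ENNReal.toReal_mono ?_ h5).trans (le_of_eq ?_)
  · exact ENNReal.mul_ne_top (Lp.eLpNorm_ne_top g)
      (ENNReal.rpow_ne_top_of_nonneg (by norm_num) ENNReal.ofReal_ne_top)
  · rw [ENNReal.toReal_mul, ← Lp.norm_def, ← ENNReal.toReal_rpow, ENNReal.toReal_ofReal hT,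
      Real.sqrt_eq_rpow]

theorem exists_norm_traj_le (Y : 𝒦 →L[ℂ] 𝒦) (N : 𝒦 →L[ℂ] 𝔥) {T : ℝ} (hT : 0 ≤ T) :
    ∃ C, 0 ≤ C ∧ ∀ τ ∈ Set.Icc 0 T, ∀ ψ : WithLp 2 (𝒦 × Lp 𝔥 2 (volume : Measure ℝ)),
      ‖traj Y N ψ.fst ψ.snd τ‖ ≤ C * ‖ψ‖ := by
  obtain ⟨C₁, hC₁⟩ := (isCompact_Icc (a := 0) (b := T)).exists_bound_of_continuousOn
    (continuous_bexpI Y).continuousOn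
  have hc : Continuous fun ξ : ℝ => bexpI Y (-ξ) ∘L adjoint N :=
    ((continuous_bexpI Y).comp continuous_neg).clm_comp continuous_const
  obtain ⟨C₂, hC₂⟩ := (isCompact_Icc (a := 0) (b := T)).exists_bound_of_continuousOn
    hc.continuousOn
  have h01 : 0 ≤ C₁ := (norm_nonneg _).trans (hC₁ 0 ⟨le_rfl, hT⟩)
  have h02 : 0 ≤ C₂ := (norm_nonneg _).trans (hC₂ 0 ⟨le_rfl, hT⟩)
  refine ⟨C₁ * (1 + C₂ * √T), by positivity, fun τ hτ ψ => ?_⟩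
  have hf : ‖ψ.fst‖ ≤ ‖ψ‖ := WithLp.norm_fst_le _ ψ
  have hs : ‖ψ.snd‖ ≤ ‖ψ‖ := WithLp.norm_snd_le _ ψ
  have hd : ‖drive Y N ψ.snd τ‖ ≤ C₂ * (‖ψ.snd‖ * √T) := by
    rw [drive]
    have hi : IntegrableOn (fun ξ => ‖ψ.snd ξ‖) (Set.Ioc 0 T) :=
      Integrable.norm (((locallyIntegrable_Lp ψ.snd).integrableOn_isCompact
        (isCompact_Icc (a := 0) (b := T))).mono_set Set.Ioc_subset_Icc_self)
    have hi' : IntegrableOn (fun ξ => ‖ψ.snd ξ‖) (Set.Ioc 0 τ) :=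
      hi.mono_set (Set.Ioc_subset_Ioc_right hτ.2)
    have e1 : ‖∫ ξ in (0 : ℝ)..τ, bexpI Y (-ξ) (adjoint N (ψ.snd ξ))‖ ≤
        ∫ ξ in (0 : ℝ)..τ, C₂ * ‖ψ.snd ξ‖ := by
      refine intervalIntegral.norm_integral_le_of_norm_le hτ.1 (ae_of_all _ fun ξ hξ => ?_) ?_
      · refine ((bexpI Y (-ξ) ∘L adjoint N).le_opNorm (ψ.snd ξ)).trans ?_
        gcongr
        exact hC₂ ξ ⟨hξ.1.le, hξ.2.trans hτ.2⟩
      · rw [intervalIntegrable_iff_integrableOn_Ioc_of_le hτ.1]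
        exact hi'.const_mul _
    refine e1.trans ?_
    rw [intervalIntegral.integral_const_mul, intervalIntegral.integral_of_le hτ.1]
    gcongr
    refine le_trans ?_ (setIntegral_norm_le ψ.snd hT)
    exact setIntegral_mono_set hi (ae_of_all _ fun _ => norm_nonneg _)
      (Set.Ioc_subset_Ioc_right hτ.2).eventuallyLE
  calc ‖traj Y N ψ.fst ψ.snd τ‖ ≤ ‖bexpI Y τ‖ * ‖ψ.fst - Complex.I • drive Y N ψ.snd τ‖ :=
        ContinuousLinearMap.le_opNorm _ _
    _ ≤ C₁ * (‖ψ.fst‖ + ‖drive Y N ψ.snd τ‖) := by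
        gcongr
        · exact hC₁ τ hτ
        · refine (norm_sub_le _ _).trans ?_
          rw [norm_smul, Complex.norm_I, one_mul]
    _ ≤ C₁ * (‖ψ‖ + C₂ * (‖ψ‖ * √T)) := by
        gcongr
        exact hd.trans (by gcongr)
    _ = _ := by ring

theorem memLp_indicator_of_bound {f : ℝ → 𝔥} (hf : Continuous f) {τ : ℝ} (hτ : 0 ≤ τ) {C : ℝ}
    (hC : 0 ≤ C) (h : ∀ ξ ∈ Set.Ioc 0 τ, ‖f ξ‖ ≤ C) :
    ∃ hm : MemLp ((Set.Ioc 0 τ).indicator f) 2 volume, ‖hm.toLp _‖ ≤ C * √τ := by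
  have hb : ∀ᵐ ξ ∂volume.restrict (Set.Ioc 0 τ), ‖f ξ‖ ≤ C := by
    filter_upwards [ae_restrict_mem measurableSet_Ioc] with ξ hξ using h ξ hξ
  have hm' : MemLp f 2 (volume.restrict (Set.Ioc 0 τ)) :=
    MemLp.of_bound hf.aestronglyMeasurable C hb
  have hm : MemLp ((Set.Ioc 0 τ).indicator f) 2 volume :=
    (memLp_indicator_iff_restrict measurableSet_Ioc).mpr hm'
  refine ⟨hm, ?_⟩
  rw [Lp.norm_toLp, eLpNorm_indicator_eq_eLpNorm_restrict measurableSet_Ioc]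
  refine (ENNReal.toReal_mono ?_ (eLpNorm_le_of_ae_bound hb)).trans (le_of_eq ?_)
  · refine ENNReal.mul_ne_top (ENNReal.rpow_ne_top_of_nonneg (by norm_num) ?_)
      ENNReal.ofReal_ne_top
    simp
  · rw [ENNReal.toReal_mul, ENNReal.toReal_ofReal hC, ← ENNReal.toReal_rpow]
    simp only [Measure.restrict_apply MeasurableSet.univ, Set.univ_inter, Real.volume_Ioc, sub_zero,
      ENNReal.toReal_ofReal hτ]
    rw [Real.sqrt_eq_rpow, mul_comm]
    norm_num

/-- The part of the output field that is emitted during `(0, τ]`. -/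
theorem exists_emission (Y : 𝒦 →L[ℂ] 𝒦) (N : 𝒦 →L[ℂ] 𝔥) {T τ : ℝ} (hτ : 0 ≤ τ) (hτT : τ ≤ T)
    {C : ℝ} (hC : 0 ≤ C) (hbd : ∀ τ ∈ Set.Icc 0 T,
      ∀ ψ : WithLp 2 (𝒦 × Lp 𝔥 2 (volume : Measure ℝ)),
        ‖traj Y N ψ.fst ψ.snd τ‖ ≤ C * ‖ψ‖) :
    ∃ S : WithLp 2 (𝒦 × Lp 𝔥 2 (volume : Measure ℝ)) →L[ℂ] Lp 𝔥 2 (volume : Measure ℝ),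
      (∀ ψ, S ψ =ᵐ[volume] (Set.Ioc 0 τ).indicator fun ξ => N (traj Y N ψ.fst ψ.snd ξ)) ∧
      ∀ ψ, ‖S ψ‖ ≤ ‖N‖ * C * √τ * ‖ψ‖ := by
  have hex : ∀ ψ : WithLp 2 (𝒦 × Lp 𝔥 2 (volume : Measure ℝ)),
      ∃ hm : MemLp ((Set.Ioc 0 τ).indicator fun ξ => N (traj Y N ψ.fst ψ.snd ξ)) 2 volume,
        ‖hm.toLp _‖ ≤ ‖N‖ * (C * ‖ψ‖) * √τ := fun ψ =>
    memLp_indicator_of_bound (N.continuous.comp (continuous_traj (locallyIntegrable_Lp _) _)) hτ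
      (by positivity) fun ξ hξ => (N.le_opNorm _).trans (by
        gcongr
        exact hbd ξ ⟨hξ.1.le, hξ.2.trans hτT⟩ ψ)
  choose hm hn using hex
  have hbd : ∀ ψ, ‖(hm ψ).toLp _‖ ≤ ‖N‖ * C * √τ * ‖ψ‖ := fun ψ =>
    (hn ψ).trans (le_of_eq (by ring))
  refine ⟨LinearMap.mkContinuous
    { toFun := fun ψ => (hm ψ).toLp _
      map_add' := fun ψ φ => ?_
      map_smul' := fun c ψ => ?_ } _ hbd, fun ψ => (hm ψ).coeFn_toLp, hbd⟩
  · rw [← MemLp.toLp_add, MemLp.toLp_eq_toLp_iff]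
    refine ae_of_all _ fun ξ => ?_
    rw [← Set.indicator_add']
    congr 1
    funext η
    rw [Pi.add_apply, ← map_add, ← traj_add (locallyIntegrable_Lp _) (locallyIntegrable_Lp _)]
    congr 1
    exact traj_congr_ae (Lp.coeFn_add _ _) _ _
  · rw [RingHom.id_apply, ← MemLp.toLp_const_smul, MemLp.toLp_eq_toLp_iff]
    refine ae_of_all _ fun ξ => ?_
    by_cases hξ : ξ ∈ Set.Ioc 0 τ
    · rw [Pi.smul_apply, Set.indicator_of_mem hξ, Set.indicator_of_mem hξ, ← map_smul, ← traj_smul]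
      congr 1
      exact traj_congr_ae (Lp.coeFn_smul _ _) _ _
    · rw [Pi.smul_apply, Set.indicator_of_notMem hξ, Set.indicator_of_notMem hξ, smul_zero]

theorem exists_trajL (Y : 𝒦 →L[ℂ] 𝒦) (N : 𝒦 →L[ℂ] 𝔥) {τ : ℝ} (hτ : 0 ≤ τ) :
    ∃ S : WithLp 2 (𝒦 × Lp 𝔥 2 (volume : Measure ℝ)) →L[ℂ] 𝒦,
      ∀ ψ, S ψ = traj Y N ψ.fst ψ.snd τ := by
  obtain ⟨C, -, hC⟩ := exists_norm_traj_le Y N hτ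
  refine ⟨LinearMap.mkContinuous
    { toFun := fun ψ => traj Y N ψ.fst ψ.snd τ
      map_add' := fun ψ φ => ?_
      map_smul' := fun c ψ => ?_ } C (hC τ ⟨hτ, le_rfl⟩), fun ψ => rfl⟩
  · rw [← traj_add (locallyIntegrable_Lp _) (locallyIntegrable_Lp _)]
    exact traj_congr_ae (Lp.coeFn_add _ _) _ _
  · rw [RingHom.id_apply, ← traj_smul]
    exact traj_congr_ae (Lp.coeFn_smul _ _) _ _

theorem dense_toLp_schwartz : Dense {ψ : WithLp 2 (𝒦 × Lp 𝔥 2 (volume : Measure ℝ)) |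
    ∃ φ : 𝓢(ℝ, 𝔥), ψ.snd = φ.toLp 2} := by
  have h1 : DenseRange fun φ : 𝓢(ℝ, 𝔥) => φ.toLp 2 (volume : Measure ℝ) :=
    SchwartzMap.denseRange_toLpCLM (p := 2) (by simp)
  have hopen : IsOpenMap fun ψ : WithLp 2 (𝒦 × Lp 𝔥 2 (volume : Measure ℝ)) => ψ.snd :=
    isOpenMap_snd.comp
      (WithLp.prodContinuousLinearEquiv 2 ℂ 𝒦 (Lp 𝔥 2 volume)).toHomeomorph.isOpenMap
  refine (Dense.preimage h1 hopen).mono ?_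
  rintro ψ ⟨φ, hφ⟩
  exact ⟨φ, hφ.symm⟩

/-- The unitary map that sends the initial state and the input field to the state at time `τ` and
the output field. -/
theorem exists_step (hY : ∀ b, 2 * (⟪b, Y b⟫_ℂ).im = -‖N b‖ ^ 2) {T τ C : ℝ} (hτ : 0 ≤ τ)
    (hτT : τ ≤ T) (hC : 0 ≤ C) (hbd : ∀ τ ∈ Set.Icc 0 T,
      ∀ ψ : WithLp 2 (𝒦 × Lp 𝔥 2 (volume : Measure ℝ)),
        ‖traj Y N ψ.fst ψ.snd τ‖ ≤ C * ‖ψ‖) :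
    ∃ M : WithLp 2 (𝒦 × Lp 𝔥 2 (volume : Measure ℝ)) →L[ℂ]
        WithLp 2 (𝒦 × Lp 𝔥 2 (volume : Measure ℝ)),
      M ∈ unitary (WithLp 2 (𝒦 × Lp 𝔥 2 (volume : Measure ℝ)) →L[ℂ]
        WithLp 2 (𝒦 × Lp 𝔥 2 (volume : Measure ℝ))) ∧
      (∀ ψ, (M ψ).fst = traj Y N ψ.fst ψ.snd τ) ∧
      (∀ ψ, ∀ᵐ ξ, (M ψ).snd ξ = ψ.snd ξ -
        Complex.I • (Set.Ioc 0 τ).indicator (fun ξ => N (traj Y N ψ.fst ψ.snd ξ)) ξ) ∧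
      ∀ ψ, ‖(M ψ).snd - ψ.snd‖ ≤ ‖N‖ * C * √τ * ‖ψ‖ := by
  obtain ⟨S, hS, hSn⟩ := exists_emission Y N hτ hτT hC hbd
  obtain ⟨B, hB⟩ := exists_trajL Y N hτ
  let sndL : WithLp 2 (𝒦 × Lp 𝔥 2 (volume : Measure ℝ)) →L[ℂ] Lp 𝔥 2 (volume : Measure ℝ) :=
    ContinuousLinearMap.snd ℂ 𝒦 (Lp 𝔥 2 (volume : Measure ℝ)) ∘L
      (WithLp.prodContinuousLinearEquiv 2 ℂ 𝒦 (Lp 𝔥 2 (volume : Measure ℝ)) :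
        WithLp 2 (𝒦 × Lp 𝔥 2 (volume : Measure ℝ)) →L[ℂ] 𝒦 × Lp 𝔥 2 (volume : Measure ℝ))
  let M : WithLp 2 (𝒦 × Lp 𝔥 2 (volume : Measure ℝ)) →L[ℂ]
      WithLp 2 (𝒦 × Lp 𝔥 2 (volume : Measure ℝ)) :=
    ((WithLp.prodContinuousLinearEquiv 2 ℂ 𝒦 (Lp 𝔥 2 (volume : Measure ℝ))).symm :
      𝒦 × Lp 𝔥 2 (volume : Measure ℝ) →L[ℂ] WithLp 2 (𝒦 × Lp 𝔥 2 (volume : Measure ℝ))) ∘L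
      B.prod (sndL - Complex.I • S)
  have hM1 : ∀ ψ, (M ψ).fst = traj Y N ψ.fst ψ.snd τ := fun ψ => hB ψ
  have hM2' : ∀ ψ, (M ψ).snd = ψ.snd - Complex.I • S ψ := fun ψ => rfl
  have hM2 : ∀ ψ, ∀ᵐ ξ, (M ψ).snd ξ = ψ.snd ξ -
      Complex.I • (Set.Ioc 0 τ).indicator (fun ξ => N (traj Y N ψ.fst ψ.snd ξ)) ξ := fun ψ => by
    rw [hM2']
    filter_upwards [hS ψ, Lp.coeFn_sub ψ.snd (Complex.I • S ψ), Lp.coeFn_smul Complex.I (S ψ)]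
      with ξ h1 h2 h3
    rw [h2, Pi.sub_apply, h3, Pi.smul_apply, h1]
  have hiso : ∀ ψ, ‖M ψ‖ = ‖ψ‖ := by
    refine fun ψ => congrFun (Continuous.ext_on (dense_toLp_schwartz (𝒦 := 𝒦) (𝔥 := 𝔥))
      M.continuous.norm continuous_norm fun ψ hψ => ?_) ψ
    obtain ⟨φ, hφ⟩ := hψ
    have hφ' : ψ.snd =ᵐ[volume] φ := by rw [hφ]; exact φ.coeFn_toLp 2
    set β := traj Y N ψ.fst φ with hβ
    have hβc : Continuous β := continuous_traj (φ.continuous.locallyIntegrable) _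
    have htr : ∀ ξ, traj Y N ψ.fst ψ.snd ξ = β ξ := fun ξ => traj_congr_ae hφ' _ _
    have hcont : Continuous fun ξ => ‖φ ξ‖ ^ 2 - ‖φ ξ - Complex.I • N (β ξ)‖ ^ 2 := by
      have := φ.continuous
      fun_prop
    have h1 := intervalIntegral.integral_eq_sub_of_hasDerivAt (a := 0) (b := τ)
      (fun s _ => hasDerivAt_norm_sq_traj hY φ.continuous ψ.fst s) (hcont.intervalIntegrable _ _)
    rw [traj_zero] at h1
    have h2 : ∫ ξ in (0 : ℝ)..τ, (‖φ ξ‖ ^ 2 - ‖φ ξ - Complex.I • N (β ξ)‖ ^ 2) =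
        ‖ψ.snd‖ ^ 2 - ‖(M ψ).snd‖ ^ 2 := by
      rw [norm_sq_eq_integral, norm_sq_eq_integral, ← integral_sub
        ((Lp.memLp _).integrable_norm_pow (by simp)) ((Lp.memLp _).integrable_norm_pow (by simp)),
        intervalIntegral.integral_of_le hτ, ← integral_indicator measurableSet_Ioc]
      refine integral_congr_ae ?_
      filter_upwards [hφ', hM2 ψ] with ξ e1 e2
      rw [e2, e1]
      by_cases hξ : ξ ∈ Set.Ioc 0 τ
      · rw [Set.indicator_of_mem hξ, Set.indicator_of_mem hξ, htr]
      · rw [Set.indicator_of_notMem hξ, Set.indicator_of_notMem hξ]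
        simp
    have h3 : ‖M ψ‖ ^ 2 = ‖ψ‖ ^ 2 := by
      rw [WithLp.prod_norm_sq_eq_of_L2, WithLp.prod_norm_sq_eq_of_L2, hM1, htr]
      rw [h2] at h1
      linarith
    exact (sq_eq_sq₀ (norm_nonneg _) (norm_nonneg _)).mp h3
  have hadj : adjoint M * M = 1 := (ContinuousLinearMap.norm_map_iff_adjoint_comp_self M).mp hiso
  have hsurj : M * adjoint M = 1 := by
    refine DFunLike.coe_injective (Continuous.ext_on (dense_toLp_schwartz (𝒦 := 𝒦) (𝔥 := 𝔥))
      (ContinuousLinearMap.continuous _) (ContinuousLinearMap.continuous _) fun ψ hψ => ?_)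
    suffices h : ∃ ζ, M ζ = ψ by
      obtain ⟨ζ, rfl⟩ := h
      change M ((adjoint M * M) ζ) = M ζ
      rw [hadj]
      rfl
    obtain ⟨φ, hφ⟩ := hψ
    have hφ' : ψ.snd =ᵐ[volume] φ := by rw [hφ]; exact φ.coeFn_toLp 2
    set Y' := Y + Complex.I • (adjoint N ∘L N) with hY'
    set b := bexpI Y' (-τ) ψ.fst + Complex.I • drive Y' N φ τ with hb
    set β := traj Y' N b φ with hβ
    have hβτ : β τ = ψ.fst := by
      rw [hβ, traj, hb, add_sub_cancel_right]
      exact DFunLike.congr_fun (bexpI_mul_neg Y' τ) _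
    have hβc : Continuous β := continuous_traj (φ.continuous.locallyIntegrable) _
    have hNβ : Continuous fun ξ => N (β ξ) := N.continuous.comp hβc
    have hg : Continuous fun ξ => φ ξ + Complex.I • N (β ξ) :=
      φ.continuous.add (hNβ.const_smul _)
    have hβ' : ∀ s, β s = traj Y N b (fun ξ => φ ξ + Complex.I • N (β ξ)) s := by
      intro s
      have h0 : β 0 = b := traj_zero _ _
      rw [← h0]
      refine eq_traj_of_hasDerivAt hg (fun r => ?_) s
      refine (hasDerivAt_traj φ.continuous b r).congr_deriv ?_
      simp only [hY', add_apply, smul_apply, map_add, map_smul,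
        ContinuousLinearMap.comp_apply]
      module
    obtain ⟨C', hC'⟩ := (isCompact_Icc (a := 0) (b := τ)).exists_bound_of_continuousOn
      hNβ.continuousOn
    obtain ⟨hm, -⟩ := memLp_indicator_of_bound hNβ hτ (C := C')
      ((norm_nonneg _).trans (hC' 0 ⟨le_rfl, hτ⟩)) (fun ξ hξ => hC' ξ ⟨hξ.1.le, hξ.2⟩)
    set g : Lp 𝔥 2 (volume : Measure ℝ) := ψ.snd + Complex.I • hm.toLp _ with hgdef
    have hgae : ∀ᵐ ξ, g ξ = φ ξ + Complex.I • (Set.Ioc 0 τ).indicator (fun ξ => N (β ξ)) ξ := by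
      filter_upwards [hφ', Lp.coeFn_add ψ.snd (Complex.I • hm.toLp _),
        Lp.coeFn_smul Complex.I (hm.toLp _), hm.coeFn_toLp] with ξ h1 h2 h3 h4
      rw [hgdef, h2, Pi.add_apply, h3, Pi.smul_apply, h1, h4]
    have htr : ∀ s ∈ Set.Icc 0 τ, traj Y N b g s = β s := by
      intro s hs
      rw [hβ' s]
      refine traj_congr hs.1 ?_ b
      filter_upwards [hgae] with ξ h1 h2
      have h3 : ξ ∈ Set.Ioc 0 τ := ⟨h2.1, h2.2.trans hs.2⟩
      rw [h1, Set.indicator_of_mem h3]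
    refine ⟨WithLp.toLp 2 (b, g), ?_⟩
    refine (WithLp.prodContinuousLinearEquiv 2 ℂ 𝒦 (Lp 𝔥 2 (volume : Measure ℝ))).injective
      (Prod.ext ?_ (Lp.ext ?_))
    · exact (hM1 _).trans ((htr τ ⟨hτ, le_rfl⟩).trans hβτ)
    · filter_upwards [hM2 (WithLp.toLp 2 (b, g)), hgae, hφ'] with ξ h1 h2 h3
      refine h1.trans ?_
      change g ξ - Complex.I • (Set.Ioc 0 τ).indicator (fun ξ => N (traj Y N b g ξ)) ξ = ψ.snd ξ
      rw [h2, h3]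
      by_cases hξ : ξ ∈ Set.Ioc 0 τ
      · rw [Set.indicator_of_mem hξ, Set.indicator_of_mem hξ, htr ξ ⟨hξ.1.le, hξ.2⟩]
        abel
      · rw [Set.indicator_of_notMem hξ, Set.indicator_of_notMem hξ]
        simp
  refine ⟨M, ?_, hM1, hM2, fun ψ => ?_⟩
  · rw [Unitary.mem_iff, star_eq_adjoint]
    exact ⟨hadj, hsurj⟩
  · rw [hM2', sub_sub_cancel_left, norm_neg, norm_smul, Complex.norm_I, one_mul]
    exact hSn ψ

end Step

/-! ### Unitary semigroups -/

section Semigroup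

variable {E : Type*} [NormedAddCommGroup E] [InnerProductSpace ℂ E] [CompleteSpace E]

/-- A semigroup of unitaries that is strongly continuous at `0` extends to a unitary group. -/
theorem exists_unitaryGroup_of_semigroup {U : ℝ → E →L[ℂ] E}
    (hU : ∀ t, 0 ≤ t → U t ∈ unitary (E →L[ℂ] E)) (h0 : U 0 = 1)
    (hadd : ∀ s t, 0 ≤ s → 0 ≤ t → U (s + t) = U s * U t)
    (hc : ∀ x, Tendsto (fun t => U t x) (𝓝[≥] 0) (𝓝 x)) :
    ∃ G : ℝ → E →L[ℂ] E, IsUnitaryGroup G ∧ ∀ t, 0 ≤ t → G t = U t := by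
  let G : ℝ → E →L[ℂ] E := fun t => if 0 ≤ t then U t else star (U (-t))
  have hpos : ∀ t, 0 ≤ t → G t = U t := fun t ht => if_pos ht
  have hneg : ∀ t, t < 0 → G t = star (U (-t)) := fun t ht => if_neg (not_le.mpr ht)
  have hl : ∀ t, 0 ≤ t → star (U t) * U t = 1 := fun t ht => (Unitary.mem_iff.mp (hU t ht)).1
  have hr : ∀ t, 0 ≤ t → U t * star (U t) = 1 := fun t ht => (Unitary.mem_iff.mp (hU t ht)).2
  have hG : ∀ a b, 0 ≤ a → 0 ≤ b → U a * star (U b) = G (a - b) := by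
    intro a b ha hb
    rcases le_or_gt b a with h | h
    · have h1 := hadd (a - b) b (sub_nonneg.mpr h) hb
      rw [sub_add_cancel] at h1
      rw [hpos _ (sub_nonneg.mpr h), h1, mul_assoc, hr b hb, mul_one]
    · have h1 := hadd (b - a) a (sub_nonneg.mpr h.le) ha
      rw [sub_add_cancel] at h1
      rw [hneg _ (sub_neg.mpr h), h1, star_mul, ← mul_assoc, hr a ha, one_mul, neg_sub]
  have hG' : ∀ a b, 0 ≤ a → 0 ≤ b → star (U b) * U a = G (a - b) := by
    intro a b ha hb
    rcases le_or_gt b a with h | h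
    · have h1 := hadd b (a - b) hb (sub_nonneg.mpr h)
      rw [add_sub_cancel] at h1
      rw [hpos _ (sub_nonneg.mpr h), h1, ← mul_assoc, hl b hb, one_mul]
    · have h1 := hadd a (b - a) ha (sub_nonneg.mpr h.le)
      rw [add_sub_cancel] at h1
      rw [hneg _ (sub_neg.mpr h), h1, star_mul, mul_assoc, hl a ha, mul_one, neg_sub]
  have hunit : ∀ t, G t ∈ unitary (E →L[ℂ] E) := by
    intro t
    rcases le_or_gt 0 t with h | h
    · rw [hpos t h]; exact hU t h
    · rw [hneg t h]; exact Unitary.star_mem (hU (-t) (by linarith))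
  have hmul : ∀ s t, G (s + t) = G s * G t := by
    intro s t
    have key : ∀ a b c d, 0 ≤ a → 0 ≤ b → 0 ≤ c → 0 ≤ d →
        G (a - b + (c - d)) = G (a - b) * G (c - d) := by
      intro a b c d ha hb hc hd
      have e1 : a - b + (c - d) = (a + c) - (d + b) := by ring
      rw [e1, ← hG (a + c) (d + b) (by positivity) (by positivity), hadd a c ha hc,
        hadd d b hd hb, star_mul, ← hG a b ha hb, ← hG c d hc hd]
      have e2 : U c * star (U b) = star (U b) * U c := (hG c b hc hb).trans (hG' c b hc hb).symm
      simp only [mul_assoc]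
      rw [← mul_assoc (U c), e2, mul_assoc]
    have := key (max s 0) (max (-s) 0) (max t 0) (max (-t) 0) (le_max_right _ _)
      (le_max_right _ _) (le_max_right _ _) (le_max_right _ _)
    have e : ∀ r : ℝ, max r 0 - max (-r) 0 = r := by
      intro r
      rcases le_total 0 r with h | h
      · rw [max_eq_left h, max_eq_right (by linarith), sub_zero]
      · rw [max_eq_right h, max_eq_left (by linarith)]; ring
    rwa [e, e] at this
  have hnorm : ∀ x r, ‖G r x - x‖ = ‖U |r| x - x‖ := by
    intro x r
    rcases le_or_gt 0 r with h | h
    · rw [hpos r h, abs_of_nonneg h]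
    · rw [hneg r h, abs_of_neg h]
      have hr' : 0 ≤ -r := by linarith
      rw [← norm_map_of_mem_unitary (hU (-r) hr'), map_sub, norm_sub_rev]
      congr 2
      exact DFunLike.congr_fun (hr (-r) hr') x
  have hc0 : ∀ x, Tendsto (fun r => G r x) (𝓝 0) (𝓝 x) := by
    intro x
    rw [tendsto_iff_norm_sub_tendsto_zero]
    simp only [hnorm]
    have h1 := tendsto_iff_norm_sub_tendsto_zero.mp (hc x)
    refine h1.comp (tendsto_nhdsWithin_iff.mpr ⟨?_, Eventually.of_forall fun r => abs_nonneg r⟩)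
    simpa using (continuous_abs.tendsto (0 : ℝ))
  refine ⟨G, ⟨?_, hmul, hunit, fun x => ?_⟩, hpos⟩
  · rw [hpos 0 le_rfl, h0]
  · rw [continuous_iff_continuousAt]
    intro t
    have h1 : Tendsto (fun s => s - t) (𝓝 t) (𝓝 0) := by
      simpa using (continuous_sub_right t).tendsto t
    have h2 := ((G t).continuous.tendsto x).comp ((hc0 x).comp h1)
    refine h2.congr fun s => ?_
    change (G t * G (s - t)) x = _
    rw [← hmul, add_sub_cancel]

end Semigroup

/-! ### The Fourier transform on `L²(ℝ; 𝔥)` -/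

section FourierL2

variable {𝔥 : Type*} [NormedAddCommGroup 𝔥] [InnerProductSpace ℂ 𝔥] [CompleteSpace 𝔥]

theorem integrable_of_mem_boundedSupport {f : Lp 𝔥 2 (volume : Measure ℝ)}
    (hf : f ∈ boundedSupport 𝔥 volume) : Integrable f := by
  obtain ⟨R, hR⟩ := hf
  have h1 : IntegrableOn f (Set.Icc (-R) R) :=
    (locallyIntegrable_Lp f).integrableOn_isCompact isCompact_Icc
  refine (integrable_indicator_iff measurableSet_Icc |>.mpr h1).congr ?_
  filter_upwards [hR] with x hx
  by_cases h : x ∈ Set.Icc (-R) R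
  · rw [Set.indicator_of_mem h]
  · rw [Set.indicator_of_notMem h, hx]
    rw [Set.mem_Icc, ← abs_le] at h
    exact not_le.mp h

theorem fourier_eq_oneBra (g : Lp 𝔥 2 (volume : Measure ℝ)) (ξ : ℝ) :
    𝓕 (g : ℝ → 𝔥) ξ = oneBra (2 * Real.pi * ξ) g := by
  rw [Real.fourier_eq', oneBra]
  refine integral_congr_ae (ae_of_all _ fun x => ?_)
  simp only [RCLike.inner_apply, conj_trivial]
  congr 2
  push_cast
  ring

theorem continuous_oneBra {g : Lp 𝔥 2 (volume : Measure ℝ)} (hg : Integrable g) :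
    Continuous fun u => oneBra u g := by
  refine continuous_of_dominated (fun u => ?_) (fun u => ae_of_all _ fun x => ?_) hg.norm
    (ae_of_all _ fun x => by fun_prop)
  · exact (Continuous.aestronglyMeasurable (by fun_prop)).smul hg.1
  · rw [norm_smul]
    have := norm_exp_I_mul (-u) x
    push_cast at this
    rw [show -(Complex.I * u * x) = Complex.I * -u * x by ring, this, one_mul]

/-- For integrable functions, the `L²` Fourier transform is given by the Fourier integral. -/
theorem coeFn_fourier {g : Lp 𝔥 2 (volume : Measure ℝ)} (hg : Integrable g) :
    (𝓕 g : Lp 𝔥 2 (volume : Measure ℝ)) =ᵐ[volume] fun ξ => oneBra (2 * Real.pi * ξ) g := by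
  have hc : Continuous fun ξ => oneBra (2 * Real.pi * ξ) g :=
    (continuous_oneBra hg).comp (continuous_const.mul continuous_id)
  refine ae_eq_of_integral_contDiff_smul_eq (locallyIntegrable_Lp _) hc.locallyIntegrable
    fun φ hφ hφc => ?_
  have h1 : HasCompactSupport fun x => (φ x : ℂ) :=
    hφc.comp_left (g := fun r : ℝ => (r : ℂ)) Complex.ofReal_zero
  have h2 : ContDiff ℝ (↑(⊤ : ℕ∞)) fun x => (φ x : ℂ) := Complex.ofRealCLM.contDiff.comp hφ
  let Φ : 𝓢(ℝ, ℂ) := h1.toSchwartzMap h2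
  have h3 : ∀ x, Φ x = (φ x : ℂ) := fun x => rfl
  have h4 : ∀ f : ℝ → 𝔥, ∫ x, φ x • f x = ∫ x, Φ x • f x := fun f => by
    simp only [h3]; rfl
  rw [h4, h4, ← Lp.toTemperedDistribution_apply, ← Lp.fourier_toTemperedDistribution_eq,
    TemperedDistribution.fourier_apply, Lp.toTemperedDistribution_apply]
  simp only [← fourier_eq_oneBra]
  have := VectorFourier.integral_fourierIntegral_smul_eq_flip (L := innerₗ ℝ)
    Real.continuous_fourierChar continuous_inner (Φ.integrable (μ := volume)) hg
  rw [flip_innerₗ] at this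
  exact this

/-- Translation by `τ` on `L²(ℝ; 𝔥)`. -/
def translate (τ : ℝ) : Lp 𝔥 2 (volume : Measure ℝ) →L[ℂ] Lp 𝔥 2 (volume : Measure ℝ) :=
  (Lp.compMeasurePreservingₗᵢ ℂ (· + τ)
    (measurePreserving_add_right volume τ)).toContinuousLinearMap

theorem coeFn_translate (τ : ℝ) (g : Lp 𝔥 2 (volume : Measure ℝ)) :
    translate τ g =ᵐ[volume] fun ξ => g (ξ + τ) :=
  Lp.coeFn_compMeasurePreserving g (measurePreserving_add_right volume τ)

theorem integrable_charOn {g : Lp 𝔥 2 (volume : Measure ℝ)} (hg : Integrable g) (t : ℝ) :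
    Integrable (charOn volume t g) := by
  refine hg.congr' (Lp.aestronglyMeasurable _) ?_
  filter_upwards [coeFn_charOn t g] with x hx
  rw [hx, norm_smul, norm_exp_I_mul, one_mul]

theorem oneBra_charOn (u t : ℝ) (g : Lp 𝔥 2 (volume : Measure ℝ)) :
    oneBra u (charOn volume t g) = oneBra (u - t) g := by
  rw [oneBra, oneBra]
  refine integral_congr_ae ?_
  filter_upwards [coeFn_charOn t g] with x hx
  rw [hx, smul_smul, ← Complex.exp_add]
  congr 2
  push_cast
  ring

theorem fourier_charOn (t : ℝ) (g : Lp 𝔥 2 (volume : Measure ℝ)) :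
    𝓕 (charOn volume (-t) g) = translate (t / (2 * Real.pi)) (𝓕 g) := by
  have hF : Continuous fun g : Lp 𝔥 2 (volume : Measure ℝ) => 𝓕 g :=
    (Lp.fourierTransformₗᵢ ℝ 𝔥).continuous
  refine congrFun (Continuous.ext_on (dense_boundedSupport (E := 𝔥) (μ := volume))
    (hF.comp (charOn volume (-t)).continuous) ((translate _).continuous.comp hF) fun g hg => ?_) g
  have hgi := integrable_of_mem_boundedSupport hg
  refine Lp.ext ?_
  filter_upwards [coeFn_fourier (integrable_charOn hgi (-t)),
    coeFn_translate (t / (2 * Real.pi)) (𝓕 g),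
    (measurePreserving_add_right volume (t / (2 * Real.pi))).quasiMeasurePreserving.ae
      (coeFn_fourier hgi)] with ξ h1 h2 h3
  refine h1.trans (Eq.trans ?_ h2.symm)
  rw [h3, oneBra_charOn]
  congr 1
  field_simp
  ring

theorem continuous_charOn_apply {μ : Measure ℝ} (g : Lp 𝔥 2 μ) :
    Continuous fun t => charOn μ (-t) g := by
  refine continuous_orbit_of_dense (U := fun t => charOn μ (-t)) (fun t x => (norm_charOn _ _).le)
    dense_boundedSupport (fun f hf => ?_) g
  obtain ⟨h, hh⟩ := exists_mul_of_boundedSupport hf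
  exact continuous_iff_continuousAt.mpr fun t => (hasDerivAt_charOn hf hh t).continuousAt

end FourierL2

/-! ### Direct sums of operators -/

section DirectSum

variable {E F : Type*}
  [NormedAddCommGroup E] [InnerProductSpace ℂ E] [CompleteSpace E]
  [NormedAddCommGroup F] [InnerProductSpace ℂ F] [CompleteSpace F]

theorem directSum_mul (A C : E →L[ℂ] E) (B D : F →L[ℂ] F) :
    directSum A B * directSum C D = directSum (A * C) (B * D) := rfl

theorem directSum_one : directSum (1 : E →L[ℂ] E) (1 : F →L[ℂ] F) = 1 := rfl

theorem adjoint_directSum {E' F' : Type*}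
    [NormedAddCommGroup E'] [InnerProductSpace ℂ E'] [CompleteSpace E']
    [NormedAddCommGroup F'] [InnerProductSpace ℂ F'] [CompleteSpace F']
    (A : E →L[ℂ] E') (B : F →L[ℂ] F') :
    adjoint (directSum A B) = directSum (adjoint A) (adjoint B) := by
  refine ((ContinuousLinearMap.eq_adjoint_iff _ _).mpr fun x y => ?_).symm
  rw [WithLp.prod_inner_apply, WithLp.prod_inner_apply]
  exact congrArg₂ (· + ·) (adjoint_inner_left A _ _) (adjoint_inner_left B _ _)

theorem directSum_mem_unitary {A : E →L[ℂ] E} {B : F →L[ℂ] F} (hA : A ∈ unitary (E →L[ℂ] E))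
    (hB : B ∈ unitary (F →L[ℂ] F)) :
    directSum A B ∈ unitary (WithLp 2 (E × F) →L[ℂ] WithLp 2 (E × F)) := by
  rw [Unitary.mem_iff, star_eq_adjoint] at *
  rw [adjoint_directSum, directSum_mul, directSum_mul, hA.1, hA.2, hB.1, hB.2]
  exact ⟨directSum_one, directSum_one⟩

theorem charOn_mem_unitary {μ : Measure ℝ} (t : ℝ) :
    (charOn μ t : Lp E 2 μ →L[ℂ] Lp E 2 μ) ∈ unitary (Lp E 2 μ →L[ℂ] Lp E 2 μ) := by
  rw [Unitary.mem_iff, star_eq_adjoint, adjoint_charOn, ← charOn_add, ← charOn_add, neg_add_cancel,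
    add_neg_cancel, charOn_zero]
  exact ⟨rfl, rfl⟩

theorem expZR_mem_unitary (t : ℝ) :
    (expZR t : WithLp 2 (E × Lp F 2 (volume : Measure ℝ)) →L[ℂ] _) ∈
      unitary (WithLp 2 (E × Lp F 2 (volume : Measure ℝ)) →L[ℂ]
        WithLp 2 (E × Lp F 2 (volume : Measure ℝ))) :=
  directSum_mem_unitary (one_mem _) (charOn_mem_unitary t)

theorem expZR_zero :
    (expZR 0 : WithLp 2 (E × Lp F 2 (volume : Measure ℝ)) →L[ℂ] _) = 1 := by
  rw [expZR, mulChar_eq_charOn, charOn_zero]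
  rfl

theorem expZR_add (s t : ℝ) :
    (expZR (s + t) : WithLp 2 (E × Lp F 2 (volume : Measure ℝ)) →L[ℂ] _) = expZR s * expZR t := by
  rw [expZR, mulChar_eq_charOn, charOn_add]
  rfl

theorem adjoint_expZR (t : ℝ) :
    adjoint (expZR t : WithLp 2 (E × Lp F 2 (volume : Measure ℝ)) →L[ℂ] _) = expZR (-t) := by
  rw [expZR, adjoint_directSum, mulChar_eq_charOn, adjoint_charOn, adjoint_id]
  rfl

end DirectSum

/-! ### The dilation group -/

section DilationGroup

variable {𝒦 𝔥 : Type*}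
  [NormedAddCommGroup 𝒦] [InnerProductSpace ℂ 𝒦] [CompleteSpace 𝒦]
  [NormedAddCommGroup 𝔥] [InnerProductSpace ℂ 𝔥] [CompleteSpace 𝔥]
  {Y : 𝒦 →L[ℂ] 𝒦} {N : 𝒦 →L[ℂ] 𝔥}

/-- `M` is the map from the initial state and input field to the state at time `τ` and the output
field. -/
def IsStep (Y : 𝒦 →L[ℂ] 𝒦) (N : 𝒦 →L[ℂ] 𝔥) (τ : ℝ)
    (M : WithLp 2 (𝒦 × Lp 𝔥 2 (volume : Measure ℝ)) →L[ℂ]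
      WithLp 2 (𝒦 × Lp 𝔥 2 (volume : Measure ℝ))) : Prop :=
  (∀ ψ, (M ψ).fst = traj Y N ψ.fst ψ.snd τ) ∧
    ∀ ψ, ∀ᵐ ξ, (M ψ).snd ξ = ψ.snd ξ -
      Complex.I • (Set.Ioc 0 τ).indicator (fun ξ => N (traj Y N ψ.fst ψ.snd ξ)) ξ

theorem withLp_ext {x y : WithLp 2 (𝒦 × Lp 𝔥 2 (volume : Measure ℝ))} (h1 : x.fst = y.fst)
    (h2 : x.snd =ᵐ[volume] y.snd) : x = y :=
  (WithLp.prodContinuousLinearEquiv 2 ℂ 𝒦 (Lp 𝔥 2 (volume : Measure ℝ))).injective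
    (Prod.ext h1 (Lp.ext h2))

theorem IsStep.mul_translate_mul {σ τ : ℝ} (hσ : 0 ≤ σ) (hτ : 0 ≤ τ)
    {Mσ Mτ M : WithLp 2 (𝒦 × Lp 𝔥 2 (volume : Measure ℝ)) →L[ℂ]
      WithLp 2 (𝒦 × Lp 𝔥 2 (volume : Measure ℝ))} (h1 : IsStep Y N σ Mσ) (h2 : IsStep Y N τ Mτ)
    (h3 : IsStep Y N (σ + τ) M) :
    Mσ * directSum 1 (translate τ) * Mτ = directSum 1 (translate τ) * M := by
  refine ContinuousLinearMap.ext fun ψ => ?_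
  change Mσ (directSum (1 : 𝒦 →L[ℂ] 𝒦) (translate τ) (Mτ ψ)) =
    directSum (1 : 𝒦 →L[ℂ] 𝒦) (translate τ) (M ψ)
  set χ := directSum (1 : 𝒦 →L[ℂ] 𝒦) (translate τ) (Mτ ψ) with hχ
  have hχ1 : χ.fst = traj Y N ψ.fst ψ.snd τ := h2.1 ψ
  have hq := (measurePreserving_add_right (volume : Measure ℝ) τ).quasiMeasurePreserving
  have hχ2 : ∀ᵐ ξ, χ.snd ξ = ψ.snd (ξ + τ) -
      Complex.I • (Set.Ioc 0 τ).indicator (fun ξ => N (traj Y N ψ.fst ψ.snd ξ)) (ξ + τ) := by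
    filter_upwards [coeFn_translate τ (Mτ ψ).snd, hq.ae (h2.2 ψ)] with ξ e1 e2
    exact Eq.trans e1 e2
  have htr : ∀ s, 0 ≤ s → traj Y N χ.fst χ.snd s = traj Y N ψ.fst ψ.snd (s + τ) := by
    intro s hs
    rw [add_comm s, traj_comp_add (locallyIntegrable_Lp _), hχ1]
    refine traj_congr hs ?_ _
    filter_upwards [hχ2] with ξ e1 e2
    rw [e1, Set.indicator_of_notMem, smul_zero, sub_zero]
    rintro ⟨-, h⟩
    linarith [e2.1]
  refine withLp_ext ?_ ?_
  · rw [h1.1, htr σ hσ]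
    exact (h3.1 ψ).symm
  · filter_upwards [h1.2 χ, hχ2, coeFn_translate τ (M ψ).snd, hq.ae (h3.2 ψ)] with ξ e1 e2 e3 e4
    refine e1.trans (Eq.trans ?_ (Eq.trans e3 e4).symm)
    rw [e2, sub_sub, ← smul_add]
    congr 2
    by_cases ha : ξ ∈ Set.Ioc 0 σ
    · have hb : ξ + τ ∉ Set.Ioc 0 τ := fun h => by linarith [h.2, ha.1]
      have hc : ξ + τ ∈ Set.Ioc 0 (σ + τ) := ⟨by linarith [ha.1], by linarith [ha.2]⟩
      rw [Set.indicator_of_mem ha, Set.indicator_of_notMem hb, Set.indicator_of_mem hc, zero_add,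
        htr ξ ha.1.le]
    · rw [Set.indicator_of_notMem ha, add_zero]
      by_cases hb : ξ + τ ∈ Set.Ioc 0 τ
      · have hc : ξ + τ ∈ Set.Ioc 0 (σ + τ) := ⟨hb.1, by linarith [hb.2]⟩
        rw [Set.indicator_of_mem hb, Set.indicator_of_mem hc]
      · have hc : ξ + τ ∉ Set.Ioc 0 (σ + τ) := by
          rintro ⟨h, h'⟩
          rcases le_or_gt ξ 0 with h0 | h0
          · exact hb ⟨h, by linarith⟩
          · exact ha ⟨h0, by linarith⟩
        rw [Set.indicator_of_notMem hb, Set.indicator_of_notMem hc]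

variable (𝒦 𝔥) in
/-- The Fourier transform on the second summand of `𝒦 ⊕ L²(ℝ; 𝔥)`. -/
def fourierZ : WithLp 2 (𝒦 × Lp 𝔥 2 (volume : Measure ℝ)) →L[ℂ]
    WithLp 2 (𝒦 × Lp 𝔥 2 (volume : Measure ℝ)) :=
  directSum 1 ((Lp.fourierTransformₗᵢ ℝ 𝔥 : Lp 𝔥 2 (volume : Measure ℝ) ≃L[ℂ]
    Lp 𝔥 2 (volume : Measure ℝ)) : Lp 𝔥 2 (volume : Measure ℝ) →L[ℂ] Lp 𝔥 2 (volume : Measure ℝ))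

theorem fourierZ_mem_unitary : fourierZ 𝒦 𝔥 ∈
    unitary (WithLp 2 (𝒦 × Lp 𝔥 2 (volume : Measure ℝ)) →L[ℂ]
      WithLp 2 (𝒦 × Lp 𝔥 2 (volume : Measure ℝ))) := by
  refine directSum_mem_unitary (one_mem _) ?_
  rw [Unitary.mem_iff, star_eq_adjoint, LinearIsometryEquiv.adjoint_eq_symm]
  constructor
  · ext1 x
    exact (Lp.fourierTransformₗᵢ ℝ 𝔥).symm_apply_apply x
  · ext1 x
    exact (Lp.fourierTransformₗᵢ ℝ 𝔥).apply_symm_apply x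

theorem fourierZ_mul_expZR (t : ℝ) :
    fourierZ 𝒦 𝔥 * expZR (-t) =
      directSum (1 : 𝒦 →L[ℂ] 𝒦) (translate (t / (2 * Real.pi))) * fourierZ 𝒦 𝔥 := by
  rw [fourierZ, expZR, mulChar_eq_charOn]
  refine (directSum_mul _ _ _ _).trans (Eq.trans ?_ (directSum_mul _ _ _ _).symm)
  congr 1
  ext1 g
  exact fourier_charOn t g

theorem continuous_expZR_apply (ψ : WithLp 2 (𝒦 × Lp 𝔥 2 (volume : Measure ℝ))) :
    Continuous fun t => expZR (-t) ψ :=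
  (WithLp.prodContinuousLinearEquiv 2 ℂ 𝒦 (Lp 𝔥 2 (volume : Measure ℝ))).symm.continuous.comp
    (continuous_const.prodMk (continuous_charOn_apply ψ.snd))

/-- The group that is, in the interaction picture and in Fourier space, given by the scattering
steps of `(Y, N)`. -/
theorem exists_unitaryGroup_of_step (hY : ∀ b, 2 * (⟪b, Y b⟫_ℂ).im = -‖N b‖ ^ 2) :
    ∃ U : ℝ → WithLp 2 (𝒦 × Lp 𝔥 2 (volume : Measure ℝ)) →L[ℂ]
        WithLp 2 (𝒦 × Lp 𝔥 2 (volume : Measure ℝ)), IsUnitaryGroup U ∧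
      ∀ t, 0 ≤ t → ∃ M, IsStep Y N (t / (2 * Real.pi)) M ∧
        U t = expZR (-t) * star (fourierZ 𝒦 𝔥) * M * fourierZ 𝒦 𝔥 := by
  have hpi : (0 : ℝ) < 2 * Real.pi := by positivity
  choose C hC0 hC using fun T : Set.Ici (0 : ℝ) => exists_norm_traj_le Y N T.2
  have hex : ∀ τ : Set.Ici (0 : ℝ), ∃ M : WithLp 2 (𝒦 × Lp 𝔥 2 (volume : Measure ℝ)) →L[ℂ]
        WithLp 2 (𝒦 × Lp 𝔥 2 (volume : Measure ℝ)),
      M ∈ unitary (WithLp 2 (𝒦 × Lp 𝔥 2 (volume : Measure ℝ)) →L[ℂ]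
        WithLp 2 (𝒦 × Lp 𝔥 2 (volume : Measure ℝ))) ∧ IsStep Y N τ M ∧
      ∀ ψ, ‖(M ψ).snd - ψ.snd‖ ≤ ‖N‖ * C (max τ ⟨1, Set.mem_Ici.mpr zero_le_one⟩) * √τ * ‖ψ‖ := by
    intro τ
    obtain ⟨M, h1, h2, h3, h4⟩ := exists_step hY (T := (max τ ⟨1, Set.mem_Ici.mpr zero_le_one⟩ : Set.Ici (0 : ℝ)))
      τ.2 (by exact_mod_cast le_max_left _ _) (hC0 _) (hC _)
    exact ⟨M, h1, ⟨h2, h3⟩, h4⟩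
  choose M' hM'u hM'S hM'n using hex
  let M : ℝ → WithLp 2 (𝒦 × Lp 𝔥 2 (volume : Measure ℝ)) →L[ℂ]
        WithLp 2 (𝒦 × Lp 𝔥 2 (volume : Measure ℝ)) := fun τ => 
      M' ⟨max τ 0, Set.mem_Ici.mpr (le_max_right _ _)⟩
  have hMM' : ∀ τ (hτ : 0 ≤ τ), M τ = M' ⟨τ, hτ⟩ := fun τ hτ => by
    simp only [M, max_eq_left hτ]
  have hMu : ∀ τ, M τ ∈ unitary _ := fun τ => hM'u _
  have hMS : ∀ τ, 0 ≤ τ → IsStep Y N τ (M τ) := fun τ hτ => by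
    rw [hMM' τ hτ]; exact hM'S ⟨τ, hτ⟩
  set Fz := fourierZ 𝒦 𝔥 with hFz
  have hFl : star Fz * Fz = 1 := (Unitary.mem_iff.mp fourierZ_mem_unitary).1
  have hFr : Fz * star Fz = 1 := (Unitary.mem_iff.mp fourierZ_mem_unitary).2
  let U : ℝ → WithLp 2 (𝒦 × Lp 𝔥 2 (volume : Measure ℝ)) →L[ℂ]
        WithLp 2 (𝒦 × Lp 𝔥 2 (volume : Measure ℝ)) :=
    fun t => expZR (-t) * star Fz * M (t / (2 * Real.pi)) * Fz
  have hM0 : M 0 = 1 := by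
    refine ContinuousLinearMap.ext fun ψ => withLp_ext ?_ ?_
    · rw [(hMS 0 le_rfl).1, traj_zero]; rfl
    · filter_upwards [(hMS 0 le_rfl).2 ψ] with ξ h1
      rw [h1]
      simp
  have hMt : ∀ ψ, Tendsto (fun τ => M τ ψ) (𝓝[≥] 0) (𝓝 ψ) := by
    intro ψ
    have h1 : Tendsto (fun τ => (M τ ψ).fst) (𝓝[≥] 0) (𝓝 ψ.fst) := by
      have h := ((continuous_traj (Y := Y) (N := N) (locallyIntegrable_Lp ψ.snd)
        ψ.fst).tendsto 0).mono_left (nhdsWithin_le_nhds (s := Set.Ici 0))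
      rw [traj_zero] at h
      refine h.congr' ?_
      filter_upwards [self_mem_nhdsWithin] with τ hτ
      exact ((hMS τ hτ).1 ψ).symm
    have h2 : Tendsto (fun τ => (M τ ψ).snd) (𝓝[≥] 0) (𝓝 ψ.snd) := by
      rw [tendsto_iff_norm_sub_tendsto_zero]
      have h3 : Tendsto (fun τ => ‖N‖ * C ⟨1, Set.mem_Ici.mpr zero_le_one⟩ * √τ * ‖ψ‖) (𝓝[≥] 0) (𝓝 0) := by
        have : Continuous fun τ => ‖N‖ * C ⟨1, Set.mem_Ici.mpr zero_le_one⟩ * √τ * ‖ψ‖ := by fun_prop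
        simpa using (this.tendsto 0).mono_left (nhdsWithin_le_nhds (s := Set.Ici (0 : ℝ)))
      refine squeeze_zero' (Eventually.of_forall fun _ => norm_nonneg _) ?_ h3
      filter_upwards [Icc_mem_nhdsGE (zero_lt_one (α := ℝ))] with τ hτ
      rw [hMM' τ hτ.1]
      have := hM'n ⟨τ, hτ.1⟩ ψ
      rwa [max_eq_right (show (⟨τ, hτ.1⟩ : Set.Ici (0 : ℝ)) ≤ ⟨1, Set.mem_Ici.mpr zero_le_one⟩ from hτ.2)] at this
    exact ((WithLp.prodContinuousLinearEquiv 2 ℂ 𝒦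
      (Lp 𝔥 2 (volume : Measure ℝ))).symm.continuous.tendsto (ψ.fst, ψ.snd)).comp
        (h1.prodMk_nhds h2)
  obtain ⟨G, hG, hGU⟩ := exists_unitaryGroup_of_semigroup (U := U)
    (fun t _ => mul_mem (mul_mem (mul_mem (expZR_mem_unitary _)
      (Unitary.star_mem fourierZ_mem_unitary)) (hMu _)) fourierZ_mem_unitary)
    (by simp only [U, neg_zero, zero_div, hM0, expZR_zero, one_mul, mul_one, hFl])
    (fun s t hs ht => by
      have hσ : 0 ≤ s / (2 * Real.pi) := by positivity
      have hτ : 0 ≤ t / (2 * Real.pi) := by positivity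
      have e1 := (hMS _ hσ).mul_translate_mul hσ hτ (hMS _ hτ) (hMS _ (add_nonneg hσ hτ))
      have e2 := fourierZ_mul_expZR (𝒦 := 𝒦) (𝔥 := 𝔥) t
      rw [← hFz] at e2
      have e3 : star Fz * directSum (1 : 𝒦 →L[ℂ] 𝒦) (translate (t / (2 * Real.pi))) =
          expZR (-t) * star Fz := by
        calc _ = star Fz * (directSum (1 : 𝒦 →L[ℂ] 𝒦) (translate (t / (2 * Real.pi))) * Fz) * star Fz := by
              simp only [mul_assoc, hFr, mul_one]
          _ = star Fz * (Fz * expZR (-t)) * star Fz := by rw [e2]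
          _ = _ := by rw [← mul_assoc (star Fz), hFl, one_mul]
      simp only [U]
      rw [neg_add, expZR_add, add_div]
      calc _ = expZR (-s) * (expZR (-t) * star Fz) *
              M (s / (2 * Real.pi) + t / (2 * Real.pi)) * Fz := by simp only [mul_assoc]
        _ = expZR (-s) * star Fz * (directSum (1 : 𝒦 →L[ℂ] 𝒦) (translate (t / (2 * Real.pi))) *
              M (s / (2 * Real.pi) + t / (2 * Real.pi))) * Fz := by
            rw [← e3]; simp only [mul_assoc]
        _ = expZR (-s) * star Fz * M (s / (2 * Real.pi)) *
              (directSum (1 : 𝒦 →L[ℂ] 𝒦) (translate (t / (2 * Real.pi))) * (Fz * star Fz)) *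
              M (t / (2 * Real.pi)) * Fz := by
            rw [← e1, hFr, mul_one]; simp only [mul_assoc]
        _ = expZR (-s) * star Fz * M (s / (2 * Real.pi)) *
              ((directSum (1 : 𝒦 →L[ℂ] 𝒦) (translate (t / (2 * Real.pi))) * Fz) * star Fz) *
              M (t / (2 * Real.pi)) * Fz := by simp only [mul_assoc]
        _ = _ := by rw [← e2]; simp only [mul_assoc])
    (fun ψ => by
      have hd : Tendsto (fun t : ℝ => t / (2 * Real.pi)) (𝓝[≥] 0) (𝓝[≥] 0) := by
        refine tendsto_nhdsWithin_iff.mpr ⟨?_, ?_⟩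
        · have : Continuous fun t : ℝ => t / (2 * Real.pi) := by fun_prop
          simpa using (this.tendsto 0).mono_left (nhdsWithin_le_nhds (s := Set.Ici (0 : ℝ)))
        · filter_upwards [self_mem_nhdsWithin] with t ht
          exact div_nonneg ht hpi.le
      have h1 : Tendsto (fun t => star Fz (M (t / (2 * Real.pi)) (Fz ψ))) (𝓝[≥] 0) (𝓝 ψ) := by
        have h := (((star Fz).continuous.tendsto (Fz ψ)).comp ((hMt (Fz ψ)).comp hd))
        have e : star Fz (Fz ψ) = ψ := DFunLike.congr_fun hFl ψ
        rwa [e] at h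
      have h2 : Tendsto (fun t => expZR (-t) ψ) (𝓝[≥] 0) (𝓝 ψ) := by
        have h := ((continuous_expZR_apply ψ).tendsto 0).mono_left
          (nhdsWithin_le_nhds (s := Set.Ici (0 : ℝ)))
        rwa [neg_zero, expZR_zero] at h
      rw [tendsto_iff_norm_sub_tendsto_zero] at h1 h2 ⊢
      have h3 := h1.add h2
      rw [add_zero] at h3
      refine squeeze_zero (fun _ => norm_nonneg _) (fun t => ?_) h3
      change ‖expZR (-t) (star Fz (M (t / (2 * Real.pi)) (Fz ψ))) - ψ‖ ≤ _
      refine (norm_sub_le_norm_sub_add_norm_sub _ (expZR (-t) ψ) _).trans ?_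
      rw [← map_sub, norm_map_of_mem_unitary (expZR_mem_unitary _)])
  exact ⟨G, hG, fun t ht => ⟨M (t / (2 * Real.pi)), hMS _ (by positivity), hGU t ht⟩⟩

end DilationGroup

/-! ### The form of the dilation group -/

section Form

variable {𝒦 𝔥 : Type*}
  [NormedAddCommGroup 𝒦] [InnerProductSpace ℂ 𝒦] [CompleteSpace 𝒦]
  [NormedAddCommGroup 𝔥] [InnerProductSpace ℂ 𝔥] [CompleteSpace 𝔥]

/-- The input field `(2π)^{-1/2} (1| e^{-iuZ_R} g` as a function of time. -/
def inputField (g : Lp 𝔥 2 (volume : Measure ℝ)) (u : ℝ) : 𝔥 :=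
  (Real.sqrt (2 * Real.pi) : ℂ)⁻¹ • oneBra u g

theorem continuous_inputField {g : Lp 𝔥 2 (volume : Measure ℝ)} (hg : Integrable g) :
    Continuous (inputField g) :=
  (continuous_oneBra hg).const_smul _

theorem bexpI_smul (c : ℝ) (B : 𝒦 →L[ℂ] 𝒦) (t : ℝ) : bexpI ((c : ℂ) • B) t = bexpI B (c * t) := by
  rw [bexpI, bexpI, smul_smul]
  congr 2
  push_cast
  ring

theorem sqrt_two_pi_mul_self :
    (Real.sqrt (2 * Real.pi) : ℂ) * (Real.sqrt (2 * Real.pi) : ℂ) = 2 * Real.pi := by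
  rw [← Complex.ofReal_mul, Real.mul_self_sqrt (by positivity)]
  push_cast
  rfl

theorem sqrt_two_pi_ne_zero : (Real.sqrt (2 * Real.pi) : ℂ) ≠ 0 := by
  rw [Complex.ofReal_ne_zero]
  positivity

theorem traj_rescale (Υ : 𝒦 →L[ℂ] 𝒦) (ν : 𝒦 →L[ℂ] 𝔥) (b : 𝒦) (g : Lp 𝔥 2 (volume : Measure ℝ))
    (ξ : ℝ) :
    traj (((2 * Real.pi : ℝ) : ℂ) • Υ) ((Real.sqrt (2 * Real.pi) : ℂ) • ν) b
      (fun ξ => oneBra (2 * Real.pi * ξ) g) ξ = traj Υ ν b (inputField g) (2 * Real.pi * ξ) := by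
  have hpi : (2 * Real.pi : ℝ) ≠ 0 := by positivity
  rw [traj, traj, bexpI_smul]
  congr 3
  rw [drive, drive]
  have h1 := intervalIntegral.integral_comp_mul_left (a := 0) (b := ξ)
    (fun w => bexpI Υ (-w) (adjoint ((Real.sqrt (2 * Real.pi) : ℂ) • ν) (oneBra w g))) hpi
  rw [mul_zero] at h1
  refine Eq.trans ?_ (h1.trans ?_)
  · refine intervalIntegral.integral_congr fun w _ => ?_
    simp only [bexpI_smul, mul_neg]
  · rw [← intervalIntegral.integral_smul]
    refine intervalIntegral.integral_congr fun w _ => ?_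
    simp only [inputField, map_smul, LinearIsometryEquiv.map_smulₛₗ, smul_apply,
      Complex.conj_ofReal]
    rw [← Complex.coe_smul, smul_smul]
    congr 1
    have := sqrt_two_pi_mul_self
    have h0 := sqrt_two_pi_ne_zero
    push_cast
    rw [← this]
    field_simp

theorem inner_expZR_step (Υ : 𝒦 →L[ℂ] 𝒦) (ν : 𝒦 →L[ℂ] 𝔥) {t : ℝ} (ht : 0 ≤ t)
    {M : WithLp 2 (𝒦 × Lp 𝔥 2 (volume : Measure ℝ)) →L[ℂ]
      WithLp 2 (𝒦 × Lp 𝔥 2 (volume : Measure ℝ))}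
    (hM : IsStep (((2 * Real.pi : ℝ) : ℂ) • Υ) ((Real.sqrt (2 * Real.pi) : ℂ) • ν)
      (t / (2 * Real.pi)) M)
    {ψ ψ' : WithLp 2 (𝒦 × Lp 𝔥 2 (volume : Measure ℝ))} (hψ : Integrable ψ.snd)
    (hψ' : Integrable ψ'.snd) :
    ⟪ψ, expZR (-t) (star (fourierZ 𝒦 𝔥) (M (fourierZ 𝒦 𝔥 ψ')))⟫_ℂ =
      ⟪ψ.snd, mulChar (-t) ψ'.snd⟫_ℂ + ⟪ψ.fst, traj Υ ν ψ'.fst (inputField ψ'.snd) t⟫_ℂ -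
      Complex.I * (Real.sqrt (2 * Real.pi) : ℂ)⁻¹ * ∫ u in (0 : ℝ)..t,
        ⟪oneBra (u - t) ψ.snd, ν (traj Υ ν ψ'.fst (inputField ψ'.snd) u)⟫_ℂ := by
  have hpi : (0 : ℝ) < 2 * Real.pi := by positivity
  set β := traj Υ ν ψ'.fst (inputField ψ'.snd) with hβ
  set χ := fourierZ 𝒦 𝔥 ψ' with hχ
  have hχ2 : χ.snd = 𝓕 ψ'.snd := rfl
  have htr : ∀ ξ, traj (((2 * Real.pi : ℝ) : ℂ) • Υ) ((Real.sqrt (2 * Real.pi) : ℂ) • ν) χ.fst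
      χ.snd ξ = β (2 * Real.pi * ξ) := fun ξ => by
    rw [hβ, ← traj_rescale]
    exact traj_congr_ae (coeFn_fourier hψ') _ _
  have e0 : ⟪ψ, expZR (-t) (star (fourierZ 𝒦 𝔥) (M (fourierZ 𝒦 𝔥 ψ')))⟫_ℂ =
      ⟪fourierZ 𝒦 𝔥 (expZR t ψ), M χ⟫_ℂ := by
    rw [← adjoint_expZR, adjoint_inner_right, star_eq_adjoint, adjoint_inner_right]
  have e1 : ∀ᵐ ξ, ((M χ).snd - χ.snd : Lp 𝔥 2 (volume : Measure ℝ)) ξ =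
      (Set.Ioc 0 (t / (2 * Real.pi))).indicator
        (fun ξ => (-Complex.I * Real.sqrt (2 * Real.pi)) • ν (β (2 * Real.pi * ξ))) ξ := by
    filter_upwards [Lp.coeFn_sub (M χ).snd χ.snd, hM.2 χ] with ξ h1 h2
    rw [h1, Pi.sub_apply, h2]
    by_cases h : ξ ∈ Set.Ioc 0 (t / (2 * Real.pi))
    · rw [Set.indicator_of_mem h, Set.indicator_of_mem h, htr, smul_apply, smul_smul]
      module
    · rw [Set.indicator_of_notMem h, Set.indicator_of_notMem h]
      simp
  have e2 : ⟪𝓕 (charOn volume t ψ.snd), (M χ).snd - χ.snd⟫_ℂ =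
      -(Complex.I * (Real.sqrt (2 * Real.pi) : ℂ)⁻¹ * ∫ u in (0 : ℝ)..t,
        ⟪oneBra (u - t) ψ.snd, ν (β u)⟫_ℂ) := by
    rw [L2.inner_def]
    have e3 : ∫ ξ, ⟪(𝓕 (charOn volume t ψ.snd) : Lp 𝔥 2 (volume : Measure ℝ)) ξ,
        ((M χ).snd - χ.snd : Lp 𝔥 2 (volume : Measure ℝ)) ξ⟫_ℂ =
        ∫ ξ in Set.Ioc 0 (t / (2 * Real.pi)), (-Complex.I * Real.sqrt (2 * Real.pi)) *
          ⟪oneBra (2 * Real.pi * ξ - t) ψ.snd, ν (β (2 * Real.pi * ξ))⟫_ℂ := by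
      rw [← integral_indicator measurableSet_Ioc]
      refine integral_congr_ae ?_
      filter_upwards [e1, coeFn_fourier (integrable_charOn hψ t)] with ξ h1 h2
      rw [h1]
      by_cases h : ξ ∈ Set.Ioc 0 (t / (2 * Real.pi))
      · rw [Set.indicator_of_mem h, Set.indicator_of_mem h, inner_smul_right, h2, oneBra_charOn]
      · rw [Set.indicator_of_notMem h, Set.indicator_of_notMem h, inner_zero_right]
    have h1 := intervalIntegral.integral_comp_mul_left (a := 0) (b := t / (2 * Real.pi))
      (fun u => ⟪oneBra (u - t) ψ.snd, ν (β u)⟫_ℂ) hpi.ne'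
    rw [mul_zero, mul_div_cancel₀ _ hpi.ne'] at h1
    rw [e3, integral_const_mul, ← intervalIntegral.integral_of_le (by positivity), h1,
      ← Complex.coe_smul, smul_eq_mul]
    have h2 := sqrt_two_pi_mul_self
    have h0 := sqrt_two_pi_ne_zero
    push_cast
    rw [← h2]
    field_simp
  rw [e0, WithLp.prod_inner_apply]
  change ⟪ψ.fst, (M χ).fst⟫_ℂ + ⟪𝓕 (charOn volume t ψ.snd), (M χ).snd⟫_ℂ = _
  have e4 : (M χ).snd = χ.snd + ((M χ).snd - χ.snd) := by abel
  rw [e4, inner_add_right, e2, hM.1, htr, mul_div_cancel₀ _ hpi.ne', hχ2, Lp.inner_fourier_eq]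
  have e5 : ⟪charOn volume t ψ.snd, ψ'.snd⟫_ℂ = ⟪ψ.snd, mulChar (-t) ψ'.snd⟫_ℂ := by
    rw [mulChar_eq_charOn, ← inner_charOn_neg, neg_neg]
  rw [e5]
  ring

theorem traj_eq_sub_integral (Υ : 𝒦 →L[ℂ] 𝒦) (ν : 𝒦 →L[ℂ] 𝔥) (b : 𝒦) {g : ℝ → 𝔥}
    (hg : LocallyIntegrable g) (t : ℝ) :
    traj Υ ν b g t = bexpI Υ t b -
      Complex.I • ∫ u in (0 : ℝ)..t, bexpI Υ (t - u) (adjoint ν (g u)) := by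
  rw [traj, map_sub, map_smul, drive,
    ← ContinuousLinearMap.intervalIntegral_comp_comm _ (intervalIntegrable_drive hg 0 t)]
  congr 3
  funext u
  rw [sub_eq_add_neg, bexpI_add]
  rfl

theorem dilationForm_eq (Υ : 𝒦 →L[ℂ] 𝒦) (ν : 𝒦 →L[ℂ] 𝔥) (t : ℝ)
    {ψ ψ' : WithLp 2 (𝒦 × Lp 𝔥 2 (volume : Measure ℝ))} (hψ : Integrable ψ.snd)
    (hψ' : Integrable ψ'.snd) :
    dilationForm Υ ν t ψ ψ' =
      ⟪ψ.snd, mulChar (-t) ψ'.snd⟫_ℂ + ⟪ψ.fst, traj Υ ν ψ'.fst (inputField ψ'.snd) t⟫_ℂ -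
      Complex.I * (Real.sqrt (2 * Real.pi) : ℂ)⁻¹ * ∫ u in (0 : ℝ)..t,
        ⟪oneBra (u - t) ψ.snd, ν (traj Υ ν ψ'.fst (inputField ψ'.snd) u)⟫_ℂ := by
  set c : ℂ := (Real.sqrt (2 * Real.pi) : ℂ)⁻¹ with hc
  have hcc : c * c = (2 * Real.pi : ℂ)⁻¹ := by
    rw [hc, ← mul_inv, sqrt_two_pi_mul_self]
  have hgc := continuous_inputField hψ'
  have hoc := continuous_oneBra hψ'
  have hint : ∀ s, IntervalIntegrable
      (fun u => bexpI Υ (s - u) (adjoint ν (oneBra u ψ'.snd))) volume 0 s := fun s =>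
    (((continuous_bexpI Υ).comp (continuous_const.sub continuous_id)).clm_apply
      ((adjoint ν).continuous.comp hoc)).intervalIntegrable _ _
  set A : ℝ → 𝒦 := fun s => ∫ u in (0 : ℝ)..s, bexpI Υ (s - u) (adjoint ν (oneBra u ψ'.snd))
    with hA
  have hβ : ∀ s, traj Υ ν ψ'.fst (inputField ψ'.snd) s =
      bexpI Υ s ψ'.fst - (Complex.I * c) • A s := by
    intro s
    rw [traj_eq_sub_integral Υ ν _ hgc.locallyIntegrable, mul_smul, hA]
    simp only [inputField, map_smul, intervalIntegral.integral_smul]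
    rfl
  have hAc : Continuous A := by
    have h1 := continuous_traj (Y := Υ) (N := ν) hgc.locallyIntegrable ψ'.fst
    have h2 : Continuous fun s => bexpI Υ s ψ'.fst := (continuous_bexpI Υ).clm_apply
      continuous_const
    have h3 : A = fun s => (Complex.I * c)⁻¹ • (bexpI Υ s ψ'.fst -
        traj Υ ν ψ'.fst (inputField ψ'.snd) s) := by
      funext s
      rw [hβ, sub_sub_cancel, smul_smul, inv_mul_cancel₀, one_smul]
      exact mul_ne_zero Complex.I_ne_zero (inv_ne_zero sqrt_two_pi_ne_zero)
    rw [h3]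
    exact (h2.sub h1).const_smul _
  have hinner : ∀ (a : 𝒦) (s : ℝ), ∫ u in (0 : ℝ)..s,
      ⟪a, bexpI Υ (s - u) (adjoint ν (oneBra u ψ'.snd))⟫_ℂ = ⟪a, A s⟫_ℂ := fun a s =>
    (innerSL ℂ a).intervalIntegral_comp_comm (hint s)
  have hof : Continuous fun u => oneBra (u - t) ψ.snd :=
    (continuous_oneBra hψ).comp (continuous_id.sub continuous_const)
  have h5 : ∫ u₂ in (0 : ℝ)..t, ∫ u₁ in (0 : ℝ)..(t - u₂),
      ⟪oneBra (-u₂) ψ.snd, ν (bexpI Υ (t - u₂ - u₁) (adjoint ν (oneBra u₁ ψ'.snd)))⟫_ℂ =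
      ∫ u in (0 : ℝ)..t, ⟪oneBra (u - t) ψ.snd, ν (A u)⟫_ℂ := by
    have e1 := intervalIntegral.integral_comp_sub_left (a := 0) (b := t)
      (fun u => ⟪oneBra (u - t) ψ.snd, ν (A u)⟫_ℂ) t
    rw [sub_self, sub_zero] at e1
    rw [← e1]
    refine intervalIntegral.integral_congr fun u _ => ?_
    simp only [sub_sub_cancel_left]
    rw [← adjoint_inner_left, ← hinner]
    simp only [adjoint_inner_left]
  have h6 : ∫ u in (0 : ℝ)..t, ⟪oneBra (u - t) ψ.snd,
      ν (traj Υ ν ψ'.fst (inputField ψ'.snd) u)⟫_ℂ =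
      (∫ u in (0 : ℝ)..t, ⟪oneBra (u - t) ψ.snd, ν (bexpI Υ u ψ'.fst)⟫_ℂ) -
        Complex.I * c * ∫ u in (0 : ℝ)..t, ⟪oneBra (u - t) ψ.snd, ν (A u)⟫_ℂ := by
    have c1 : Continuous fun u => ⟪oneBra (u - t) ψ.snd, ν (bexpI Υ u ψ'.fst)⟫_ℂ :=
      hof.inner (ν.continuous.comp ((continuous_bexpI Υ).clm_apply continuous_const))
    have c2 : Continuous fun u => Complex.I * c * ⟪oneBra (u - t) ψ.snd, ν (A u)⟫_ℂ :=
      continuous_const.mul (hof.inner (ν.continuous.comp hAc))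
    rw [← intervalIntegral.integral_const_mul, ← intervalIntegral.integral_sub
      (c1.intervalIntegrable _ _) (c2.intervalIntegrable _ _)]
    refine intervalIntegral.integral_congr fun u _ => ?_
    simp only [hβ, map_sub, map_smul, inner_sub_right, inner_smul_right]
  rw [dilationForm, hinner, h5, h6, hβ, inner_sub_right, inner_smul_right, ← hcc, ← hc]
  simp only [neg_sub]
  linear_combination (c * c * ∫ u in (0 : ℝ)..t, ⟪oneBra (u - t) ψ.snd, ν (A u)⟫_ℂ) *
    (-Complex.I_mul_I)

theorem exists_singularFriedrichsGroup {Υ : 𝒦 →L[ℂ] 𝒦} {ν : 𝒦 →L[ℂ] 𝔥}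
    (hΥ : ∀ b, 2 * (⟪b, Υ b⟫_ℂ).im = -‖ν b‖ ^ 2) :
    ∃ U, IsSingularFriedrichsGroup Υ ν U := by
  obtain ⟨U, hU, hUM⟩ := exists_unitaryGroup_of_step (Y := ((2 * Real.pi : ℝ) : ℂ) • Υ)
    (N := (Real.sqrt (2 * Real.pi) : ℂ) • ν) (fun b => by
      have h1 := hΥ b
      rw [smul_apply, smul_apply, inner_smul_right, Complex.im_ofReal_mul, norm_smul, mul_pow,
        Complex.norm_real, Real.norm_of_nonneg (Real.sqrt_nonneg _),
        Real.sq_sqrt (by positivity)]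
      linear_combination (2 * Real.pi) * h1)
  refine ⟨U, hU, fun t ht ψ ψ' hψ hψ' => ?_⟩
  obtain ⟨M, hM, hUt⟩ := hUM t ht
  rw [hUt, dilationForm_eq Υ ν t hψ hψ']
  exact inner_expZR_step Υ ν ht hM hψ hψ'

theorem IsSingularFriedrichsGroup.isDilation {Υ : 𝒦 →L[ℂ] 𝒦} {ν : 𝒦 →L[ℂ] 𝔥}
    {U : ℝ → WithLp 2 (𝒦 × Lp 𝔥 2 (volume : Measure ℝ)) →L[ℂ]
      WithLp 2 (𝒦 × Lp 𝔥 2 (volume : Measure ℝ))} (hU : IsSingularFriedrichsGroup Υ ν U) :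
    IsDilation Υ U := by
  refine ⟨hU.isUnitaryGroup, fun t ht => ?_⟩
  refine ContinuousLinearMap.ext fun b => ext_inner_left ℂ fun a => ?_
  change ⟪a, adjoint inlL (U t (inlL b))⟫_ℂ = _
  rw [adjoint_inner_right]
  have h0 : Integrable ((0 : Lp 𝔥 2 (volume : Measure ℝ)) : ℝ → 𝔥) :=
    (integrable_zero ℝ 𝔥 volume).congr (Lp.coeFn_zero 𝔥 2 volume).symm
  have h1 : ∀ u, oneBra u (0 : Lp 𝔥 2 (volume : Measure ℝ)) = 0 := fun u => by
    rw [oneBra, ← integral_zero ℝ 𝔥]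
    refine integral_congr_ae ?_
    filter_upwards [Lp.coeFn_zero 𝔥 2 (volume : Measure ℝ)] with x hx
    rw [hx, Pi.zero_apply, smul_zero]
  have hs : ∀ c : 𝒦, (inlL c : WithLp 2 (𝒦 × Lp 𝔥 2 (volume : Measure ℝ))).snd = 0 :=
    fun _ => rfl
  have hf : ∀ c : 𝒦, (inlL c : WithLp 2 (𝒦 × Lp 𝔥 2 (volume : Measure ℝ))).fst = c :=
    fun _ => rfl
  rw [hU.form t ht _ _ (by rw [hs]; exact h0) (by rw [hs]; exact h0), dilationForm]
  simp only [hs, hf, h1]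
  simp

end Form

/-! ### Integrals over triangles, averaging and a Gronwall estimate -/

section Analysis

variable {E : Type*} [NormedAddCommGroup E]

theorem intervalIntegral_triangle_swap [NormedSpace ℝ E] {F : ℝ → ℝ → E}
    (hF : Continuous (Function.uncurry F)) {a s : ℝ} (has : a ≤ s) :
    ∫ u in a..s, ∫ w in a..u, F u w = ∫ w in a..s, ∫ u in w..s, F u w := by
  have hS : MeasurableSet {p : ℝ × ℝ | p.2 ≤ p.1} := measurableSet_le measurable_snd measurable_fst
  let G : ℝ → ℝ → E := fun u w => {p : ℝ × ℝ | p.2 ≤ p.1}.indicator (Function.uncurry F) (u, w)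
  have hint : Integrable (Function.uncurry G)
      ((volume.restrict (Set.Ioc a s)).prod (volume.restrict (Set.Ioc a s))) := by
    rw [Measure.prod_restrict]
    have h1 : IntegrableOn (Function.uncurry F) (Set.Icc a s ×ˢ Set.Icc a s)
        (volume.prod volume) :=
      hF.continuousOn.integrableOn_compact (isCompact_Icc.prod isCompact_Icc)
    have h2 := h1.mono_set (Set.prod_mono (Set.Ioc_subset_Icc_self (a := a) (b := s))
      (Set.Ioc_subset_Icc_self (a := a) (b := s)))
    exact Integrable.indicator h2 hS
  have hswap := integral_integral_swap hint
  rw [intervalIntegral.integral_of_le has, intervalIntegral.integral_of_le has]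
  refine Eq.trans ?_ (hswap.trans ?_)
  · refine setIntegral_congr_fun measurableSet_Ioc fun u hu => ?_
    rw [intervalIntegral.integral_of_le hu.1.le]
    have h3 : (fun w => G u w) = (Set.Iic u).indicator (F u) := rfl
    rw [h3, setIntegral_indicator measurableSet_Iic, Set.Ioc_inter_Iic, min_eq_right hu.2]
  · refine setIntegral_congr_fun measurableSet_Ioc fun w hw => ?_
    rw [intervalIntegral.integral_of_le hw.2]
    have h3 : (fun u => G u w) = (Set.Ici w).indicator fun u => F u w := rfl
    rw [h3, setIntegral_indicator measurableSet_Ici, ← integral_Icc_eq_integral_Ioc]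
    congr 2
    ext u
    simp only [Set.mem_Icc, Set.mem_inter_iff, Set.mem_Ioc, Set.mem_Ici]
    exact ⟨fun h => ⟨h.2, h.1.2⟩, fun h => ⟨⟨hw.1.trans_le h.1, h.2⟩, h.1⟩⟩

/-- Oscillating integrals vanish in the limit of high frequency. -/
theorem tendsto_integral_oscillating [NormedSpace ℂ E] {κ : ℝ} (hκ : κ ≠ 0) (f : ℝ → E) {a s : ℝ}
    (has : a ≤ s) :
    Tendsto (fun lam : ℝ => ∫ w in a..s, Complex.exp (Complex.I * (w / lam ^ 2 : ℝ) * κ) • f w)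
      (𝓝[>] 0) (𝓝 0) := by
  have h1 := Real.tendsto_integral_exp_smul_cocompact ((Set.Ioc a s).indicator f)
  have h2 : Tendsto (fun lam : ℝ => -(κ / (2 * Real.pi)) * (lam ^ 2)⁻¹) (𝓝[>] 0)
      (cocompact ℝ) := by
    have e1 : Tendsto (fun lam : ℝ => (lam ^ 2)⁻¹) (𝓝[>] 0) atTop := by
      refine tendsto_inv_nhdsGT_zero.comp (tendsto_nhdsWithin_iff.mpr ⟨?_, ?_⟩)
      · simpa using ((continuous_pow 2).tendsto (0 : ℝ)).mono_left
          (nhdsWithin_le_nhds (s := Set.Ioi (0 : ℝ)))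
      · filter_upwards [self_mem_nhdsWithin] with lam hlam
        exact pow_pos (Set.mem_Ioi.mp hlam) 2
    have e2 : Tendsto (fun lam : ℝ => (lam ^ 2)⁻¹) (𝓝[>] 0) (cocompact ℝ) :=
      e1.mono_right atTop_le_cocompact
    exact ((Homeomorph.mulLeft₀ (-(κ / (2 * Real.pi))) (neg_ne_zero.mpr (div_ne_zero hκ
      (by positivity)))).isClosedEmbedding.tendsto_cocompact).comp e2
  refine (h1.comp h2).congr fun lam => ?_
  rw [intervalIntegral.integral_of_le has, ← integral_indicator measurableSet_Ioc]
  refine integral_congr_ae (ae_of_all _ fun w => ?_)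
  by_cases hw : w ∈ Set.Ioc a s
  · simp only [Set.indicator_of_mem hw, Circle.smul_def, Real.fourierChar_apply]
    congr 2
    have hpi : (Real.pi : ℂ) ≠ 0 := by exact_mod_cast Real.pi_ne_zero
    push_cast
    field_simp
  · simp [Set.indicator_of_notMem hw]

theorem gronwall_average {δ r : ℝ → ℝ} (hδ : Continuous δ) (hr : Continuous r)
    (hr0 : ∀ s, 0 ≤ r s) {C a T : ℝ} (hC : 0 ≤ C)
    (h : ∀ s ∈ Set.Icc a T, δ s ≤ r s + C * ∫ w in a..s, δ w) {s : ℝ} (hs : s ∈ Set.Icc a T) :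
    ∫ w in a..s, δ w ≤ Real.exp (C * (s - a)) * ∫ w in a..s, r w := by
  let z : ℝ → ℝ := fun s => Real.exp (-(C * (s - a))) * (∫ w in a..s, δ w) - ∫ w in a..s, r w
  have hy : ∀ x, HasDerivAt (fun s => ∫ w in a..s, δ w) (δ x) x := fun x =>
    intervalIntegral.integral_hasDerivAt_right (hδ.intervalIntegrable _ _)
      (hδ.stronglyMeasurableAtFilter _ _) hδ.continuousAt
  have hR : ∀ x, HasDerivAt (fun s => ∫ w in a..s, r w) (r x) x := fun x =>
    intervalIntegral.integral_hasDerivAt_right (hr.intervalIntegrable _ _)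
      (hr.stronglyMeasurableAtFilter _ _) hr.continuousAt
  have he : ∀ x, HasDerivAt (fun s => Real.exp (-(C * (s - a))))
      (Real.exp (-(C * (x - a))) * (-C)) x := fun x => by
    have := ((((hasDerivAt_id x).sub_const a).const_mul C).neg).exp
    simpa using this
  have hz : ∀ x, HasDerivAt z (Real.exp (-(C * (x - a))) * (-C) * (∫ w in a..x, δ w) +
      Real.exp (-(C * (x - a))) * δ x - r x) x := fun x => ((he x).mul (hy x)).sub (hR x)
  have hanti : AntitoneOn z (Set.Icc a T) := by
    refine antitoneOn_of_hasDerivWithinAt_nonpos (convex_Icc a T)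
      (fun x _ => (hz x).continuousAt.continuousWithinAt)
      (fun x _ => (hz x).hasDerivWithinAt) fun x hx => ?_
    have hx' : x ∈ Set.Icc a T := interior_subset hx
    have h1 := h x hx'
    have h2 : Real.exp (-(C * (x - a))) ≤ 1 := by
      rw [Real.exp_le_one_iff]
      have := mul_nonneg hC (sub_nonneg.mpr hx'.1)
      linarith
    have h3 := Real.exp_nonneg (-(C * (x - a)))
    nlinarith [hr0 x, mul_le_mul_of_nonneg_left h1 h3, mul_le_mul_of_nonneg_right h2 (hr0 x)]
  have h1 := hanti ⟨le_rfl, hs.1.trans hs.2⟩ hs hs.1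
  simp only [z, intervalIntegral.integral_same, mul_zero, sub_zero] at h1
  have h2 : Real.exp (C * (s - a)) * Real.exp (-(C * (s - a))) = 1 := by
    rw [← Real.exp_add, add_neg_cancel, Real.exp_zero]
  have h3 := mul_le_mul_of_nonneg_left (sub_nonpos.mp h1) (Real.exp_nonneg (C * (s - a)))
  rwa [← mul_assoc, h2, one_mul] at h3

/-- Solutions of Volterra equations with vanishing inhomogeneity vanish in the limit. -/
theorem tendsto_zero_of_volterra {ι : Type*} {l : Filter ι} [l.IsCountablyGenerated]
    {δ r : ι → ℝ → E} {C D a T : ℝ} (hC : 0 ≤ C)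
    (hδ : ∀ᶠ i in l, Continuous (δ i)) (hr : ∀ᶠ i in l, Continuous (r i))
    (hD : ∀ᶠ i in l, ∀ s ∈ Set.Icc a T, ‖δ i s‖ ≤ D)
    (h : ∀ᶠ i in l, ∀ s ∈ Set.Icc a T, ‖δ i s - r i s‖ ≤ C * ∫ w in a..s, ‖δ i w‖)
    (hlim : ∀ s ∈ Set.Icc a T, Tendsto (fun i => r i s) l (𝓝 0)) {s : ℝ} (hs : s ∈ Set.Icc a T) :
    Tendsto (fun i => δ i s) l (𝓝 0) := by
  have hint : Tendsto (fun i => ∫ w in a..s, ‖r i w‖) l (𝓝 0) := by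
    have h0 : ∫ w in a..s, (0 : ℝ) = 0 := by simp
    rw [← h0]
    refine intervalIntegral.tendsto_integral_filter_of_dominated_convergence
      (fun _ => D + C * (D * (T - a))) ?_ ?_ (by simp) ?_
    · filter_upwards [hr] with i hi
      exact hi.norm.aestronglyMeasurable
    · filter_upwards [hD, h, hδ] with i h1 h2 h3
      refine ae_of_all _ fun w hw => ?_
      rw [Set.uIoc_of_le hs.1] at hw
      have hw' : w ∈ Set.Icc a T := ⟨hw.1.le, hw.2.trans hs.2⟩
      have hD0 : 0 ≤ D := (norm_nonneg _).trans (h1 w hw')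
      rw [norm_norm]
      have e1 : ‖r i w‖ ≤ ‖δ i w‖ + ‖δ i w - r i w‖ := by
        have := norm_sub_le (δ i w) (δ i w - r i w)
        rwa [sub_sub_cancel] at this
      have e2 : ∫ x in a..w, ‖δ i x‖ ≤ D * (T - a) := by
        have e3 : ∫ x in a..w, ‖δ i x‖ ≤ ∫ _ in a..w, D :=
          intervalIntegral.integral_mono_on hw.1.le (h3.norm.intervalIntegrable _ _)
            (by simp) fun x hx => h1 x ⟨hx.1, hx.2.trans hw'.2⟩
        rw [intervalIntegral.integral_const, smul_eq_mul, mul_comm] at e3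
        exact e3.trans (mul_le_mul_of_nonneg_left (by linarith [hw'.2]) hD0)
      exact e1.trans (add_le_add (h1 w hw') ((h2 w hw').trans (mul_le_mul_of_nonneg_left e2 hC)))
    · refine ae_of_all _ fun w hw => ?_
      rw [Set.uIoc_of_le hs.1] at hw
      exact tendsto_zero_iff_norm_tendsto_zero.mp (hlim w ⟨hw.1.le, hw.2.trans hs.2⟩)
  have hb : Tendsto (fun i => ‖r i s‖ + C * (Real.exp (C * (s - a)) * ∫ w in a..s, ‖r i w‖)) l
      (𝓝 0) := by
    have := (tendsto_zero_iff_norm_tendsto_zero.mp (hlim s hs)).add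
      ((hint.const_mul (Real.exp (C * (s - a)))).const_mul C)
    simpa using this
  rw [tendsto_zero_iff_norm_tendsto_zero]
  refine squeeze_zero' (Eventually.of_forall fun _ => norm_nonneg _) ?_ hb
  filter_upwards [hδ, hr, h] with i h1 h2 h3
  have h4 : ∀ s ∈ Set.Icc a T, ‖δ i s‖ ≤ ‖r i s‖ + C * ∫ w in a..s, ‖δ i w‖ := fun s hs => by
    have := norm_add_le (r i s) (δ i s - r i s)
    rw [add_sub_cancel] at this
    exact this.trans (add_le_add le_rfl (h3 s hs))
  have h5 := gronwall_average h1.norm h2.norm (fun _ => norm_nonneg _) hC h4 hs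
  exact (h4 s hs).trans (add_le_add le_rfl (mul_le_mul_of_nonneg_left h5 hC))

theorem tendsto_of_tendsto_inner [InnerProductSpace ℂ E] [FiniteDimensional ℂ E] {ι : Type*}
    {l : Filter ι} {x : ι → E} {y : E}
    (h : ∀ a, Tendsto (fun i => ⟪a, x i⟫_ℂ) l (𝓝 ⟪a, y⟫_ℂ)) : Tendsto x l (𝓝 y) := by
  have b := stdOrthonormalBasis ℂ E
  have h1 : ∀ z : E, z = ∑ j, ⟪b j, z⟫_ℂ • b j := fun z => (b.sum_repr' z).symm
  rw [h1 y]
  refine Tendsto.congr (fun i => (h1 (x i)).symm) (tendsto_finsetSum _ fun j _ => ?_)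
  exact (h (b j)).smul_const _

/-- Contractions that converge weakly on a dense set to a unitary converge strongly. -/
theorem tendsto_of_tendsto_inner_of_contraction [InnerProductSpace ℂ E] [CompleteSpace E]
    {ι : Type*} {l : Filter ι} {A : ι → E →L[ℂ] E} {B : E →L[ℂ] E}
    (hA : ∀ᶠ i in l, ∀ x, ‖A i x‖ ≤ ‖x‖) (hB : B ∈ unitary (E →L[ℂ] E)) {S : Set E} (hS : Dense S)
    (h : ∀ x ∈ S, ∀ y ∈ S, Tendsto (fun i => ⟪x, A i y⟫_ℂ) l (𝓝 ⟪x, B y⟫_ℂ)) (y : E) :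
    Tendsto (fun i => A i y) l (𝓝 (B y)) := by
  have hBn := norm_map_of_mem_unitary hB
  have h1 : ∀ y ∈ S, ∀ x, Tendsto (fun i => ⟪x, A i y⟫_ℂ) l (𝓝 ⟪x, B y⟫_ℂ) := by
    intro y hy x
    rw [Metric.tendsto_nhds]
    intro ε hε
    set η := ε / (4 * (‖y‖ + 1)) with hη
    have hη0 : 0 < η := by positivity
    obtain ⟨x', hx', hxx'⟩ := Metric.mem_closure_iff.mp (hS x) η hη0
    filter_upwards [hA, (Metric.tendsto_nhds.mp (h x' hx' y hy)) (ε / 2) (by positivity)]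
      with i e1 e2
    rw [dist_eq_norm] at *
    have e3 : ⟪x, A i y⟫_ℂ - ⟪x, B y⟫_ℂ =
        (⟪x', A i y⟫_ℂ - ⟪x', B y⟫_ℂ) + ⟪x - x', A i y - B y⟫_ℂ := by
      simp only [inner_sub_left, inner_sub_right]
      ring
    have e4 : ‖⟪x - x', A i y - B y⟫_ℂ‖ ≤ η * (2 * ‖y‖) := by
      refine (norm_inner_le_norm _ _).trans ?_
      gcongr
      refine (norm_sub_le _ _).trans ?_
      rw [hBn]
      linarith [e1 y]
    have e5 : η * (2 * ‖y‖) ≤ ε / 2 := by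
      rw [hη, div_mul_eq_mul_div, div_le_div_iff₀ (by positivity) (by positivity)]
      nlinarith [norm_nonneg y]
    rw [e3]
    refine (norm_add_le _ _).trans_lt ?_
    linarith
  have h2 : ∀ y ∈ S, Tendsto (fun i => A i y) l (𝓝 (B y)) := by
    intro y hy
    rw [tendsto_iff_norm_sub_tendsto_zero]
    have e1 : Tendsto (fun i => 2 * ‖y‖ ^ 2 - 2 * (⟪B y, A i y⟫_ℂ).re) l (𝓝 0) := by
      have e2 := (Complex.continuous_re.tendsto _).comp (h1 y hy (B y))
      have e3 : (⟪B y, B y⟫_ℂ).re = ‖y‖ ^ 2 := by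
        rw [← hBn y]
        exact inner_self_eq_norm_sq (𝕜 := ℂ) _
      rw [e3] at e2
      have := (e2.const_mul 2).const_sub (2 * ‖y‖ ^ 2)
      simpa using this
    have e4 : Tendsto (fun i => √(2 * ‖y‖ ^ 2 - 2 * (⟪B y, A i y⟫_ℂ).re)) l (𝓝 0) := by
      have := (Real.continuous_sqrt.tendsto 0).comp e1
      rwa [Real.sqrt_zero] at this
    refine squeeze_zero' (Eventually.of_forall fun _ => norm_nonneg _) ?_ e4
    filter_upwards [hA] with i hi
    refine Real.le_sqrt_of_sq_le ?_
    rw [norm_sub_rev, @norm_sub_sq ℂ, hBn]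
    have := pow_le_pow_left₀ (norm_nonneg _) (hi y) 2
    change ‖y‖ ^ 2 - 2 * (⟪B y, A i y⟫_ℂ).re + ‖A i y‖ ^ 2 ≤ _
    linarith
  rw [Metric.tendsto_nhds]
  intro ε hε
  obtain ⟨y', hy', hyy'⟩ := Metric.mem_closure_iff.mp (hS y) (ε / 4) (by positivity)
  filter_upwards [hA, (Metric.tendsto_nhds.mp (h2 y' hy')) (ε / 4) (by positivity)] with i e1 e2
  have e3 : dist (A i y) (A i y') ≤ dist y y' := by
    rw [dist_eq_norm, dist_eq_norm, ← map_sub]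
    exact e1 _
  have e4 : dist (B y') (B y) = dist y' y := by
    rw [dist_eq_norm, dist_eq_norm, ← map_sub, hBn]
  rw [dist_comm y' y] at e4
  have := dist_triangle4 (A i y) (A i y') (B y') (B y)
  linarith

end Analysis

/-! ### Spectral decomposition of `K` -/

section SpectralDecomposition

variable {𝒦 : Type*} [NormedAddCommGroup 𝒦] [InnerProductSpace ℂ 𝒦] [CompleteSpace 𝒦]
  [FiniteDimensional ℂ 𝒦] {K : 𝒦 →L[ℂ] 𝒦}

theorem sum_eigenProjection (hK : IsSelfAdjoint K) :
    ∑ k : spectrum ℝ K, eigenProjection K k = 1 := by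
  have hsymm : (K : 𝒦 →ₗ[ℂ] 𝒦).IsSymmetric := isSelfAdjoint_iff_isSymmetric.mp hK
  have hfam : OrthogonalFamily ℂ
      (fun k : spectrum ℝ K => Module.End.eigenspace (K : 𝒦 →ₗ[ℂ] 𝒦) ((k : ℝ) : ℂ))
      fun k => (Module.End.eigenspace (K : 𝒦 →ₗ[ℂ] 𝒦) ((k : ℝ) : ℂ)).subtypeₗᵢ :=
    hsymm.orthogonalFamily_eigenspaces.comp (γ := spectrum ℝ K) (f := fun k => ((k : ℝ) : ℂ))
      fun k l h => Subtype.ext (Complex.ofReal_injective h)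
  have htop : ⨆ k : spectrum ℝ K, Module.End.eigenspace (K : 𝒦 →ₗ[ℂ] 𝒦) ((k : ℝ) : ℂ) = ⊤ := by
    rw [eq_top_iff, ← Submodule.orthogonal_eq_bot_iff.mp
      hsymm.orthogonalComplement_iSup_eigenspaces_eq_bot]
    refine iSup_le fun μ => ?_
    by_cases hμ : Module.End.HasEigenvalue (K : 𝒦 →ₗ[ℂ] 𝒦) μ
    · have hre : ((μ.re : ℝ) : ℂ) = μ := by
        rw [← Complex.conj_eq_iff_re]
        exact hsymm.conj_eigenvalue_eq_self hμ
      have hmem : μ.re ∈ spectrum ℝ K := by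
        rw [← spectrum.preimage_algebraMap ℂ]
        change ((μ.re : ℝ) : ℂ) ∈ spectrum ℂ K
        rw [hre, ← AlgEquiv.spectrum_eq (Module.End.toContinuousLinearMap 𝒦).symm K]
        exact hμ.mem_spectrum
      have := le_iSup (fun k : spectrum ℝ K =>
        Module.End.eigenspace (K : 𝒦 →ₗ[ℂ] 𝒦) ((k : ℝ) : ℂ)) ⟨μ.re, hmem⟩
      simpa only [hre] using this
    · have h0 : Module.End.eigenspace (K : 𝒦 →ₗ[ℂ] 𝒦) μ = ⊥ := by
        by_contra hne
        exact hμ hne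
      rw [h0]
      exact bot_le
  ext1 x
  rw [_root_.sum_apply]
  exact hfam.sum_projection_of_mem_iSup x (by rw [htop]; trivial)

theorem apply_eigenProjection (k : ℝ) (x : 𝒦) :
    K (eigenProjection K k x) = (k : ℂ) • eigenProjection K k x :=
  Module.End.mem_eigenspace_iff.mp (Submodule.starProjection_apply_mem _ x)

theorem bexpI_eigenProjection (k t : ℝ) (x : 𝒦) :
    bexpI K t (eigenProjection K k x) =
      Complex.exp (-(Complex.I * t * k)) • eigenProjection K k x := by
  set y := eigenProjection K k x with hy
  have hKy : K y = (k : ℂ) • y := apply_eigenProjection k x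
  have hd : ∀ s, HasDerivAt (fun s : ℝ => Complex.exp (Complex.I * s * k) • bexpI K s y) 0 s := by
    intro s
    have h1 : HasDerivAt (fun s : ℝ => Complex.exp (Complex.I * s * k))
        (Complex.exp (Complex.I * s * k) * (Complex.I * k)) s := by
      have h0 : HasDerivAt (fun s : ℝ => Complex.I * s * k) (Complex.I * k) s := by
        simpa using ((Complex.ofRealCLM.hasDerivAt (x := s)).const_mul Complex.I).mul_const (k : ℂ)
      exact h0.cexp
    refine (h1.smul (hasDerivAt_apply (hasDerivAt_bexpI K s)
      (hasDerivAt_const s y))).congr_deriv ?_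
    have h2 : (K * bexpI K s) y = (k : ℂ) • bexpI K s y := by
      rw [(commute_bexpI (Commute.refl K) s).eq]
      change bexpI K s (K y) = _
      rw [hKy, map_smul]
    simp only [smul_apply, h2, map_zero, add_zero]
    module
  have hconst := is_const_of_deriv_eq_zero (fun s => (hd s).differentiableAt)
    (fun s => (hd s).deriv) t 0
  simp only [bexpI_zero, Complex.ofReal_zero, mul_zero, zero_mul, Complex.exp_zero, one_smul]
    at hconst
  change _ = y at hconst
  rw [← hconst, smul_smul, ← Complex.exp_add, neg_add_cancel, Complex.exp_zero, one_smul, hconst]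

theorem bexpI_eq_sum (hK : IsSelfAdjoint K) (t : ℝ) (x : 𝒦) : bexpI K t x =
    ∑ k : spectrum ℝ K, Complex.exp (-(Complex.I * t * (k : ℝ))) • eigenProjection K k x := by
  have h1 : x = ∑ k : spectrum ℝ K, eigenProjection K k x := by
    rw [← _root_.sum_apply, sum_eigenProjection hK]
    rfl
  conv_lhs => rw [h1]
  rw [map_sum]
  exact Finset.sum_congr rfl fun k _ => bexpI_eigenProjection k t x

theorem inner_bexpI_neg (hK : IsSelfAdjoint K) (t : ℝ) (x y : 𝒦) :
    ⟪bexpI K (-t) x, y⟫_ℂ = ⟪x, bexpI K t y⟫_ℂ := by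
  have h1 := (Unitary.mem_iff.mp (bexpI_mem_unitary hK t)).1
  have h2 : star (bexpI K t) = bexpI K (-t) := by
    calc _ = star (bexpI K t) * (bexpI K t * bexpI K (-t)) := by rw [bexpI_mul_neg, mul_one]
      _ = _ := by rw [← mul_assoc, h1, one_mul]
  rw [← h2, star_eq_adjoint, adjoint_inner_left]

theorem eigenProjection_bexpI (hK : IsSelfAdjoint K) (k t : ℝ) (x : 𝒦) :
    eigenProjection K k (bexpI K t x) =
      Complex.exp (-(Complex.I * t * k)) • eigenProjection K k x := by
  refine ext_inner_left ℂ fun a => ?_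
  rw [inner_eigenProjection, ← inner_bexpI_neg hK, bexpI_eigenProjection, inner_smul_left,
    inner_smul_right, inner_eigenProjection, ← Complex.exp_conj]
  congr 2
  simp

end SpectralDecomposition

/-! ### The memory kernel -/

section Memory

variable {𝒦 ℋ : Type*}
  [NormedAddCommGroup 𝒦] [InnerProductSpace ℂ 𝒦] [CompleteSpace 𝒦] [FiniteDimensional ℂ 𝒦]
  [NormedAddCommGroup ℋ] [InnerProductSpace ℂ ℋ] [CompleteSpace ℋ]
  (K : 𝒦 →L[ℂ] 𝒦) (HR : ℋ →ₗ.[ℂ] ℋ) (V : 𝒦 →L[ℂ] ℋ)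

/-- `e^{irK} V* e^{-irH_R} V`. -/
def memoryKernel (r : ℝ) : 𝒦 →L[ℂ] 𝒦 := bexpI K (-r) ∘L adjoint V ∘L expI HR r ∘L V

/-- The rescaled coupling `λ⁻¹ e^{iλ⁻²uH_R} V e^{-iλ⁻²uK}` in the interaction picture. -/
def coupling (lam u : ℝ) : 𝒦 →L[ℂ] ℋ :=
  ((lam⁻¹ : ℝ) : ℂ) • (expI HR (-(u / lam ^ 2)) ∘L V ∘L bexpI K (u / lam ^ 2))

/-- `∫_a^s Q(u)* ∫_a^u Q(w) η(w) dw du` for the rescaled coupling `Q`. -/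
def memory (lam a : ℝ) (η : ℝ → 𝒦) (s : ℝ) : 𝒦 :=
  ∫ u in a..s, adjoint (coupling K HR V lam u) (∫ w in a..u, coupling K HR V lam w (η w))

variable {K HR V}

theorem norm_bexpI_le (hK : IsSelfAdjoint K) (t : ℝ) : ‖bexpI K t‖ ≤ 1 :=
  ContinuousLinearMap.opNorm_le_bound _ zero_le_one fun x => by
    rw [norm_map_of_mem_unitary (bexpI_mem_unitary hK t), one_mul]

theorem continuous_memoryKernel (hHR : IsSelfAdjoint HR) : Continuous (memoryKernel K HR V) :=
  ((continuous_bexpI K).comp continuous_neg).clm_comp (continuous_correlation hHR)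

theorem norm_memoryKernel_le (hK : IsSelfAdjoint K) (r : ℝ) :
    ‖memoryKernel K HR V r‖ ≤ ‖adjoint V ∘L expI HR r ∘L V‖ := by
  refine (ContinuousLinearMap.opNorm_comp_le _ _).trans ?_
  exact (mul_le_mul_of_nonneg_right (norm_bexpI_le hK _) (norm_nonneg _)).trans (one_mul _).le

theorem integrable_memoryKernel (hK : IsSelfAdjoint K) (hHR : IsSelfAdjoint HR)
    (hV : Integrable fun t : ℝ => ‖adjoint V ∘L expI HR t ∘L V‖) :
    Integrable (memoryKernel K HR V) :=
  hV.mono' (continuous_memoryKernel hHR).aestronglyMeasurable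
    (ae_of_all _ fun r => norm_memoryKernel_le hK r)

theorem norm_integral_memoryKernel_le (hK : IsSelfAdjoint K) (hHR : IsSelfAdjoint HR)
    (hV : Integrable fun t : ℝ => ‖adjoint V ∘L expI HR t ∘L V‖) {r : ℝ} (hr : 0 ≤ r) :
    ‖∫ r' in (0 : ℝ)..r, memoryKernel K HR V r'‖ ≤ ∫ t, ‖adjoint V ∘L expI HR t ∘L V‖ := by
  have h1 := integrable_memoryKernel hK hHR hV
  rw [intervalIntegral.integral_of_le hr]
  refine (norm_integral_le_integral_norm _).trans ?_
  refine (setIntegral_le_integral h1.norm (ae_of_all _ fun _ => norm_nonneg _)).trans ?_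
  exact integral_mono h1.norm hV fun r => norm_memoryKernel_le hK r

theorem adjoint_coupling_apply (hK : IsSelfAdjoint K) (hHR : IsSelfAdjoint HR) (lam u : ℝ)
    (y : ℋ) : adjoint (coupling K HR V lam u) y =
      ((lam⁻¹ : ℝ) : ℂ) • bexpI K (-(u / lam ^ 2)) (adjoint V (expI HR (u / lam ^ 2) y)) := by
  refine ext_inner_left ℂ fun x => ?_
  have h := inner_bexpI_neg hK (-(u / lam ^ 2)) x (adjoint V (expI HR (u / lam ^ 2) y))
  rw [neg_neg] at h
  rw [adjoint_inner_right, inner_smul_right, ← h, adjoint_inner_right,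
    ← (isUnitaryGroup_expI hHR).inner_neg]
  change ⟪((lam⁻¹ : ℝ) : ℂ) • expI HR (-(u / lam ^ 2)) (V (bexpI K (u / lam ^ 2) x)), y⟫_ℂ = _
  rw [inner_smul_left, Complex.conj_ofReal]

theorem adjoint_coupling_coupling (hK : IsSelfAdjoint K) (hHR : IsSelfAdjoint HR) (lam u w : ℝ)
    (x : 𝒦) : adjoint (coupling K HR V lam u) (coupling K HR V lam w x) =
      (lam ^ 2)⁻¹ • bexpI K (-(w / lam ^ 2)) (memoryKernel K HR V (u / lam ^ 2 - w / lam ^ 2)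
        (bexpI K (w / lam ^ 2) x)) := by
  have hQ : coupling K HR V lam w x = ((lam⁻¹ : ℝ) : ℂ) • expI HR (-(w / lam ^ 2))
    (V (bexpI K (w / lam ^ 2) x)) := rfl
  have hm : ∀ r y, memoryKernel K HR V r y = bexpI K (-r) (adjoint V (expI HR r (V y))) :=
    fun r y => rfl
  have h1 : ∀ y, expI HR (u / lam ^ 2) (expI HR (-(w / lam ^ 2)) y) =
      expI HR (u / lam ^ 2 - w / lam ^ 2) y := fun y => by
    rw [sub_eq_add_neg, (isUnitaryGroup_expI hHR).map_add]
    rfl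
  have h2 : ∀ y, bexpI K (-(w / lam ^ 2)) (bexpI K (-(u / lam ^ 2 - w / lam ^ 2)) y) =
      bexpI K (-(u / lam ^ 2)) y := fun y => by
    rw [show -(u / lam ^ 2) = -(w / lam ^ 2) + -(u / lam ^ 2 - w / lam ^ 2) by ring, bexpI_add]
    rfl
  rw [adjoint_coupling_apply hK hHR, hQ, hm, h2, map_smul, map_smul, map_smul, h1, smul_smul,
    ← Complex.coe_smul]
  congr 1
  push_cast
  ring

theorem continuous_coupling_apply (hHR : IsSelfAdjoint HR) (lam : ℝ) {η : ℝ → 𝒦}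
    (hη : Continuous η) : Continuous fun u => coupling K HR V lam u (η u) := by
  have h1 : Continuous fun u : ℝ => bexpI K (u / lam ^ 2) (η u) :=
    ((continuous_bexpI K).comp (by fun_prop)).clm_apply hη
  have h2 := (isUnitaryGroup_expI hHR).continuous_apply (φ := fun u : ℝ => -(u / lam ^ 2))
    (by fun_prop) (V.continuous.comp h1)
  exact h2.const_smul _

theorem continuous_adjoint_coupling_apply (hK : IsSelfAdjoint K) (hHR : IsSelfAdjoint HR)
    (lam : ℝ) {y : ℝ → ℋ} (hy : Continuous y) :
    Continuous fun u => adjoint (coupling K HR V lam u) (y u) := by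
  simp only [adjoint_coupling_apply hK hHR]
  have h2 := (isUnitaryGroup_expI hHR).continuous_apply (φ := fun u : ℝ => u / lam ^ 2)
    (by fun_prop) hy
  exact (((continuous_bexpI K).comp (by fun_prop)).clm_apply
    ((adjoint V).continuous.comp h2)).const_smul _

theorem continuous_integral_coupling (hHR : IsSelfAdjoint HR) (lam a : ℝ) {η : ℝ → 𝒦}
    (hη : Continuous η) : Continuous fun u => ∫ w in a..u, coupling K HR V lam w (η w) :=
  intervalIntegral.continuous_primitive
    (fun _ _ => (continuous_coupling_apply hHR lam hη).intervalIntegrable _ _) a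

theorem continuous_memory (hK : IsSelfAdjoint K) (hHR : IsSelfAdjoint HR) (lam a : ℝ) {η : ℝ → 𝒦}
    (hη : Continuous η) : Continuous (memory K HR V lam a η) :=
  intervalIntegral.continuous_primitive
    (fun _ _ => (continuous_adjoint_coupling_apply hK hHR lam
      (continuous_integral_coupling hHR lam a hη)).intervalIntegrable _ _) a

theorem memory_sub (hK : IsSelfAdjoint K) (hHR : IsSelfAdjoint HR) (lam a : ℝ) {η ζ : ℝ → 𝒦}
    (hη : Continuous η) (hζ : Continuous ζ) (s : ℝ) :
    memory K HR V lam a (fun w => η w - ζ w) s =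
      memory K HR V lam a η s - memory K HR V lam a ζ s := by
  rw [memory, memory, memory, ← intervalIntegral.integral_sub]
  · refine intervalIntegral.integral_congr fun u _ => ?_
    simp only [map_sub]
    rw [intervalIntegral.integral_sub, map_sub]
    · exact (continuous_coupling_apply hHR lam hη).intervalIntegrable _ _
    · exact (continuous_coupling_apply hHR lam hζ).intervalIntegrable _ _
  · exact (continuous_adjoint_coupling_apply hK hHR lam
      (continuous_integral_coupling hHR lam a hη)).intervalIntegrable _ _
  · exact (continuous_adjoint_coupling_apply hK hHR lam
      (continuous_integral_coupling hHR lam a hζ)).intervalIntegrable _ _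

theorem memory_eq (hK : IsSelfAdjoint K) (hHR : IsSelfAdjoint HR) {lam : ℝ} (hlam : lam ≠ 0)
    {η : ℝ → 𝒦} (hη : Continuous η) {a s : ℝ} (has : a ≤ s) :
    memory K HR V lam a η s = ∫ w in a..s, bexpI K (-(w / lam ^ 2))
      ((∫ r in (0 : ℝ)..(s / lam ^ 2 - w / lam ^ 2), memoryKernel K HR V r)
        (bexpI K (w / lam ^ 2) (η w))) := by
  have h2 : lam ^ 2 ≠ 0 := pow_ne_zero 2 hlam
  let F : ℝ → ℝ → 𝒦 := fun u w => (lam ^ 2)⁻¹ • bexpI K (-(w / lam ^ 2))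
    (memoryKernel K HR V (u / lam ^ 2 - w / lam ^ 2) (bexpI K (w / lam ^ 2) (η w)))
  have hF : Continuous (Function.uncurry F) := by
    have hb := continuous_bexpI K
    have hm := continuous_memoryKernel (K := K) (V := V) hHR
    have e1 : Continuous fun p : ℝ × ℝ => bexpI K (-(p.2 / lam ^ 2)) := hb.comp (by fun_prop)
    have e2 : Continuous fun p : ℝ × ℝ => memoryKernel K HR V (p.1 / lam ^ 2 - p.2 / lam ^ 2) :=
      hm.comp (by fun_prop)
    have e3 : Continuous fun p : ℝ × ℝ => bexpI K (p.2 / lam ^ 2) := hb.comp (by fun_prop)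
    exact (e1.clm_apply (e2.clm_apply (e3.clm_apply (hη.comp continuous_snd)))).const_smul _
  have e1 : memory K HR V lam a η s = ∫ u in a..s, ∫ w in a..u, F u w := by
    rw [memory]
    refine intervalIntegral.integral_congr fun u _ => ?_
    rw [← ContinuousLinearMap.intervalIntegral_comp_comm _
      ((continuous_coupling_apply hHR lam hη).intervalIntegrable _ _)]
    refine intervalIntegral.integral_congr fun w _ => ?_
    exact adjoint_coupling_coupling hK hHR lam u w (η w)
  rw [e1, intervalIntegral_triangle_swap hF has]
  refine intervalIntegral.integral_congr fun w _ => ?_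
  simp only [F]
  rw [intervalIntegral.integral_smul]
  have hc : Continuous fun r => memoryKernel K HR V r (bexpI K (w / lam ^ 2) (η w)) :=
    (continuous_memoryKernel hHR).clm_apply continuous_const
  have e2 := intervalIntegral.integral_comp_div_sub (a := w) (b := s)
    (fun r => bexpI K (-(w / lam ^ 2)) (memoryKernel K HR V r (bexpI K (w / lam ^ 2) (η w))))
    h2 (w / lam ^ 2)
  rw [sub_self] at e2
  rw [e2, smul_smul, inv_mul_cancel₀ h2, one_smul,
    ContinuousLinearMap.intervalIntegral_comp_comm _ (hc.intervalIntegrable _ _)]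
  congr 1
  exact ContinuousLinearMap.intervalIntegral_apply
    ((continuous_memoryKernel hHR).intervalIntegrable _ _) _ |>.symm

theorem norm_bexpI_apply (hK : IsSelfAdjoint K) (t : ℝ) (x : 𝒦) : ‖bexpI K t x‖ = ‖x‖ :=
  norm_map_of_mem_unitary (bexpI_mem_unitary hK t) x

theorem norm_memory_le (hK : IsSelfAdjoint K) (hHR : IsSelfAdjoint HR)
    (hV : Integrable fun t : ℝ => ‖adjoint V ∘L expI HR t ∘L V‖) {lam : ℝ} (hlam : 0 < lam)
    {η : ℝ → 𝒦} (hη : Continuous η) {a s : ℝ} (has : a ≤ s) :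
    ‖memory K HR V lam a η s‖ ≤ (∫ t, ‖adjoint V ∘L expI HR t ∘L V‖) * ∫ w in a..s, ‖η w‖ := by
  rw [memory_eq hK hHR hlam.ne' hη has, ← intervalIntegral.integral_const_mul]
  refine intervalIntegral.norm_integral_le_of_norm_le has (ae_of_all _ fun w hw => ?_)
    ((hη.norm.const_mul _).intervalIntegrable _ _)
  rw [norm_bexpI_apply hK]
  refine (ContinuousLinearMap.le_opNorm _ _).trans ?_
  rw [norm_bexpI_apply hK]
  refine mul_le_mul_of_nonneg_right (norm_integral_memoryKernel_le hK hHR hV ?_) (norm_nonneg _)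
  rw [← sub_div]
  exact div_nonneg (by linarith [hw.2]) (by positivity)

theorem sum_eigenProjection_integral_memoryKernel (hK : IsSelfAdjoint K) (hHR : IsSelfAdjoint HR)
    (hV : Integrable fun t : ℝ => ‖adjoint V ∘L expI HR t ∘L V‖) (x : 𝒦) :
    ∑ k : spectrum ℝ K, eigenProjection K k
      ((∫ r in Set.Ioi (0 : ℝ), memoryKernel K HR V r) (eigenProjection K k x)) =
      Complex.I • levelShift K HR V x := by
  rw [levelShift, smul_apply, smul_smul, mul_neg, Complex.I_mul_I, neg_neg, one_smul,
    _root_.sum_apply]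
  refine Finset.sum_congr rfl fun k _ => ?_
  have h1 := (integrable_memoryKernel hK hHR hV).integrableOn (s := Set.Ioi 0)
  rw [ContinuousLinearMap.integral_apply h1,
    ContinuousLinearMap.integral_apply (integrable_levelShift hHR hV k).integrableOn,
    ← ContinuousLinearMap.integral_comp_comm _ (h1.apply_continuousLinearMap _)]
  refine integral_congr_ae (ae_of_all _ fun r => ?_)
  change eigenProjection K k (bexpI K (-r) _) = _
  rw [eigenProjection_bexpI hK]
  change _ = Complex.exp (Complex.I * r * (k : ℝ)) •
    eigenProjection K k (adjoint V (expI HR r (V (eigenProjection K k x))))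
  congr 2
  push_cast
  ring

/-- In the weak coupling limit the memory term becomes local in time. -/
theorem tendsto_memory (hK : IsSelfAdjoint K) (hHR : IsSelfAdjoint HR)
    (hV : Integrable fun t : ℝ => ‖adjoint V ∘L expI HR t ∘L V‖) {η : ℝ → 𝒦} (hη : Continuous η)
    {a s : ℝ} (has : a ≤ s) :
    Tendsto (fun lam => memory K HR V lam a η s) (𝓝[>] 0)
      (𝓝 (∫ w in a..s, Complex.I • levelShift K HR V (η w))) := by
  set M := ∫ r in Set.Ioi (0 : ℝ), memoryKernel K HR V r with hM
  set C := ∫ t, ‖adjoint V ∘L expI HR t ∘L V‖ with hC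
  have hρ := integrable_memoryKernel hK hHR hV
  have hD : Tendsto (fun r => ∫ r' in (0 : ℝ)..r, memoryKernel K HR V r') atTop (𝓝 M) :=
    intervalIntegral_tendsto_integral_Ioi 0 hρ.integrableOn tendsto_id
  have hMC : ‖M‖ ≤ C := by
    refine le_of_tendsto hD.norm ?_
    filter_upwards [eventually_ge_atTop 0] with r hr
    exact norm_integral_memoryKernel_le hK hHR hV hr
  have hpc : Continuous fun r => ∫ r' in (0 : ℝ)..r, memoryKernel K HR V r' :=
    intervalIntegral.continuous_primitive (fun _ _ => hρ.intervalIntegrable) 0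
  have hb := continuous_bexpI K
  have c1 : ∀ lam : ℝ, Continuous fun w : ℝ => bexpI K (-(w / lam ^ 2)) := fun lam =>
    hb.comp (by fun_prop)
  have c2 : ∀ lam : ℝ, Continuous fun w : ℝ => bexpI K (w / lam ^ 2) := fun lam =>
    hb.comp (by fun_prop)
  have c3 : ∀ lam : ℝ, Continuous fun w : ℝ => bexpI K (-(w / lam ^ 2))
      (((∫ r in (0 : ℝ)..(s / lam ^ 2 - w / lam ^ 2), memoryKernel K HR V r) - M)
        (bexpI K (w / lam ^ 2) (η w))) := fun lam =>
    (c1 lam).clm_apply (((hpc.comp (by fun_prop)).sub continuous_const).clm_apply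
      ((c2 lam).clm_apply hη))
  have c4 : ∀ lam : ℝ, Continuous fun w : ℝ => bexpI K (-(w / lam ^ 2))
      (M (bexpI K (w / lam ^ 2) (η w))) := fun lam =>
    (c1 lam).clm_apply (M.continuous.comp ((c2 lam).clm_apply hη))
  have hA : Tendsto (fun lam : ℝ => ∫ w in a..s, bexpI K (-(w / lam ^ 2))
      (((∫ r in (0 : ℝ)..(s / lam ^ 2 - w / lam ^ 2), memoryKernel K HR V r) - M)
        (bexpI K (w / lam ^ 2) (η w)))) (𝓝[>] 0) (𝓝 0) := by
    have h0 : ∫ w in a..s, (0 : 𝒦) = 0 := by simp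
    rw [← h0]
    refine intervalIntegral.tendsto_integral_filter_of_dominated_convergence
      (fun w => (C + C) * ‖η w‖) ?_ ?_ ((hη.norm.const_mul _).intervalIntegrable _ _) ?_
    · exact Eventually.of_forall fun lam => (c3 lam).aestronglyMeasurable
    · filter_upwards [self_mem_nhdsWithin] with lam hlam
      refine ae_of_all _ fun w hw => ?_
      rw [Set.uIoc_of_le has] at hw
      rw [norm_bexpI_apply hK]
      refine (ContinuousLinearMap.le_opNorm _ _).trans ?_
      rw [norm_bexpI_apply hK]
      refine mul_le_mul_of_nonneg_right ((norm_sub_le _ _).trans (add_le_add ?_ hMC))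
        (norm_nonneg _)
      refine norm_integral_memoryKernel_le hK hHR hV ?_
      rw [← sub_div]
      exact div_nonneg (by linarith [hw.2]) (by positivity)
    · have hne : ∀ᵐ w : ℝ, w ≠ s := by simp [ae_iff, measure_singleton]
      filter_upwards [hne] with w hws hw
      rw [Set.uIoc_of_le has] at hw
      have hlt : 0 < s - w := sub_pos.mpr (lt_of_le_of_ne hw.2 hws)
      have e1 : Tendsto (fun lam : ℝ => s / lam ^ 2 - w / lam ^ 2) (𝓝[>] 0) atTop := by
        have e0 : Tendsto (fun lam : ℝ => (lam ^ 2)⁻¹) (𝓝[>] 0) atTop := by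
          refine tendsto_inv_nhdsGT_zero.comp (tendsto_nhdsWithin_iff.mpr ⟨?_, ?_⟩)
          · simpa using ((continuous_pow 2).tendsto (0 : ℝ)).mono_left
              (nhdsWithin_le_nhds (s := Set.Ioi (0 : ℝ)))
          · filter_upwards [self_mem_nhdsWithin] with lam hlam
            exact pow_pos (Set.mem_Ioi.mp hlam) 2
        refine (e0.const_mul_atTop hlt).congr fun lam => ?_
        rw [← sub_div, div_eq_mul_inv]
      have e2 := tendsto_iff_norm_sub_tendsto_zero.mp (hD.comp e1)
      rw [tendsto_zero_iff_norm_tendsto_zero]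
      have e3 := e2.mul_const ‖η w‖
      rw [zero_mul] at e3
      refine squeeze_zero (fun _ => norm_nonneg _) (fun lam => ?_) e3
      rw [norm_bexpI_apply hK]
      refine (ContinuousLinearMap.le_opNorm _ _).trans ?_
      rw [norm_bexpI_apply hK]
      rfl
  have hB : Tendsto (fun lam : ℝ => ∫ w in a..s, bexpI K (-(w / lam ^ 2))
      (M (bexpI K (w / lam ^ 2) (η w)))) (𝓝[>] 0)
      (𝓝 (∫ w in a..s, Complex.I • levelShift K HR V (η w))) := by
    have cT : ∀ k l : ℝ, Continuous fun w =>
        eigenProjection K k (M (eigenProjection K l (η w))) := fun k l =>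
      (eigenProjection K k).continuous.comp (M.continuous.comp
        ((eigenProjection K l).continuous.comp hη))
    have e1 : ∀ lam w : ℝ, bexpI K (-(w / lam ^ 2)) (M (bexpI K (w / lam ^ 2) (η w))) =
        ∑ k : spectrum ℝ K, ∑ l : spectrum ℝ K,
          Complex.exp (Complex.I * (w / lam ^ 2 : ℝ) * ((k : ℝ) - (l : ℝ) : ℝ)) •
            eigenProjection K k (M (eigenProjection K l (η w))) := by
      intro lam w
      rw [bexpI_eq_sum hK (-(w / lam ^ 2))]
      refine Finset.sum_congr rfl fun k _ => ?_
      rw [bexpI_eq_sum hK (w / lam ^ 2), map_sum, map_sum, Finset.smul_sum]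
      refine Finset.sum_congr rfl fun l _ => ?_
      rw [map_smul, map_smul, smul_smul, ← Complex.exp_add]
      congr 2
      push_cast
      ring
    have cE : ∀ (lam : ℝ) (k l : spectrum ℝ K), Continuous fun w : ℝ =>
        Complex.exp (Complex.I * (w / lam ^ 2 : ℝ) * ((k : ℝ) - (l : ℝ) : ℝ)) •
            eigenProjection K k (M (eigenProjection K l (η w))) := fun lam k l =>
      Continuous.smul (by fun_prop) (cT k l)
    have e2 : ∀ lam : ℝ, ∫ w in a..s, bexpI K (-(w / lam ^ 2)) (M (bexpI K (w / lam ^ 2) (η w))) =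
        ∑ k : spectrum ℝ K, ∑ l : spectrum ℝ K, ∫ w in a..s,
          Complex.exp (Complex.I * (w / lam ^ 2 : ℝ) * ((k : ℝ) - (l : ℝ) : ℝ)) •
            eigenProjection K k (M (eigenProjection K l (η w))) := by
      intro lam
      simp only [e1]
      rw [intervalIntegral.integral_finsetSum fun k _ =>
        (continuous_finsetSum _ fun l _ => cE lam k l).intervalIntegrable _ _]
      refine Finset.sum_congr rfl fun k _ => ?_
      rw [intervalIntegral.integral_finsetSum fun l _ => (cE lam k l).intervalIntegrable _ _]
    have e3 : ∫ w in a..s, Complex.I • levelShift K HR V (η w) =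
        ∑ k : spectrum ℝ K, ∑ l : spectrum ℝ K,
          if k = l then ∫ w in a..s, eigenProjection K k (M (eigenProjection K k (η w)))
          else 0 := by
      simp only [Finset.sum_ite_eq, Finset.mem_univ, if_true]
      rw [← intervalIntegral.integral_finsetSum fun (k : spectrum ℝ K) _ => (cT k k).intervalIntegrable _ _]
      refine intervalIntegral.integral_congr fun w _ => ?_
      exact (sum_eigenProjection_integral_memoryKernel hK hHR hV (η w)).symm
    rw [e3]
    simp only [e2]
    refine tendsto_finsetSum _ fun k _ => tendsto_finsetSum _ fun l _ => ?_
    split_ifs with hkl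
    · subst hkl
      simp
    · exact tendsto_integral_oscillating (sub_ne_zero.mpr fun h => hkl (Subtype.ext h)) _ has
  have hAB := hA.add hB
  rw [zero_add] at hAB
  refine hAB.congr' ?_
  filter_upwards [self_mem_nhdsWithin] with lam hlam
  rw [memory_eq hK hHR (Set.mem_Ioi.mp hlam).ne' hη has, ← intervalIntegral.integral_add
    ((c3 lam).intervalIntegrable _ _) ((c4 lam).intervalIntegrable _ _)]
  refine intervalIntegral.integral_congr fun w _ => ?_
  simp only [sub_apply, map_sub, sub_add_cancel]

end Memory

/-! ### The interaction picture -/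

section Interaction

variable {𝒦 ℋ : Type*}
  [NormedAddCommGroup 𝒦] [InnerProductSpace ℂ 𝒦] [CompleteSpace 𝒦] [FiniteDimensional ℂ 𝒦]
  [NormedAddCommGroup ℋ] [InnerProductSpace ℂ ℋ] [CompleteSpace ℋ]

/-- The evolution from time `a` to time `s` in the interaction picture. -/
def interaction (K : 𝒦 →L[ℂ] 𝒦) (HR : ℋ →ₗ.[ℂ] ℋ) (V : 𝒦 →L[ℂ] ℋ) (lam a s : ℝ) :
    WithLp 2 (𝒦 × ℋ) →L[ℂ] WithLp 2 (𝒦 × ℋ) :=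
  expI (friedrichs K HR V 0) (-(s / lam ^ 2)) ∘L
    expI (friedrichs K HR V lam) ((s - a) / lam ^ 2) ∘L
    expI (friedrichs K HR V 0) (a / lam ^ 2)

variable {K : 𝒦 →L[ℂ] 𝒦} {HR : ℋ →ₗ.[ℂ] ℋ} {V : 𝒦 →L[ℂ] ℋ}

theorem norm_interaction (hK : IsSelfAdjoint K) (hHR : IsSelfAdjoint HR) (lam a s : ℝ)
    (x : WithLp 2 (𝒦 × ℋ)) : ‖interaction K HR V lam a s x‖ = ‖x‖ := by
  have h0 := isUnitaryGroup_expI (isSelfAdjoint_friedrichs hK hHR V 0)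
  have h1 := isUnitaryGroup_expI (isSelfAdjoint_friedrichs hK hHR V lam)
  change ‖expI _ _ (expI _ _ (expI _ _ x))‖ = _
  rw [h0.norm_map, h1.norm_map, h0.norm_map]

theorem interaction_self (hK : IsSelfAdjoint K) (hHR : IsSelfAdjoint HR) (lam a : ℝ)
    (x : WithLp 2 (𝒦 × ℋ)) : interaction K HR V lam a a x = x := by
  have h0 := isUnitaryGroup_expI (isSelfAdjoint_friedrichs hK hHR V 0)
  have h1 := isUnitaryGroup_expI (isSelfAdjoint_friedrichs hK hHR V lam)
  change expI _ _ (expI _ _ (expI _ _ x)) = _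
  rw [sub_self, zero_div, h1.map_zero]
  exact h0.neg_apply_self _ _

theorem adjoint_interaction (hK : IsSelfAdjoint K) (hHR : IsSelfAdjoint HR) (lam a s : ℝ) :
    adjoint (interaction K HR V lam a s) = interaction K HR V lam s a := by
  have h0 := isUnitaryGroup_expI (isSelfAdjoint_friedrichs hK hHR V 0)
  have h1 := isUnitaryGroup_expI (isSelfAdjoint_friedrichs hK hHR V lam)
  rw [interaction, adjoint_comp, adjoint_comp, h0.adjoint_eq, h0.adjoint_eq, h1.adjoint_eq,
    neg_neg, show -((s - a) / lam ^ 2) = (a - s) / lam ^ 2 by ring, comp_assoc]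
  rfl

theorem hasDerivAt_interaction (hK : IsSelfAdjoint K) (hHR : IsSelfAdjoint HR) (lam a : ℝ)
    (x : WithLp 2 (𝒦 × ℋ)) (s : ℝ) :
    HasDerivAt (fun s => interaction K HR V lam a s x) (WithLp.toLp 2
      (-Complex.I • adjoint (coupling K HR V lam s) (interaction K HR V lam a s x).snd,
        -Complex.I • coupling K HR V lam s (interaction K HR V lam a s x).fst)) s := by
  have hA := isSelfAdjoint_friedrichs hK hHR V 0
  have hB := isSelfAdjoint_friedrichs hK hHR V lam
  have h0 := isUnitaryGroup_expI hA
  let C : WithLp 2 (𝒦 × ℋ) →L[ℂ] WithLp 2 (𝒦 × ℋ) :=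
    ((WithLp.prodContinuousLinearEquiv 2 ℂ 𝒦 ℋ).symm : 𝒦 × ℋ →L[ℂ] WithLp 2 (𝒦 × ℋ)) ∘L
      (((lam : ℂ) • (adjoint V ∘L ContinuousLinearMap.snd ℂ 𝒦 ℋ)).prod
        ((lam : ℂ) • (V ∘L ContinuousLinearMap.fst ℂ 𝒦 ℋ))) ∘L
      (WithLp.prodContinuousLinearEquiv 2 ℂ 𝒦 ℋ : WithLp 2 (𝒦 × ℋ) →L[ℂ] 𝒦 × ℋ)
  have hCx : ∀ x, C x = WithLp.toLp 2 ((lam : ℂ) • adjoint V x.snd, (lam : ℂ) • V x.fst) :=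
    fun x => rfl
  have hC : ∀ x y, (x, y) ∈ (friedrichs K HR V lam).graph →
      (x, y - C x) ∈ (friedrichs K HR V 0).graph := by
    intro x y hxy
    rw [mem_friedrichs_graph_iff] at hxy ⊢
    obtain ⟨w, hw, rfl⟩ := hxy
    refine ⟨w, hw, ?_⟩
    rw [hCx, ← WithLp.toLp_sub]
    congr 1
    ext1
    · simp
    · simp
  set y := expI (friedrichs K HR V 0) (a / lam ^ 2) x with hy
  set z := expI (friedrichs K HR V lam) ((s - a) / lam ^ 2) y with hz
  have h1 := hasDerivAt_expI_neg_expI hA hB C hC y ((s - a) / lam ^ 2)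
  have h2 : HasDerivAt (fun s : ℝ => (s - a) / lam ^ 2) (lam ^ 2)⁻¹ s := by
    simpa using ((hasDerivAt_id s).sub_const a).div_const (lam ^ 2)
  have h3 := HasDerivAt.scomp s h1 h2
  have h4 := hasDerivAt_apply (hasDerivAt_const s (expI (friedrichs K HR V 0) (-(a / lam ^ 2)))) h3
  have e1 : ∀ (s : ℝ) (w : WithLp 2 (𝒦 × ℋ)), expI (friedrichs K HR V 0) (-(a / lam ^ 2))
      (expI (friedrichs K HR V 0) (-((s - a) / lam ^ 2)) w) =
      expI (friedrichs K HR V 0) (-(s / lam ^ 2)) w := fun s w => by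
    rw [show -(s / lam ^ 2) = -(a / lam ^ 2) + -((s - a) / lam ^ 2) by ring, h0.map_add]
    rfl
  have hfun : (fun s => interaction K HR V lam a s x) =
      (expI (friedrichs K HR V 0) (-(a / lam ^ 2))) ∘
        ((fun s => expI (friedrichs K HR V 0) (-s) (expI (friedrichs K HR V lam) s y)) ∘
          fun s => (s - a) / lam ^ 2) := by
    funext s
    exact (e1 s _).symm
  rw [hfun]
  refine h4.congr_deriv ?_
  have hΦ : interaction K HR V lam a s x = expI (friedrichs K HR V 0) (-(s / lam ^ 2)) z := rfl
  have hzΦ : z = expI (friedrichs K HR V 0) (s / lam ^ 2) (interaction K HR V lam a s x) := by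
    rw [hΦ]
    exact (h0.apply_neg_self _ _).symm
  rw [zero_apply, zero_add, ContinuousLinearMap.map_smul_of_tower, map_smul, e1, ← hz]
  set Φ := interaction K HR V lam a s x
  rw [hzΦ, hCx, expI_friedrichs_zero hK hHR, expI_friedrichs_zero hK hHR]
  refine (WithLp.prodContinuousLinearEquiv 2 ℂ 𝒦 ℋ).injective (Prod.ext ?_ ?_)
  · change (lam ^ 2)⁻¹ • -Complex.I • bexpI K (-(s / lam ^ 2))
      ((lam : ℂ) • adjoint V (expI HR (s / lam ^ 2) Φ.snd)) = -Complex.I • _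
    rw [adjoint_coupling_apply hK hHR, map_smul, ← Complex.coe_smul, smul_comm,
      smul_smul (((lam ^ 2)⁻¹ : ℝ) : ℂ)]
    congr 2
    push_cast
    field_simp
  · change (lam ^ 2)⁻¹ • -Complex.I • expI HR (-(s / lam ^ 2))
      ((lam : ℂ) • V (bexpI K (s / lam ^ 2) Φ.fst)) = -Complex.I •
        ((lam⁻¹ : ℝ) : ℂ) • expI HR (-(s / lam ^ 2)) (V (bexpI K (s / lam ^ 2) Φ.fst))
    rw [map_smul, ← Complex.coe_smul, smul_comm, smul_smul (((lam ^ 2)⁻¹ : ℝ) : ℂ)]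
    congr 2
    push_cast
    field_simp

theorem continuous_interaction (hK : IsSelfAdjoint K) (hHR : IsSelfAdjoint HR) (lam a : ℝ)
    (x : WithLp 2 (𝒦 × ℋ)) :
    Continuous fun s => interaction K HR V lam a s x :=
  continuous_iff_continuousAt.mpr fun s => (hasDerivAt_interaction hK hHR lam a x s).continuousAt

theorem interaction_snd (hK : IsSelfAdjoint K) (hHR : IsSelfAdjoint HR) (lam a : ℝ)
    (x : WithLp 2 (𝒦 × ℋ)) (s : ℝ) :
    (interaction K HR V lam a s x).snd = x.snd - Complex.I •
      ∫ w in a..s, coupling K HR V lam w (interaction K HR V lam a w x).fst := by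
  have hc : Continuous fun w => (interaction K HR V lam a w x).fst :=
    (WithLp.fstL 2 ℂ 𝒦 ℋ).continuous.comp (continuous_interaction hK hHR lam a x)
  have h1 := intervalIntegral.integral_eq_sub_of_hasDerivAt (a := a) (b := s)
    (fun w _ => hasDerivAt_snd (hasDerivAt_interaction hK hHR lam a x w))
    (((continuous_coupling_apply hHR lam hc).const_smul _).intervalIntegrable _ _)
  change (∫ w in a..s, -Complex.I • coupling K HR V lam w
    (interaction K HR V lam a w x).fst) = _ at h1
  rw [interaction_self hK hHR, intervalIntegral.integral_smul] at h1
  rw [eq_add_of_sub_eq h1.symm]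
  module

/-- The Volterra equation for the component in `𝒦`. -/
theorem interaction_fst (hK : IsSelfAdjoint K) (hHR : IsSelfAdjoint HR) (lam a : ℝ)
    (x : WithLp 2 (𝒦 × ℋ)) (s : ℝ) :
    (interaction K HR V lam a s x).fst = x.fst - Complex.I •
      (∫ u in a..s, adjoint (coupling K HR V lam u) x.snd) -
      memory K HR V lam a (fun w => (interaction K HR V lam a w x).fst) s := by
  have hc1 : Continuous fun w => (interaction K HR V lam a w x).fst :=
    (WithLp.fstL 2 ℂ 𝒦 ℋ).continuous.comp (continuous_interaction hK hHR lam a x)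
  have hc2 : Continuous fun w => (interaction K HR V lam a w x).snd :=
    (WithLp.sndL 2 ℂ 𝒦 ℋ).continuous.comp (continuous_interaction hK hHR lam a x)
  have h1 := intervalIntegral.integral_eq_sub_of_hasDerivAt (a := a) (b := s)
    (fun w _ => hasDerivAt_fst (hasDerivAt_interaction hK hHR lam a x w))
    (((continuous_adjoint_coupling_apply hK hHR lam hc2).const_smul _).intervalIntegrable _ _)
  change (∫ w in a..s, -Complex.I • adjoint (coupling K HR V lam w)
    (interaction K HR V lam a w x).snd) = _ at h1
  rw [interaction_self hK hHR, intervalIntegral.integral_smul] at h1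
  rw [eq_add_of_sub_eq h1.symm]
  have h2 : ∫ u in a..s, adjoint (coupling K HR V lam u) (interaction K HR V lam a u x).snd =
      (∫ u in a..s, adjoint (coupling K HR V lam u) x.snd) - Complex.I •
        memory K HR V lam a (fun w => (interaction K HR V lam a w x).fst) s := by
    rw [memory, ← intervalIntegral.integral_smul, ← intervalIntegral.integral_sub]
    · refine intervalIntegral.integral_congr fun u _ => ?_
      rw [interaction_snd hK hHR lam, map_sub, map_smul]
    · exact (continuous_adjoint_coupling_apply hK hHR lam continuous_const).intervalIntegrable _ _
    · exact ((continuous_adjoint_coupling_apply hK hHR lam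
        (continuous_integral_coupling hHR lam a hc1)).const_smul _).intervalIntegrable _ _
  rw [h2, smul_sub, smul_smul, neg_mul, Complex.I_mul_I, neg_neg, one_smul]
  module

end Interaction

/-! ### Rescaled functions -/

section Rescale

variable {E : Type*} [NormedAddCommGroup E] [InnerProductSpace ℂ E]

theorem coeFn_rescale {lam : ℝ} (hlam : 0 < lam) (k : ℝ) (I : Set ℝ)
    (g : Lp E 2 (volume : Measure ℝ)) :
    rescale lam k I g =ᵐ[volume.restrict I]
      fun y => ((lam⁻¹ : ℝ) : ℂ) • g ((y - k) / lam ^ 2) := by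
  have h1 : rescale lam k I g =
      ((lam⁻¹ : ℝ) : ℂ) • (eLpNorm_rescale hlam k I g).1.toLp _ := by
    rw [rescale, dif_pos hlam]
    rfl
  rw [h1]
  filter_upwards [Lp.coeFn_smul ((lam⁻¹ : ℝ) : ℂ) ((eLpNorm_rescale hlam k I g).1.toLp _),
    (eLpNorm_rescale hlam k I g).1.coeFn_toLp] with y e1 e2
  rw [e1, Pi.smul_apply, e2]

theorem norm_rescale_le {lam : ℝ} (hlam : 0 < lam) (k : ℝ) (I : Set ℝ)
    (g : Lp E 2 (volume : Measure ℝ)) : ‖rescale lam k I g‖ ≤ ‖g‖ := by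
  rw [rescale, dif_pos hlam, smul_apply, norm_smul, Complex.norm_real,
    Real.norm_of_nonneg (inv_nonneg.mpr hlam.le), inv_mul_le_iff₀ hlam]
  exact (ContinuousLinearMap.le_opNorm _ _).trans (mul_le_mul_of_nonneg_right
    (LinearMap.mkContinuous_norm_le _ hlam.le _) (norm_nonneg _))

theorem setIntegral_eq_integral_rescale {G : Type*} [NormedAddCommGroup G] [NormedSpace ℝ G]
    {lam : ℝ} (hlam : 0 < lam) (k : ℝ) {I : Set ℝ} (hI : MeasurableSet I) (F : ℝ → G) :
    ∫ y in I, F y = lam ^ 2 • ∫ x, I.indicator F (k + lam ^ 2 * x) := by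
  have h1 := Measure.integral_comp_mul_left (fun y => I.indicator F (k + y)) (lam ^ 2)
  rw [h1, integral_add_left_eq_self, smul_smul, abs_of_pos (by positivity),
    mul_inv_cancel₀ (by positivity), one_smul, integral_indicator hI]

theorem rescale_add_mul {lam : ℝ} (hlam : 0 < lam) (k x : ℝ) :
    (k + lam ^ 2 * x - k) / lam ^ 2 = x := by
  field_simp
  ring

theorem inner_rescale {lam : ℝ} (hlam : 0 < lam) {k R : ℝ} {I : Set ℝ} (hI : MeasurableSet I)
    (hR : ∀ x, |x| ≤ R → k + lam ^ 2 * x ∈ I) (f : Lp E 2 (volume : Measure ℝ))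
    {g : Lp E 2 (volume : Measure ℝ)} (hg : ∀ᵐ x, R < |x| → g x = 0) :
    ⟪rescale lam k I f, rescale lam k I g⟫_ℂ = ⟪f, g⟫_ℂ := by
  rw [L2.inner_def, L2.inner_def]
  have h1 : ∫ y in I, ⟪rescale lam k I f y, rescale lam k I g y⟫_ℂ =
      ∫ y in I, ((lam ^ 2)⁻¹ : ℝ) • ⟪f ((y - k) / lam ^ 2), g ((y - k) / lam ^ 2)⟫_ℂ := by
    refine integral_congr_ae ?_
    filter_upwards [coeFn_rescale hlam k I f, coeFn_rescale hlam k I g] with y e1 e2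
    rw [e1, e2, inner_smul_left, inner_smul_right, Complex.conj_ofReal, ← Complex.coe_smul,
      smul_eq_mul]
    push_cast
    ring
  rw [h1, setIntegral_eq_integral_rescale hlam k hI, ← integral_smul]
  refine integral_congr_ae ?_
  filter_upwards [hg] with x hx
  by_cases h : k + lam ^ 2 * x ∈ I
  · simp only [Set.indicator_of_mem h, rescale_add_mul hlam]
    rw [smul_smul, mul_inv_cancel₀ (by positivity), one_smul]
  · have hx' : g x = 0 := hx (not_le.mp fun h' => h (hR x h'))
    simp only [Set.indicator_of_notMem h, smul_zero, hx', inner_zero_right]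

theorem eventually_add_mul_mem {k R : ℝ} {s : Set ℝ} (hs : s ∈ 𝓝 k) :
    ∀ᶠ lam : ℝ in 𝓝[>] 0, ∀ x, |x| ≤ R → k + lam ^ 2 * x ∈ s := by
  obtain ⟨ε, hε, hball⟩ := Metric.mem_nhds_iff.mp hs
  have h1 : Tendsto (fun lam : ℝ => lam ^ 2 * |R|) (𝓝[>] 0) (𝓝 0) := by
    have : Continuous fun lam : ℝ => lam ^ 2 * |R| := by fun_prop
    simpa using (this.tendsto 0).mono_left (nhdsWithin_le_nhds (s := Set.Ioi (0 : ℝ)))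
  filter_upwards [h1.eventually (gt_mem_nhds hε)] with lam hlam x hx
  refine hball ?_
  rw [Metric.mem_ball, Real.dist_eq, add_sub_cancel_left, abs_mul, abs_of_nonneg (sq_nonneg lam)]
  exact (mul_le_mul_of_nonneg_left (hx.trans (le_abs_self R)) (sq_nonneg lam)).trans_lt hlam

end Rescale

/-! ### The rescaled field -/

section Field

variable {𝒦 ℋ : Type*}
  [NormedAddCommGroup 𝒦] [InnerProductSpace ℂ 𝒦] [CompleteSpace 𝒦] [FiniteDimensional ℂ 𝒦]
  [NormedAddCommGroup ℋ] [InnerProductSpace ℂ ℋ] [CompleteSpace ℋ]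
  {K : 𝒦 →L[ℂ] 𝒦} {HR : ℋ →ₗ.[ℂ] ℋ} {V : 𝒦 →L[ℂ] ℋ}
  {𝔥 : spectrum ℝ K → Type*} [∀ k, NormedAddCommGroup (𝔥 k)]
  [∀ k, InnerProductSpace ℂ (𝔥 k)] [∀ k, CompleteSpace (𝔥 k)]
  {I : spectrum ℝ K → Set ℝ} {W : ∀ k, Lp (𝔥 k) 2 (volume.restrict (I k)) →ₗᵢ[ℂ] ℋ}
  {v : ∀ k, ℝ → 𝒦 →L[ℂ] 𝔥 k}

/-- The components `g_k` of `g ∈ L²(ℝ; ⊕_k 𝔥_k)`. -/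
def component (k : spectrum ℝ K) :
    Lp (PiLp 2 𝔥) 2 (volume : Measure ℝ) →L[ℂ] Lp (𝔥 k) 2 (volume : Measure ℝ) :=
  (PiLp.proj 2 𝔥 k : PiLp 2 𝔥 →L[ℂ] 𝔥 k).compLpL 2 volume

theorem coeFn_component (k : spectrum ℝ K) (g : Lp (PiLp 2 𝔥) 2 (volume : Measure ℝ)) :
    component k g =ᵐ[volume] fun x => g x k :=
  ContinuousLinearMap.coeFn_compLp (PiLp.proj 2 𝔥 k : PiLp 2 𝔥 →L[ℂ] 𝔥 k) g

theorem sum_inner_component (f g : Lp (PiLp 2 𝔥) 2 (volume : Measure ℝ)) :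
    ∑ k, ⟪component k f, component k g⟫_ℂ = ⟪f, g⟫_ℂ := by
  simp only [L2.inner_def]
  rw [← integral_finsetSum _ fun k _ => L2.integrable_inner _ _]
  have h : ∀ᵐ x, ∀ k, component k f x = f x k ∧ component k g x = g x k :=
    ae_all_iff.mpr fun k => (coeFn_component k f).and (coeFn_component k g)
  refine integral_congr_ae ?_
  filter_upwards [h] with x hx
  rw [PiLp.inner_apply]
  exact Finset.sum_congr rfl fun k _ => by rw [(hx k).1, (hx k).2]

theorem integrable_component {g : Lp (PiLp 2 𝔥) 2 (volume : Measure ℝ)} (hg : Integrable g)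
    (k : spectrum ℝ K) : Integrable (component k g) :=
  ((PiLp.proj 2 𝔥 k : PiLp 2 𝔥 →L[ℂ] 𝔥 k).integrable_comp hg).congr (coeFn_component k g).symm

theorem oneBra_component {g : Lp (PiLp 2 𝔥) 2 (volume : Measure ℝ)} (hg : Integrable g)
    (k : spectrum ℝ K) (u : ℝ) : oneBra u (component k g) = oneBra u g k := by
  have hi : Integrable fun x : ℝ => Complex.exp (-(Complex.I * u * x)) • g x := by
    have hc : Continuous fun x : ℝ => Complex.exp (-(Complex.I * u * x)) := by fun_prop
    refine hg.congr' (hc.aestronglyMeasurable.smul hg.1)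
      (ae_of_all _ fun x => ?_)
    have := norm_exp_I_mul (-u) x
    push_cast at this
    rw [norm_smul, show -(Complex.I * u * x) = Complex.I * -u * x by ring, this, one_mul]
  rw [oneBra, oneBra]
  change _ = (PiLp.proj 2 𝔥 k : PiLp 2 𝔥 →L[ℂ] 𝔥 k) _
  rw [← ContinuousLinearMap.integral_comp_comm _ hi]
  refine integral_congr_ae ?_
  filter_upwards [coeFn_component k g] with x hx
  rw [hx]
  rfl

theorem inner_nu_inputField {g : Lp (PiLp 2 𝔥) 2 (volume : Measure ℝ)} (hg : Integrable g)
    (u : ℝ) (φ : 𝒦) : ⟪φ, adjoint (nu v) (inputField g u)⟫_ℂ =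
      ∑ k : spectrum ℝ K, ⟪v k k (eigenProjection K k φ), oneBra u (component k g)⟫_ℂ := by
  rw [adjoint_inner_right, PiLp.inner_apply]
  refine Finset.sum_congr rfl fun k _ => ?_
  rw [oneBra_component hg]
  change ⟪(Real.sqrt (2 * Real.pi) : ℂ) • v k k (eigenProjection K k φ),
    (Real.sqrt (2 * Real.pi) : ℂ)⁻¹ • oneBra u g k⟫_ℂ = _
  rw [inner_smul_left, inner_smul_right, Complex.conj_ofReal, ← mul_assoc,
    mul_inv_cancel₀ sqrt_two_pi_ne_zero, one_mul]

variable (I W) in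
/-- The second component of the identification operator. -/
def reservoirMap (lam : ℝ) : Lp (PiLp 2 𝔥) 2 (volume : Measure ℝ) →L[ℂ] ℋ :=
  ∑ k, (W k).toContinuousLinearMap ∘L rescale lam k (I k) ∘L component k

theorem reservoirMap_apply (lam : ℝ) (g : Lp (PiLp 2 𝔥) 2 (volume : Measure ℝ)) :
    reservoirMap I W lam g = ∑ k : spectrum ℝ K, W k (rescale lam k (I k) (component k g)) := by
  rw [reservoirMap, _root_.sum_apply]
  rfl

theorem identification_apply (lam : ℝ)
    (ψ : WithLp 2 (𝒦 × Lp (PiLp 2 𝔥) 2 (volume : Measure ℝ))) :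
    identification I W lam ψ = WithLp.toLp 2 (ψ.fst, reservoirMap I W lam ψ.snd) := rfl

theorem inner_reservoirMap (hHR : IsSelfAdjoint HR) (hreg : IsRegularNearSpectrum HR V I W v)
    (lam : ℝ) (f g : Lp (PiLp 2 𝔥) 2 (volume : Measure ℝ)) :
    ⟪reservoirMap I W lam f, reservoirMap I W lam g⟫_ℂ = ∑ k : spectrum ℝ K,
      ⟪rescale lam k (I k) (component k f), rescale lam k (I k) (component k g)⟫_ℂ := by
  rw [reservoirMap_apply, reservoirMap_apply, sum_inner]
  refine Finset.sum_congr rfl fun k _ => ?_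
  rw [inner_sum, Finset.sum_eq_single k]
  · exact (W k).inner_map_map _ _
  · intro l _ hlk
    refine inner_eq_zero_of_disjoint hHR (hreg.mul k) (hreg.disjoint hlk) _ ?_
    rw [← hreg.range_eq l]
    exact ⟨_, rfl⟩
  · simp

theorem norm_reservoirMap_le (hHR : IsSelfAdjoint HR) (hreg : IsRegularNearSpectrum HR V I W v)
    {lam : ℝ} (hlam : 0 < lam) (g : Lp (PiLp 2 𝔥) 2 (volume : Measure ℝ)) :
    ‖reservoirMap I W lam g‖ ≤ ‖g‖ := by
  have h1 : ‖reservoirMap I W lam g‖ ^ 2 =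
      ∑ k : spectrum ℝ K, ‖rescale lam k (I k) (component k g)‖ ^ 2 := by
    have h := congrArg Complex.re (inner_reservoirMap hHR hreg lam g g)
    rw [Complex.re_sum] at h
    refine (inner_self_eq_norm_sq (𝕜 := ℂ) _).symm.trans (h.trans ?_)
    exact Finset.sum_congr rfl fun k _ => inner_self_eq_norm_sq (𝕜 := ℂ) _
  have h2 : ‖g‖ ^ 2 = ∑ k : spectrum ℝ K, ‖component k g‖ ^ 2 := by
    have h := congrArg Complex.re (sum_inner_component g g)
    rw [Complex.re_sum] at h
    refine (inner_self_eq_norm_sq (𝕜 := ℂ) g).symm.trans (h.symm.trans ?_)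
    exact Finset.sum_congr rfl fun k _ => inner_self_eq_norm_sq (𝕜 := ℂ) _
  refine (sq_le_sq₀ (norm_nonneg _) (norm_nonneg _)).mp ?_
  rw [h1, h2]
  exact Finset.sum_le_sum fun k _ => pow_le_pow_left₀ (norm_nonneg _)
    (norm_rescale_le hlam k (I k) _) 2

theorem norm_identification_le (hHR : IsSelfAdjoint HR) (hreg : IsRegularNearSpectrum HR V I W v)
    {lam : ℝ} (hlam : 0 < lam) (ψ : WithLp 2 (𝒦 × Lp (PiLp 2 𝔥) 2 (volume : Measure ℝ))) :
    ‖identification I W lam ψ‖ ≤ ‖ψ‖ := by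
  refine (sq_le_sq₀ (norm_nonneg _) (norm_nonneg _)).mp ?_
  rw [identification_apply, WithLp.prod_norm_sq_eq_of_L2, WithLp.prod_norm_sq_eq_of_L2]
  exact add_le_add le_rfl (pow_le_pow_left₀ (norm_nonneg _)
    (norm_reservoirMap_le hHR hreg hlam ψ.snd) 2)

theorem component_support {R : ℝ} {g : Lp (PiLp 2 𝔥) 2 (volume : Measure ℝ)}
    (hg : ∀ᵐ x, R < |x| → g x = 0) (k : spectrum ℝ K) :
    ∀ᵐ x, R < |x| → component k g x = 0 := by
  filter_upwards [hg, coeFn_component k g] with x h1 h2 hx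
  rw [h2, h1 hx]
  rfl

theorem eventually_inner_reservoirMap (hHR : IsSelfAdjoint HR)
    (hreg : IsRegularNearSpectrum HR V I W v) (f : Lp (PiLp 2 𝔥) 2 (volume : Measure ℝ))
    {g : Lp (PiLp 2 𝔥) 2 (volume : Measure ℝ)} (hg : g ∈ boundedSupport (PiLp 2 𝔥) volume) :
    ∀ᶠ lam in 𝓝[>] 0, ⟪reservoirMap I W lam f, reservoirMap I W lam g⟫_ℂ = ⟪f, g⟫_ℂ := by
  obtain ⟨R, hR⟩ := hg
  have h1 : ∀ᶠ lam : ℝ in 𝓝[>] 0, ∀ k : spectrum ℝ K, ∀ x, |x| ≤ R →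
      (k : ℝ) + lam ^ 2 * x ∈ I k :=
    eventually_all.mpr fun k => eventually_add_mul_mem ((hreg.isOpen k).mem_nhds (hreg.mem k))
  filter_upwards [h1, self_mem_nhdsWithin] with lam h2 hlam
  rw [inner_reservoirMap hHR hreg, ← sum_inner_component f g]
  exact Finset.sum_congr rfl fun k _ => inner_rescale hlam (hreg.isOpen k).measurableSet (h2 k) _
    (component_support hR k)

/-- The interaction sees the field only through `v(k)`, up to a small error. -/
theorem norm_inner_coupling_sub_le (hHR : IsSelfAdjoint HR)
    (hreg : IsRegularNearSpectrum HR V I W v) (hK : IsSelfAdjoint K) {lam : ℝ} (hlam : 0 < lam)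
    (k : spectrum ℝ K) {R κ : ℝ}
    (hR : ∀ x, |x| ≤ R → (k : ℝ) + lam ^ 2 * x ∈ I k ∧
      ‖v k ((k : ℝ) + lam ^ 2 * x) - v k k‖ ≤ κ)
    {g : Lp (𝔥 k) 2 (volume : Measure ℝ)} (hg : ∀ᵐ x, R < |x| → g x = 0) (hgi : Integrable g)
    (u : ℝ) (φ : 𝒦) :
    ‖⟪coupling K HR V lam u φ, W k (rescale lam k (I k) g)⟫_ℂ -
      ⟪v k k (bexpI K (u / lam ^ 2) φ),
        Complex.exp (-(Complex.I * (u / lam ^ 2 : ℝ) * (k : ℝ))) • oneBra u g⟫_ℂ‖ ≤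
      κ * ‖φ‖ * ∫ x, ‖g x‖ := by
  set τ := u / lam ^ 2 with hτ
  set b := bexpI K τ φ with hb
  have hbn : ‖b‖ = ‖φ‖ := norm_bexpI_apply hK τ φ
  have hI := (hreg.isOpen k).measurableSet
  have hl2 : (lam ^ 2 : ℝ) ≠ 0 := by positivity
  set f := rescale lam k (I k) g with hf
  let c : ℝ → ℂ := fun x => Complex.exp (-(Complex.I * τ * (k : ℝ))) *
    Complex.exp (-(Complex.I * u * x))
  have hc : ∀ x, ‖c x‖ = 1 := fun x => by
    have h1 := norm_exp_I_mul (-τ) k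
    have h2 := norm_exp_I_mul (-u) x
    push_cast at h1 h2
    rw [norm_mul, show -(Complex.I * τ * (k : ℝ)) = Complex.I * -τ * (k : ℝ) by ring,
      show -(Complex.I * u * x) = Complex.I * -u * x by ring, h1, h2, one_mul]
  have hcc : Continuous c := by fun_prop
  let A : ℝ → ℂ := fun x => ⟪(I k).indicator (v k) ((k : ℝ) + lam ^ 2 * x) b, c x • g x⟫_ℂ
  let B : ℝ → ℂ := fun x => ⟪v k k b, c x • g x⟫_ℂ
  have hcg : AEStronglyMeasurable (fun x => c x • g x) volume :=
    hcc.aestronglyMeasurable.smul hgi.1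
  have hcgi : Integrable fun x => c x • g x :=
    hgi.congr' hcg (ae_of_all _ fun x => by rw [norm_smul, hc, one_mul])
  have e1 : ⟪coupling K HR V lam u φ, W k f⟫_ℂ = ∫ x, A x := by
    change ⟪((lam⁻¹ : ℝ) : ℂ) • expI HR (-τ) (V b), W k f⟫_ℂ = _
    rw [inner_smul_left, Complex.conj_ofReal, (isUnitaryGroup_expI hHR).inner_neg,
      expI_apply_of_mul hHR (hreg.mul k), hreg.inner_apply]
    have e2 : ∫ y in I k, ⟪v k y b, charOn (volume.restrict (I k)) (-τ) f y⟫_ℂ =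
        ∫ y in I k, ⟪v k y b, Complex.exp (Complex.I * (-τ : ℝ) * y) •
          ((lam⁻¹ : ℝ) : ℂ) • g ((y - k) / lam ^ 2)⟫_ℂ := by
      refine integral_congr_ae ?_
      filter_upwards [coeFn_charOn (-τ) f, coeFn_rescale hlam k (I k) g] with y h1 h2
      rw [h1, hf, h2]
    rw [e2, setIntegral_eq_integral_rescale hlam k hI, ← Complex.coe_smul, smul_eq_mul,
      ← mul_assoc, ← integral_const_mul]
    refine integral_congr_ae (ae_of_all _ fun x => ?_)
    by_cases h : (k : ℝ) + lam ^ 2 * x ∈ I k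
    · simp only [A, Set.indicator_of_mem h, rescale_add_mul hlam]
      rw [inner_smul_right, inner_smul_right, inner_smul_right]
      have hexp : Complex.exp (Complex.I * (-τ : ℝ) * ((k : ℝ) + lam ^ 2 * x : ℝ)) = c x := by
        simp only [c]
        rw [← Complex.exp_add]
        congr 1
        have : (τ : ℂ) * (lam : ℂ) ^ 2 = u := by
          have : τ * lam ^ 2 = u := div_mul_cancel₀ u hl2
          exact_mod_cast this
        push_cast
        linear_combination (-Complex.I * x) * this
      rw [hexp]
      have hll : (lam : ℂ) ≠ 0 := by exact_mod_cast hlam.ne'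
      push_cast
      field_simp
    · simp only [A, Set.indicator_of_notMem h, mul_zero, zero_apply, inner_zero_left]
  have e3 : ⟪v k k b, Complex.exp (-(Complex.I * τ * (k : ℝ))) • oneBra u g⟫_ℂ = ∫ x, B x := by
    rw [oneBra, ← integral_smul, ← integral_inner]
    · refine integral_congr_ae (ae_of_all _ fun x => ?_)
      simp only [B, c, smul_smul]
    · simpa only [c, mul_smul] using hcgi
  have hdiff : ∀ᵐ x, ‖A x - B x‖ ≤ κ * ‖φ‖ * ‖g x‖ := by
    filter_upwards [hg] with x hx
    by_cases h : |x| ≤ R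
    · obtain ⟨h1, h2⟩ := hR x h
      simp only [A, B, Set.indicator_of_mem h1]
      rw [← inner_sub_left, ← sub_apply]
      refine (norm_inner_le_norm _ _).trans ?_
      rw [norm_smul, hc, one_mul, ← hbn]
      exact mul_le_mul_of_nonneg_right ((ContinuousLinearMap.le_opNorm _ _).trans
        (mul_le_mul_of_nonneg_right h2 (norm_nonneg _))) (norm_nonneg _)
    · simp only [A, B, hx (not_le.mp h), smul_zero, inner_zero_right, sub_zero, norm_zero, mul_zero]
      exact le_rfl
  have hBi : Integrable B := hcgi.const_inner _
  have hAm : AEStronglyMeasurable A volume := by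
    have h1 : AEStronglyMeasurable ((I k).indicator (v k)) volume :=
      (aestronglyMeasurable_indicator_iff hI).mpr (hreg.measurable k)
    have hq : Measure.QuasiMeasurePreserving (fun x : ℝ => (k : ℝ) + lam ^ 2 * x) := by
      refine ((measurePreserving_add_left volume (k : ℝ)).quasiMeasurePreserving).comp
        ⟨by fun_prop, ?_⟩
      rw [Real.map_volume_mul_left hl2]
      exact Measure.smul_absolutelyContinuous
    exact ((h1.comp_quasiMeasurePreserving hq).apply_continuousLinearMap b).inner hcg
  have hABi : Integrable fun x => A x - B x :=
    (hgi.norm.const_mul (κ * ‖φ‖)).mono' (hAm.sub hBi.1) hdiff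
  have hAi : Integrable A := by
    refine (hABi.add hBi).congr (ae_of_all _ fun x => ?_)
    simp
  rw [e1, e3, ← integral_sub hAi hBi, ← integral_const_mul]
  exact norm_integral_le_of_norm_le (hgi.norm.const_mul _) hdiff

/-- The main part of `(φ | Q(u)* J_λ g)` for the rescaled coupling `Q`. -/
def fieldForm (v : ∀ k, ℝ → 𝒦 →L[ℂ] 𝔥 k) (lam : ℝ)
    (g : Lp (PiLp 2 𝔥) 2 (volume : Measure ℝ)) (u : ℝ) (φ : 𝒦) : ℂ :=
  ∑ k : spectrum ℝ K, ⟪v k k (bexpI K (u / lam ^ 2) φ),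
    Complex.exp (-(Complex.I * (u / lam ^ 2 : ℝ) * (k : ℝ))) • oneBra u (component k g)⟫_ℂ

theorem eventually_norm_inner_coupling_sub_le (hHR : IsSelfAdjoint HR)
    (hreg : IsRegularNearSpectrum HR V I W v) (hK : IsSelfAdjoint K)
    {g : Lp (PiLp 2 𝔥) 2 (volume : Measure ℝ)} (hg : g ∈ boundedSupport (PiLp 2 𝔥) volume)
    {κ : ℝ} (hκ : 0 < κ) :
    ∀ᶠ lam in 𝓝[>] 0, ∀ (u : ℝ) (φ : 𝒦),
      ‖⟪φ, adjoint (coupling K HR V lam u) (reservoirMap I W lam g)⟫_ℂ - fieldForm v lam g u φ‖ ≤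
        κ * ‖φ‖ * ∑ k : spectrum ℝ K, ∫ x, ‖component k g x‖ := by
  have hgi := integrable_of_mem_boundedSupport hg
  obtain ⟨R, hR⟩ := hg
  have h1 : ∀ᶠ lam : ℝ in 𝓝[>] 0, ∀ k : spectrum ℝ K, ∀ x, |x| ≤ R →
      (k : ℝ) + lam ^ 2 * x ∈ I k ∩ {y | ‖v k y - v k k‖ ≤ κ} := by
    refine eventually_all.mpr fun k => eventually_add_mul_mem
      (inter_mem ((hreg.isOpen k).mem_nhds (hreg.mem k)) ?_)
    have h2 := tendsto_iff_norm_sub_tendsto_zero.mp (hreg.continuousAt k)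
    exact h2.eventually (ge_mem_nhds hκ)
  filter_upwards [h1, self_mem_nhdsWithin] with lam h2 hlam u φ
  rw [adjoint_inner_right, reservoirMap_apply, inner_sum, fieldForm, ← Finset.sum_sub_distrib,
    Finset.mul_sum]
  refine (norm_sum_le _ _).trans (Finset.sum_le_sum fun k _ => ?_)
  exact norm_inner_coupling_sub_le hHR hreg hK hlam k (h2 k) (component_support hR k)
    (integrable_component hgi k) u φ

theorem norm_oneBra_le {E : Type*} [NormedAddCommGroup E] [InnerProductSpace ℂ E] (u : ℝ)
    (g : Lp E 2 (volume : Measure ℝ)) : ‖oneBra u g‖ ≤ ∫ x, ‖g x‖ := by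
  refine (norm_integral_le_integral_norm _).trans (le_of_eq ?_)
  refine integral_congr_ae (ae_of_all _ fun x => ?_)
  have := norm_exp_I_mul (-u) x
  push_cast at this
  simp only
  rw [norm_smul, show -(Complex.I * u * x) = Complex.I * -u * x by ring, this, one_mul]

theorem exists_norm_adjoint_coupling_le (hHR : IsSelfAdjoint HR)
    (hreg : IsRegularNearSpectrum HR V I W v) (hK : IsSelfAdjoint K)
    {g : Lp (PiLp 2 𝔥) 2 (volume : Measure ℝ)} (hg : g ∈ boundedSupport (PiLp 2 𝔥) volume) :
    ∃ B : ℝ, ∀ᶠ lam in 𝓝[>] 0, ∀ u,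
      ‖adjoint (coupling K HR V lam u) (reservoirMap I W lam g)‖ ≤ B := by
  refine ⟨(∑ k : spectrum ℝ K, ∫ x, ‖component k g x‖) +
    ∑ k : spectrum ℝ K, ‖v k k‖ * ∫ x, ‖component k g x‖, ?_⟩
  filter_upwards [eventually_norm_inner_coupling_sub_le hHR hreg hK hg one_pos] with lam h u
  set y := adjoint (coupling K HR V lam u) (reservoirMap I W lam g)
  have h1 := h u y
  have h2 : ‖fieldForm v lam g u y‖ ≤
      ‖y‖ * ∑ k : spectrum ℝ K, ‖v k k‖ * ∫ x, ‖component k g x‖ := by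
    rw [fieldForm, Finset.mul_sum]
    refine (norm_sum_le _ _).trans (Finset.sum_le_sum fun k _ => ?_)
    refine (norm_inner_le_norm _ _).trans ?_
    have e1 := norm_exp_I_mul (-(u / lam ^ 2)) k
    rw [norm_smul, show -(Complex.I * (u / lam ^ 2 : ℝ) * (k : ℝ)) =
      Complex.I * (-(u / lam ^ 2) : ℝ) * (k : ℝ) by push_cast; ring, e1, one_mul]
    have e2 := (v k k).le_opNorm (bexpI K (u / lam ^ 2) y)
    rw [norm_bexpI_apply hK] at e2
    calc _ ≤ (‖v k k‖ * ‖y‖) * ∫ x, ‖component k g x‖ :=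
          mul_le_mul e2 (norm_oneBra_le u _) (norm_nonneg _) (by positivity)
      _ = _ := by ring
  have h3 : ‖y‖ * ‖y‖ ≤ ((∑ k : spectrum ℝ K, ∫ x, ‖component k g x‖) +
      ∑ k : spectrum ℝ K, ‖v k k‖ * ∫ x, ‖component k g x‖) * ‖y‖ := by
    have e1 : ‖⟪y, y⟫_ℂ‖ = ‖y‖ * ‖y‖ := by
      rw [inner_self_eq_norm_sq_to_K]
      simp [sq]
    have e2 := norm_le_norm_sub_add ⟪y, y⟫_ℂ (fieldForm v lam g u y)
    rw [e1] at e2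
    linarith
  by_cases hy : ‖y‖ = 0
  · rw [hy]
    refine add_nonneg (Finset.sum_nonneg fun k _ => integral_nonneg fun _ => norm_nonneg _)
      (Finset.sum_nonneg fun k _ => mul_nonneg (norm_nonneg _)
        (integral_nonneg fun _ => norm_nonneg _))
  · exact le_of_mul_le_mul_right h3 (lt_of_le_of_ne (norm_nonneg _) (Ne.symm hy))

theorem fieldForm_eq_sum (hK : IsSelfAdjoint K) (lam : ℝ)
    (g : Lp (PiLp 2 𝔥) 2 (volume : Measure ℝ)) (u : ℝ) (φ : 𝒦) :
    fieldForm v lam g u φ = ∑ k : spectrum ℝ K, ∑ l : spectrum ℝ K,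
      Complex.exp (Complex.I * (u / lam ^ 2 : ℝ) * ((l : ℝ) - (k : ℝ) : ℝ)) •
        ⟪v k k (eigenProjection K l φ), oneBra u (component k g)⟫_ℂ := by
  rw [fieldForm]
  refine Finset.sum_congr rfl fun k _ => ?_
  rw [bexpI_eq_sum hK, map_sum, sum_inner]
  refine Finset.sum_congr rfl fun l _ => ?_
  rw [map_smul, inner_smul_left, inner_smul_right, ← mul_assoc, ← Complex.exp_conj,
    ← Complex.exp_add, smul_eq_mul]
  congr 2
  simp only [map_neg, map_mul, Complex.conj_I, Complex.conj_ofReal]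
  push_cast
  ring

/-- The rescaled field converges weakly to the input field. -/
theorem tendsto_integral_inner_field (hHR : IsSelfAdjoint HR)
    (hreg : IsRegularNearSpectrum HR V I W v) (hK : IsSelfAdjoint K)
    {g : Lp (PiLp 2 𝔥) 2 (volume : Measure ℝ)} (hg : g ∈ boundedSupport (PiLp 2 𝔥) volume)
    {η : ℝ → 𝒦} (hη : Continuous η) {a s : ℝ} (has : a ≤ s) :
    Tendsto (fun lam => ∫ u in a..s,
      ⟪η u, adjoint (coupling K HR V lam u) (reservoirMap I W lam g)⟫_ℂ) (𝓝[>] 0)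
      (𝓝 (∫ u in a..s, ⟪η u, adjoint (nu v) (inputField g u)⟫_ℂ)) := by
  have hgi := integrable_of_mem_boundedSupport hg
  have hog : ∀ k : spectrum ℝ K, Continuous fun u => oneBra u (component k g) := fun k =>
    continuous_oneBra (integrable_component hgi k)
  have cT : ∀ k l : spectrum ℝ K, Continuous fun u =>
      ⟪v k k (eigenProjection K l (η u)), oneBra u (component k g)⟫_ℂ := fun k l =>
    ((v k k).continuous.comp ((eigenProjection K l).continuous.comp hη)).inner (hog k)
  have cE : ∀ (lam : ℝ) (k l : spectrum ℝ K), Continuous fun u : ℝ =>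
      Complex.exp (Complex.I * (u / lam ^ 2 : ℝ) * ((l : ℝ) - (k : ℝ) : ℝ)) •
        ⟪v k k (eigenProjection K l (η u)), oneBra u (component k g)⟫_ℂ := fun lam k l => by
    have hc : Continuous fun u : ℝ =>
        Complex.exp (Complex.I * (u / lam ^ 2 : ℝ) * ((l : ℝ) - (k : ℝ) : ℝ)) := by fun_prop
    exact hc.smul (cT k l)
  have cF : ∀ lam : ℝ, Continuous fun u => fieldForm v lam g u (η u) := fun lam => by
    simp only [fieldForm_eq_sum hK]
    exact continuous_finsetSum _ fun k _ => continuous_finsetSum _ fun l _ => cE lam k l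
  have cQ : ∀ lam : ℝ, Continuous fun u =>
      ⟪η u, adjoint (coupling K HR V lam u) (reservoirMap I W lam g)⟫_ℂ := fun lam =>
    hη.inner (continuous_adjoint_coupling_apply hK hHR lam continuous_const)
  have hmain : Tendsto (fun lam => ∫ u in a..s, fieldForm v lam g u (η u)) (𝓝[>] 0)
      (𝓝 (∫ u in a..s, ⟪η u, adjoint (nu v) (inputField g u)⟫_ℂ)) := by
    have e2 : ∀ lam : ℝ, ∫ u in a..s, fieldForm v lam g u (η u) =
        ∑ k : spectrum ℝ K, ∑ l : spectrum ℝ K, ∫ u in a..s,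
          Complex.exp (Complex.I * (u / lam ^ 2 : ℝ) * ((l : ℝ) - (k : ℝ) : ℝ)) •
            ⟪v k k (eigenProjection K l (η u)), oneBra u (component k g)⟫_ℂ := by
      intro lam
      simp only [fieldForm_eq_sum hK]
      rw [intervalIntegral.integral_finsetSum fun k _ =>
        (continuous_finsetSum _ fun l _ => cE lam k l).intervalIntegrable _ _]
      refine Finset.sum_congr rfl fun k _ => ?_
      rw [intervalIntegral.integral_finsetSum fun l _ => (cE lam k l).intervalIntegrable _ _]
    have e3 : ∫ u in a..s, ⟪η u, adjoint (nu v) (inputField g u)⟫_ℂ =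
        ∑ k : spectrum ℝ K, ∑ l : spectrum ℝ K, if k = l then
          ∫ u in a..s, ⟪v k k (eigenProjection K k (η u)), oneBra u (component k g)⟫_ℂ else 0 := by
      simp only [Finset.sum_ite_eq, Finset.mem_univ, if_true]
      rw [← intervalIntegral.integral_finsetSum fun (k : spectrum ℝ K) _ =>
        (cT k k).intervalIntegrable _ _]
      exact intervalIntegral.integral_congr fun u _ => inner_nu_inputField hgi u (η u)
    rw [e3]
    simp only [e2]
    refine tendsto_finsetSum _ fun k _ => tendsto_finsetSum _ fun l _ => ?_
    split_ifs with hkl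
    · subst hkl
      simp
    · exact tendsto_integral_oscillating
        (sub_ne_zero.mpr fun h => hkl (Subtype.ext h.symm)) _ has
  have hsmall : Tendsto (fun lam => (∫ u in a..s,
      ⟪η u, adjoint (coupling K HR V lam u) (reservoirMap I W lam g)⟫_ℂ) -
      ∫ u in a..s, fieldForm v lam g u (η u)) (𝓝[>] 0) (𝓝 0) := by
    obtain ⟨B, hB⟩ := (isCompact_Icc (a := a) (b := s)).exists_bound_of_continuousOn
      hη.continuousOn
    have hB0 : 0 ≤ B := (norm_nonneg _).trans (hB a ⟨le_rfl, has⟩)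
    set S := ∑ k : spectrum ℝ K, ∫ x, ‖component k g x‖ with hS
    have hS0 : 0 ≤ S := Finset.sum_nonneg fun k _ => integral_nonneg fun _ => norm_nonneg _
    rw [Metric.tendsto_nhds]
    intro ε hε
    set D := B * S * (s - a) + 1 with hD
    have hD0 : 0 < D := by
      have := mul_nonneg (mul_nonneg hB0 hS0) (sub_nonneg.mpr has)
      linarith
    filter_upwards [eventually_norm_inner_coupling_sub_le hHR hreg hK hg
      (κ := ε / (2 * D)) (by positivity)] with lam hlam
    rw [dist_zero_right, ← intervalIntegral.integral_sub ((cQ lam).intervalIntegrable _ _)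
      ((cF lam).intervalIntegrable _ _)]
    have e1 := intervalIntegral.norm_integral_le_of_norm_le_const (a := a) (b := s)
      (C := ε / (2 * D) * B * S) (f := fun u =>
        ⟪η u, adjoint (coupling K HR V lam u) (reservoirMap I W lam g)⟫_ℂ -
          fieldForm v lam g u (η u)) fun u hu => by
        rw [Set.uIoc_of_le has] at hu
        refine (hlam u (η u)).trans ?_
        have := hB u ⟨hu.1.le, hu.2⟩
        gcongr
    refine e1.trans_lt ?_
    rw [abs_of_nonneg (sub_nonneg.mpr has)]
    have e2 : ε / (2 * D) * B * S * (s - a) = ε * ((D - 1) / (2 * D)) := by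
      rw [hD]
      ring
    rw [e2]
    have e3 : (D - 1) / (2 * D) < 1 := by
      rw [div_lt_one (by positivity)]
      linarith
    nlinarith
  have := hsmall.add hmain
  rw [zero_add] at this
  refine this.congr fun lam => ?_
  ring

end Field

/-! ### The weak coupling limit -/

section Limit

variable {𝒦 ℋ : Type*}
  [NormedAddCommGroup 𝒦] [InnerProductSpace ℂ 𝒦] [CompleteSpace 𝒦] [FiniteDimensional ℂ 𝒦]
  [NormedAddCommGroup ℋ] [InnerProductSpace ℂ ℋ] [CompleteSpace ℋ]
  {K : 𝒦 →L[ℂ] 𝒦} {HR : ℋ →ₗ.[ℂ] ℋ} {V : 𝒦 →L[ℂ] ℋ}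
  {𝔥 : spectrum ℝ K → Type*} [∀ k, NormedAddCommGroup (𝔥 k)]
  [∀ k, InnerProductSpace ℂ (𝔥 k)] [∀ k, CompleteSpace (𝔥 k)]
  {I : spectrum ℝ K → Set ℝ} {W : ∀ k, Lp (𝔥 k) 2 (volume.restrict (I k)) →ₗᵢ[ℂ] ℋ}
  {v : ∀ k, ℝ → 𝒦 →L[ℂ] 𝔥 k}

/-- The solution of `β' = -i (Υ β + ν* γ)` with `β(a) = b`, where `γ` is the input field of `g`. -/
def limitState {𝔤 : Type*} [NormedAddCommGroup 𝔤] [InnerProductSpace ℂ 𝔤] [CompleteSpace 𝔤]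
    (Υ : 𝒦 →L[ℂ] 𝒦) (ν : 𝒦 →L[ℂ] 𝔤) (a : ℝ)
    (ψ : WithLp 2 (𝒦 × Lp 𝔤 2 (volume : Measure ℝ))) (s : ℝ) : 𝒦 :=
  traj Υ ν ψ.fst (fun w => inputField ψ.snd (w + a)) (s - a)

theorem adjoint_comp_comp {E F G G' : Type*} [NormedAddCommGroup E] [InnerProductSpace ℂ E]
    [CompleteSpace E] [NormedAddCommGroup F] [InnerProductSpace ℂ F] [CompleteSpace F]
    [NormedAddCommGroup G] [InnerProductSpace ℂ G] [CompleteSpace G]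
    [NormedAddCommGroup G'] [InnerProductSpace ℂ G'] [CompleteSpace G']
    (A : G →L[ℂ] G') (B : F →L[ℂ] G) (C : E →L[ℂ] F) :
    adjoint (A ∘L B ∘L C) = adjoint C ∘L adjoint B ∘L adjoint A := by
  rw [adjoint_comp, adjoint_comp, comp_assoc]

section LimitState

variable {𝔤 : Type*} [NormedAddCommGroup 𝔤] [InnerProductSpace ℂ 𝔤] [CompleteSpace 𝔤]
  {Υ : 𝒦 →L[ℂ] 𝒦} {ν : 𝒦 →L[ℂ] 𝔤}

theorem hasDerivAt_limitState (a : ℝ) {ψ : WithLp 2 (𝒦 × Lp 𝔤 2 (volume : Measure ℝ))}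
    (hψ : Integrable ψ.snd) (s : ℝ) : HasDerivAt (limitState Υ ν a ψ)
      (-Complex.I • (Υ (limitState Υ ν a ψ s) + adjoint ν (inputField ψ.snd s))) s := by
  have hc : Continuous fun w => inputField ψ.snd (w + a) :=
    (continuous_inputField hψ).comp (continuous_add_const a)
  have h := (hasDerivAt_traj (Y := Υ) (N := ν) hc ψ.fst (s - a)).comp_sub_const s a
  rwa [sub_add_cancel] at h

theorem continuous_limitState (a : ℝ) {ψ : WithLp 2 (𝒦 × Lp 𝔤 2 (volume : Measure ℝ))}
    (hψ : Integrable ψ.snd) : Continuous (limitState Υ ν a ψ) :=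
  continuous_iff_continuousAt.mpr fun s => (hasDerivAt_limitState a hψ s).continuousAt

theorem limitState_eq (a : ℝ) {ψ : WithLp 2 (𝒦 × Lp 𝔤 2 (volume : Measure ℝ))}
    (hψ : Integrable ψ.snd) (s : ℝ) : limitState Υ ν a ψ s = ψ.fst -
      Complex.I • (∫ u in a..s, adjoint ν (inputField ψ.snd u)) -
      ∫ u in a..s, Complex.I • Υ (limitState Υ ν a ψ u) := by
  have c1 : Continuous fun u => Υ (limitState Υ ν a ψ u) :=
    Υ.continuous.comp (continuous_limitState a hψ)
  have c2 : Continuous fun u => adjoint ν (inputField ψ.snd u) :=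
    (adjoint ν).continuous.comp (continuous_inputField hψ)
  have h1 := intervalIntegral.integral_eq_sub_of_hasDerivAt (a := a) (b := s)
    (fun u _ => hasDerivAt_limitState (Υ := Υ) (ν := ν) a hψ u)
    (((c1.add c2).const_smul _).intervalIntegrable _ _)
  rw [intervalIntegral.integral_smul, intervalIntegral.integral_add (c1.intervalIntegrable _ _)
    (c2.intervalIntegrable _ _)] at h1
  have h0 : limitState Υ ν a ψ a = ψ.fst := by
    rw [limitState, sub_self, traj_zero]
  rw [h0] at h1
  rw [eq_add_of_sub_eq h1.symm, intervalIntegral.integral_smul]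
  module

/-- The matrix elements of the dilation in the interaction picture. -/
theorem IsSingularFriedrichsGroup.inner_interaction
    {U : ℝ → WithLp 2 (𝒦 × Lp 𝔤 2 (volume : Measure ℝ)) →L[ℂ]
      WithLp 2 (𝒦 × Lp 𝔤 2 (volume : Measure ℝ))} (hU : IsSingularFriedrichsGroup Υ ν U)
    {a t : ℝ} (hat : a ≤ t) {ψ ψ' : WithLp 2 (𝒦 × Lp 𝔤 2 (volume : Measure ℝ))}
    (hψ : Integrable ψ.snd) (hψ' : Integrable ψ'.snd) :
    ⟪ψ, expZR t (U (t - a) (expZR (-a) ψ'))⟫_ℂ =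
      ⟪ψ.fst, limitState Υ ν a ψ' t⟫_ℂ + ⟪ψ.snd, ψ'.snd⟫_ℂ -
      Complex.I * ∫ u in a..t, ⟪adjoint ν (inputField ψ.snd u), limitState Υ ν a ψ' u⟫_ℂ := by
  have e0 : ⟪ψ, expZR t (U (t - a) (expZR (-a) ψ'))⟫_ℂ =
      ⟪expZR (-t) ψ, U (t - a) (expZR (-a) ψ')⟫_ℂ := by
    rw [← adjoint_inner_right, adjoint_expZR, neg_neg]
  have s1 : (expZR (-t) ψ).snd = charOn volume (-t) ψ.snd := rfl
  have s2 : (expZR (-a) ψ').snd = charOn volume (-a) ψ'.snd := rfl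
  have f1 : (expZR (-t) ψ).fst = ψ.fst := rfl
  have f2 : (expZR (-a) ψ').fst = ψ'.fst := rfl
  have i1 := integrable_charOn hψ (-t)
  have i2 := integrable_charOn hψ' (-a)
  rw [e0, hU.form (t - a) (sub_nonneg.mpr hat) _ _ (by rwa [s1]) (by rwa [s2]),
    dilationForm_eq Υ ν _ (by rwa [s1]) (by rwa [s2]), s1, s2, f1, f2]
  have e1 : ⟪charOn volume (-t) ψ.snd, mulChar (-(t - a)) (charOn volume (-a) ψ'.snd)⟫_ℂ =
      ⟪ψ.snd, ψ'.snd⟫_ℂ := by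
    have h1 : ∀ h : Lp 𝔤 2 (volume : Measure ℝ),
        charOn volume t (charOn volume (-(t - a)) (charOn volume (-a) h)) = h := fun h => by
      change ((charOn volume t * (charOn volume (-(t - a)) * charOn volume (-a)) :
        Lp 𝔤 2 (volume : Measure ℝ) →L[ℂ] Lp 𝔤 2 (volume : Measure ℝ))) h = h
      rw [← charOn_add, ← charOn_add, show t + (-(t - a) + -a) = 0 by ring, charOn_zero]
      rfl
    rw [inner_charOn_neg, mulChar_eq_charOn, h1]
  have e2 : inputField (charOn volume (-a) ψ'.snd) = fun w => inputField ψ'.snd (w + a) := by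
    funext w
    rw [inputField, inputField, oneBra_charOn, sub_neg_eq_add]
  have e3 : ∫ u in a..t, ⟪adjoint ν (inputField ψ.snd u), limitState Υ ν a ψ' u⟫_ℂ =
      (Real.sqrt (2 * Real.pi) : ℂ)⁻¹ * ∫ u in (0 : ℝ)..(t - a),
        ⟪oneBra (u - (t - a)) (charOn volume (-t) ψ.snd),
          ν (traj Υ ν ψ'.fst (fun w => inputField ψ'.snd (w + a)) u)⟫_ℂ := by
    have h1 := intervalIntegral.integral_comp_sub_right (a := a) (b := t)
      (fun u => (Real.sqrt (2 * Real.pi) : ℂ)⁻¹ * ⟪oneBra (u - (t - a)) (charOn volume (-t) ψ.snd),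
          ν (traj Υ ν ψ'.fst (fun w => inputField ψ'.snd (w + a)) u)⟫_ℂ) a
    rw [sub_self] at h1
    rw [← intervalIntegral.integral_const_mul, ← h1]
    refine intervalIntegral.integral_congr fun u _ => ?_
    rw [adjoint_inner_left, inputField, inner_smul_left, map_inv₀, Complex.conj_ofReal,
      oneBra_charOn, show u - a - (t - a) - -t = u by ring, limitState]
  rw [e1, e2, e3, limitState]
  ring

theorem IsSingularFriedrichsGroup.adjoint_interaction
    {U : ℝ → WithLp 2 (𝒦 × Lp 𝔤 2 (volume : Measure ℝ)) →L[ℂ]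
      WithLp 2 (𝒦 × Lp 𝔤 2 (volume : Measure ℝ))} (hU : IsSingularFriedrichsGroup Υ ν U)
    (t a : ℝ) : adjoint (expZR t ∘L U (t - a) ∘L expZR (-a)) =
      expZR a ∘L U (a - t) ∘L expZR (-t) := by
  refine (adjoint_comp_comp _ _ _).trans ?_
  have e1 : adjoint (U (t - a)) = U (a - t) := by
    rw [hU.isUnitaryGroup.adjoint_eq, neg_sub]
  exact congrArg₂ _ ((adjoint_expZR (-a)).trans (congrArg expZR (neg_neg a)))
    (congrArg₂ _ e1 (adjoint_expZR t))

end LimitState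

theorem tendsto_interaction_fst (hK : IsSelfAdjoint K) (hHR : IsSelfAdjoint HR)
    (hV : Integrable fun t : ℝ => ‖adjoint V ∘L expI HR t ∘L V‖)
    (hreg : IsRegularNearSpectrum HR V I W v)
    {ψ : WithLp 2 (𝒦 × Lp (PiLp 2 𝔥) 2 (volume : Measure ℝ))}
    (hψ : ψ.snd ∈ boundedSupport (PiLp 2 𝔥) volume) {a s : ℝ} (has : a ≤ s) :
    Tendsto (fun lam => (interaction K HR V lam a s (identification I W lam ψ)).fst) (𝓝[>] 0)
      (𝓝 (limitState (levelShift K HR V) (nu v) a ψ s)) := by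
  have hψi := integrable_of_mem_boundedSupport hψ
  set β := limitState (levelShift K HR V) (nu v) a ψ with hβ
  have hβc : Continuous β := continuous_limitState a hψi
  set βl : ℝ → ℝ → 𝒦 := fun lam s =>
    (interaction K HR V lam a s (identification I W lam ψ)).fst with hβl
  have hβlc : ∀ lam, Continuous (βl lam) := fun lam =>
    (WithLp.fstL 2 ℂ 𝒦 ℋ).continuous.comp (continuous_interaction hK hHR lam a _)
  let g : ℝ → ℝ → 𝒦 := fun lam u =>
    adjoint (coupling K HR V lam u) (reservoirMap I W lam ψ.snd)
  have hgc : ∀ lam, Continuous (g lam) := fun lam =>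
    continuous_adjoint_coupling_apply hK hHR lam continuous_const
  have hγc : Continuous fun u => adjoint (nu v) (inputField ψ.snd u) :=
    (adjoint (nu v)).continuous.comp (continuous_inputField hψi)
  have hΥc : Continuous fun u => Complex.I • levelShift K HR V (β u) :=
    ((levelShift K HR V).continuous.comp hβc).const_smul _
  let r : ℝ → ℝ → 𝒦 := fun lam s =>
    Complex.I • ((∫ u in a..s, adjoint (nu v) (inputField ψ.snd u)) - ∫ u in a..s, g lam u) +
      ((∫ u in a..s, Complex.I • levelShift K HR V (β u)) - memory K HR V lam a β s)
  have hr : ∀ lam s, βl lam s - β s - r lam s =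
      -memory K HR V lam a (fun w => βl lam w - β w) s := by
    intro lam s
    have h1 : βl lam s = ψ.fst - Complex.I • (∫ u in a..s, g lam u) -
        memory K HR V lam a (βl lam) s :=
      interaction_fst hK hHR lam a (identification I W lam ψ) s
    rw [memory_sub hK hHR lam a (hβlc lam) hβc, h1]
    have h2 : β s = _ := limitState_eq a hψi s
    rw [h2]
    simp only [r]
    module
  obtain ⟨D, hD⟩ := (isCompact_Icc (a := a) (b := s)).exists_bound_of_continuousOn
    hβc.continuousOn
  have hC : 0 ≤ ∫ t, ‖adjoint V ∘L expI HR t ∘L V‖ := integral_nonneg fun _ => norm_nonneg _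
  have key := tendsto_zero_of_volterra (l := 𝓝[>] (0 : ℝ)) (δ := fun lam s => βl lam s - β s)
    (r := r) (D := ‖ψ‖ + D) (a := a) (T := s) hC
    (Eventually.of_forall fun lam => (hβlc lam).sub hβc)
    (Eventually.of_forall fun lam => by
      have p1 : Continuous fun s => ∫ u in a..s, g lam u :=
        intervalIntegral.continuous_primitive (fun _ _ => (hgc lam).intervalIntegrable _ _) a
      have p2 : Continuous fun s => ∫ u in a..s, adjoint (nu v) (inputField ψ.snd u) :=
        intervalIntegral.continuous_primitive (fun _ _ => hγc.intervalIntegrable _ _) a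
      have p3 : Continuous fun s => ∫ u in a..s, Complex.I • levelShift K HR V (β u) :=
        intervalIntegral.continuous_primitive (fun _ _ => hΥc.intervalIntegrable _ _) a
      exact ((p2.sub p1).const_smul _).add (p3.sub (continuous_memory hK hHR lam a hβc)))
    (by
      filter_upwards [self_mem_nhdsWithin] with lam hlam w hw
      refine (norm_sub_le _ _).trans (add_le_add ?_ (hD w hw))
      refine (WithLp.norm_fst_le _ _).trans ?_
      rw [norm_interaction hK hHR]
      exact norm_identification_le hHR hreg hlam ψ)
    (by
      filter_upwards [self_mem_nhdsWithin] with lam hlam w hw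
      rw [hr, norm_neg]
      exact norm_memory_le hK hHR hV hlam ((hβlc lam).sub hβc) hw.1)
    (fun w hw => by
      have h1 : Tendsto (fun lam => ∫ u in a..w, g lam u) (𝓝[>] 0)
          (𝓝 (∫ u in a..w, adjoint (nu v) (inputField ψ.snd u))) := by
        refine tendsto_of_tendsto_inner fun x => ?_
        have h2 := tendsto_integral_inner_field hHR hreg hK hψ (η := fun _ => x)
          continuous_const hw.1
        have h3 : ∀ f : ℝ → 𝒦, Continuous f →
            ∫ u in a..w, ⟪x, f u⟫_ℂ = ⟪x, ∫ u in a..w, f u⟫_ℂ := fun f hf =>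
          (innerSL ℂ x).intervalIntegral_comp_comm (hf.intervalIntegrable _ _)
        rw [h3 _ hγc] at h2
        exact h2.congr fun lam => h3 _ (hgc lam)
      have h4 := tendsto_memory hK hHR hV hβc hw.1
      have h5 := ((h1.const_sub (∫ u in a..w, adjoint (nu v) (inputField ψ.snd u))).const_smul
        Complex.I).add (h4.const_sub (∫ u in a..w, Complex.I • levelShift K HR V (β u)))
      rw [sub_self, sub_self, smul_zero, add_zero] at h5
      exact h5)
    (s := s) ⟨has, le_rfl⟩
  have := key.add_const (β s)
  simpa using this

theorem conj_inner_of_adjoint_eq {E : Type*} [NormedAddCommGroup E] [InnerProductSpace ℂ E]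
    [CompleteSpace E] {A B : E →L[ℂ] E} (h : adjoint A = B) (x y : E) :
    (starRingEnd ℂ) ⟪y, B x⟫_ℂ = ⟪x, A y⟫_ℂ := by
  rw [← h, inner_conj_symm, adjoint_inner_left]

variable (K HR V I W) in
/-- The rescaled evolution in the interaction picture, compressed to `𝒦 ⊕ L²(ℝ; 𝔥)`. -/
def compressedEvolution (lam t a : ℝ) :
    WithLp 2 (𝒦 × Lp (PiLp 2 𝔥) 2 (volume : Measure ℝ)) →L[ℂ]
      WithLp 2 (𝒦 × Lp (PiLp 2 𝔥) 2 (volume : Measure ℝ)) :=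
  adjoint (identification I W lam) ∘L interaction K HR V lam a t ∘L identification I W lam

theorem adjoint_compressedEvolution (hK : IsSelfAdjoint K) (hHR : IsSelfAdjoint HR)
    (lam t a : ℝ) : adjoint (compressedEvolution K HR V I W lam t a) =
      compressedEvolution K HR V I W lam a t := by
  refine (adjoint_comp_comp _ _ _).trans ?_
  exact congrArg₂ _ rfl (congrArg₂ _ (adjoint_interaction hK hHR lam a t) (adjoint_adjoint _))

theorem norm_compressedEvolution_le (hK : IsSelfAdjoint K) (hHR : IsSelfAdjoint HR)
    (hreg : IsRegularNearSpectrum HR V I W v) {lam : ℝ} (hlam : 0 < lam) (t a : ℝ)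
    (ψ : WithLp 2 (𝒦 × Lp (PiLp 2 𝔥) 2 (volume : Measure ℝ))) :
    ‖compressedEvolution K HR V I W lam t a ψ‖ ≤ ‖ψ‖ := by
  have h1 : ‖adjoint (identification I W lam)‖ ≤ 1 := by
    rw [LinearIsometryEquiv.norm_map]
    refine ContinuousLinearMap.opNorm_le_bound _ zero_le_one fun x => ?_
    rw [one_mul]
    exact norm_identification_le hHR hreg hlam x
  refine (ContinuousLinearMap.le_opNorm (adjoint (identification I W lam)) _).trans ?_
  refine (mul_le_mul_of_nonneg_right h1 (norm_nonneg _)).trans ?_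
  rw [one_mul]
  refine (norm_interaction hK hHR _ _ _ _).le.trans ?_
  exact norm_identification_le hHR hreg hlam ψ

theorem intervalIntegral_inner_symm {a s : ℝ} (x y : ℝ → 𝒦) :
    ∫ u in a..s, ⟪x u, y u⟫_ℂ = (starRingEnd ℂ) (∫ u in a..s, ⟪y u, x u⟫_ℂ) := by
  rw [intervalIntegral.intervalIntegral_eq_integral_uIoc,
    intervalIntegral.intervalIntegral_eq_integral_uIoc, Complex.real_smul, Complex.real_smul,
    map_mul, Complex.conj_ofReal, ← integral_conj]
  simp only [inner_conj_symm]

theorem inner_compressedEvolution (hK : IsSelfAdjoint K) (hHR : IsSelfAdjoint HR) (lam t a : ℝ)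
    (ψ ψ' : WithLp 2 (𝒦 × Lp (PiLp 2 𝔥) 2 (volume : Measure ℝ))) :
    ⟪ψ, compressedEvolution K HR V I W lam t a ψ'⟫_ℂ =
      ⟪ψ.fst, (interaction K HR V lam a t (identification I W lam ψ')).fst⟫_ℂ +
      ⟪reservoirMap I W lam ψ.snd, reservoirMap I W lam ψ'.snd⟫_ℂ -
      Complex.I * ∫ u in a..t, ⟪adjoint (coupling K HR V lam u) (reservoirMap I W lam ψ.snd),
        (interaction K HR V lam a u (identification I W lam ψ')).fst⟫_ℂ := by
  change ⟪ψ, adjoint (identification I W lam) (interaction K HR V lam a t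
    (identification I W lam ψ'))⟫_ℂ = _
  rw [adjoint_inner_right, WithLp.prod_inner_apply]
  change ⟪ψ.fst, (interaction K HR V lam a t (identification I W lam ψ')).fst⟫_ℂ +
    ⟪reservoirMap I W lam ψ.snd,
      (interaction K HR V lam a t (identification I W lam ψ')).snd⟫_ℂ = _
  have hc : Continuous fun u => (interaction K HR V lam a u (identification I W lam ψ')).fst :=
    (WithLp.fstL 2 ℂ 𝒦 ℋ).continuous.comp (continuous_interaction hK hHR lam a _)
  have h1 : ⟪reservoirMap I W lam ψ.snd, ∫ u in a..t, coupling K HR V lam u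
      (interaction K HR V lam a u (identification I W lam ψ')).fst⟫_ℂ =
      ∫ u in a..t, ⟪adjoint (coupling K HR V lam u) (reservoirMap I W lam ψ.snd),
        (interaction K HR V lam a u (identification I W lam ψ')).fst⟫_ℂ := by
    simp only [adjoint_inner_left]
    exact ((innerSL ℂ (reservoirMap I W lam ψ.snd)).intervalIntegral_comp_comm
      ((continuous_coupling_apply hHR lam hc).intervalIntegrable _ _)).symm
  have h2 : (identification I W lam ψ').snd = reservoirMap I W lam ψ'.snd := rfl
  have h3 : ⟪reservoirMap I W lam ψ.snd,
      (interaction K HR V lam a t (identification I W lam ψ')).snd⟫_ℂ =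
      ⟪reservoirMap I W lam ψ.snd, reservoirMap I W lam ψ'.snd⟫_ℂ - Complex.I *
        ∫ u in a..t, ⟪adjoint (coupling K HR V lam u) (reservoirMap I W lam ψ.snd),
          (interaction K HR V lam a u (identification I W lam ψ')).fst⟫_ℂ := by
    refine (congrArg _ (interaction_snd hK hHR lam a _ t)).trans
      ((inner_sub_right _ _ _).trans ?_)
    exact congrArg₂ _ (congrArg _ h2) ((inner_smul_right _ _ _).trans (congrArg _ h1))
  rw [h3, add_sub_assoc]

theorem tendsto_inner_compressedEvolution (hK : IsSelfAdjoint K) (hHR : IsSelfAdjoint HR)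
    (hV : Integrable fun t : ℝ => ‖adjoint V ∘L expI HR t ∘L V‖)
    (hreg : IsRegularNearSpectrum HR V I W v)
    {ψ ψ' : WithLp 2 (𝒦 × Lp (PiLp 2 𝔥) 2 (volume : Measure ℝ))}
    (hψ : ψ.snd ∈ boundedSupport (PiLp 2 𝔥) volume)
    (hψ' : ψ'.snd ∈ boundedSupport (PiLp 2 𝔥) volume) {a t : ℝ} (hat : a ≤ t) :
    Tendsto (fun lam => ⟪ψ, compressedEvolution K HR V I W lam t a ψ'⟫_ℂ) (𝓝[>] 0)
      (𝓝 (⟪ψ.fst, limitState (levelShift K HR V) (nu v) a ψ' t⟫_ℂ + ⟪ψ.snd, ψ'.snd⟫_ℂ -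
        Complex.I * ∫ u in a..t, ⟪adjoint (nu v) (inputField ψ.snd u),
          limitState (levelShift K HR V) (nu v) a ψ' u⟫_ℂ)) := by
  have hψi' := integrable_of_mem_boundedSupport hψ'
  set β := limitState (levelShift K HR V) (nu v) a ψ' with hβ
  have hβc : Continuous β := continuous_limitState a hψi'
  let βl : ℝ → ℝ → 𝒦 := fun lam s =>
    (interaction K HR V lam a s (identification I W lam ψ')).fst
  have hβlc : ∀ lam, Continuous (βl lam) := fun lam =>
    (WithLp.fstL 2 ℂ 𝒦 ℋ).continuous.comp (continuous_interaction hK hHR lam a _)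
  let f : ℝ → ℝ → 𝒦 := fun lam u =>
    adjoint (coupling K HR V lam u) (reservoirMap I W lam ψ.snd)
  have hfc : ∀ lam, Continuous (f lam) := fun lam =>
    continuous_adjoint_coupling_apply hK hHR lam continuous_const
  obtain ⟨B, hB⟩ := exists_norm_adjoint_coupling_le hHR hreg hK hψ
  obtain ⟨D, hD⟩ := (isCompact_Icc (a := a) (b := t)).exists_bound_of_continuousOn
    hβc.continuousOn
  simp only [inner_compressedEvolution hK hHR]
  refine Tendsto.sub (Tendsto.add ?_ ?_) (Tendsto.const_mul _ ?_)
  · exact tendsto_const_nhds.inner (tendsto_interaction_fst hK hHR hV hreg hψ' hat)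
  · exact tendsto_nhds_of_eventually_eq (eventually_inner_reservoirMap hHR hreg ψ.snd hψ')
  · have h1 : Tendsto (fun lam => ∫ u in a..t, ⟪f lam u, β u⟫_ℂ) (𝓝[>] 0)
        (𝓝 (∫ u in a..t, ⟪adjoint (nu v) (inputField ψ.snd u), β u⟫_ℂ)) := by
      rw [intervalIntegral_inner_symm]
      refine ((Complex.continuous_conj.tendsto _).comp
        (tendsto_integral_inner_field hHR hreg hK hψ hβc hat)).congr fun lam => ?_
      exact (intervalIntegral_inner_symm _ _).symm
    have h2 : Tendsto (fun lam => ∫ u in a..t, ⟪f lam u, βl lam u - β u⟫_ℂ) (𝓝[>] 0) (𝓝 0) := by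
      have h0 : ∫ _ in a..t, (0 : ℂ) = 0 := by simp
      rw [← h0]
      refine intervalIntegral.tendsto_integral_filter_of_dominated_convergence
        (fun _ => B * (‖ψ'‖ + D)) ?_ ?_ (by simp) ?_
      · exact Eventually.of_forall fun lam =>
          ((hfc lam).inner ((hβlc lam).sub hβc)).aestronglyMeasurable
      · filter_upwards [hB, self_mem_nhdsWithin] with lam hlam hlam0
        refine ae_of_all _ fun u hu => ?_
        rw [Set.uIoc_of_le hat] at hu
        refine (norm_inner_le_norm _ _).trans ?_
        refine mul_le_mul (hlam u) ?_ (norm_nonneg _) ((norm_nonneg _).trans (hlam u))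
        refine (norm_sub_le _ _).trans (add_le_add ?_ (hD u ⟨hu.1.le, hu.2⟩))
        refine (WithLp.norm_fst_le _ _).trans ?_
        rw [norm_interaction hK hHR]
        exact norm_identification_le hHR hreg hlam0 ψ'
      · refine ae_of_all _ fun u hu => ?_
        rw [Set.uIoc_of_le hat] at hu
        have e1 := tendsto_iff_norm_sub_tendsto_zero.mp
          (tendsto_interaction_fst hK hHR hV hreg hψ' hu.1.le)
        have e2 := e1.const_mul B
        rw [mul_zero] at e2
        rw [tendsto_zero_iff_norm_tendsto_zero]
        refine squeeze_zero' (Eventually.of_forall fun _ => norm_nonneg _) ?_ e2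
        filter_upwards [hB] with lam hlam
        exact (norm_inner_le_norm _ _).trans
          (mul_le_mul_of_nonneg_right (hlam u) (norm_nonneg _))
    have h3 := h2.add h1
    rw [zero_add] at h3
    refine h3.congr fun lam => ?_
    rw [← intervalIntegral.integral_add
      (((hfc lam).inner ((hβlc lam).sub hβc)).intervalIntegrable _ _)
      (((hfc lam).inner hβc).intervalIntegrable _ _)]
    refine intervalIntegral.integral_congr fun u _ => ?_
    simp only [inner_sub_right, sub_add_cancel]
    rfl

theorem dense_boundedSupport_snd {𝔤 : Type*} [NormedAddCommGroup 𝔤] [InnerProductSpace ℂ 𝔤]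
    [CompleteSpace 𝔤] : Dense {ψ : WithLp 2 (𝒦 × Lp 𝔤 2 (volume : Measure ℝ)) |
      ψ.snd ∈ boundedSupport 𝔤 volume} := by
  have hopen : IsOpenMap fun ψ : WithLp 2 (𝒦 × Lp 𝔤 2 (volume : Measure ℝ)) => ψ.snd :=
    isOpenMap_snd.comp
      (WithLp.prodContinuousLinearEquiv 2 ℂ 𝒦 (Lp 𝔤 2 volume)).toHomeomorph.isOpenMap
  exact Dense.preimage dense_boundedSupport hopen

set_option maxHeartbeats 1000000 in
theorem strongStarTendsto_compressedEvolution (hK : IsSelfAdjoint K) (hHR : IsSelfAdjoint HR)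
    (hV : Integrable fun t : ℝ => ‖adjoint V ∘L expI HR t ∘L V‖)
    (hreg : IsRegularNearSpectrum HR V I W v)
    {U : ℝ → WithLp 2 (𝒦 × Lp (PiLp 2 𝔥) 2 (volume : Measure ℝ)) →L[ℂ]
      WithLp 2 (𝒦 × Lp (PiLp 2 𝔥) 2 (volume : Measure ℝ))}
    (hU : IsSingularFriedrichsGroup (levelShift K HR V) (nu v) U) (t a : ℝ) :
    StrongStarTendsto (fun lam => compressedEvolution K HR V I W lam t a) (𝓝[>] 0)
      (expZR t ∘L U (t - a) ∘L expZR (-a)) := by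
  let B : ℝ → ℝ → WithLp 2 (𝒦 × Lp (PiLp 2 𝔥) 2 (volume : Measure ℝ)) →L[ℂ]
      WithLp 2 (𝒦 × Lp (PiLp 2 𝔥) 2 (volume : Measure ℝ)) :=
    fun t a => expZR t ∘L U (t - a) ∘L expZR (-a)
  have hBadj : ∀ t a, adjoint (B t a) = B a t := hU.adjoint_interaction
  have hBu : ∀ t a, B t a ∈ unitary _ := fun t a =>
    mul_mem (expZR_mem_unitary t) (mul_mem (hU.isUnitaryGroup.mem_unitary _)
      (expZR_mem_unitary (-a)))
  have hweak : ∀ t a, ∀ ψ ∈ {ψ : WithLp 2 (𝒦 × Lp (PiLp 2 𝔥) 2 (volume : Measure ℝ)) |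
        ψ.snd ∈ boundedSupport (PiLp 2 𝔥) volume},
      ∀ ψ' ∈ {ψ : WithLp 2 (𝒦 × Lp (PiLp 2 𝔥) 2 (volume : Measure ℝ)) |
        ψ.snd ∈ boundedSupport (PiLp 2 𝔥) volume},
      Tendsto (fun lam => ⟪ψ, compressedEvolution K HR V I W lam t a ψ'⟫_ℂ) (𝓝[>] 0)
        (𝓝 ⟪ψ, B t a ψ'⟫_ℂ) := by
    have h1 : ∀ t a, a ≤ t → ∀ ψ ∈ {ψ : WithLp 2 (𝒦 × Lp (PiLp 2 𝔥) 2 (volume : Measure ℝ)) |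
          ψ.snd ∈ boundedSupport (PiLp 2 𝔥) volume},
        ∀ ψ' ∈ {ψ : WithLp 2 (𝒦 × Lp (PiLp 2 𝔥) 2 (volume : Measure ℝ)) |
          ψ.snd ∈ boundedSupport (PiLp 2 𝔥) volume},
        Tendsto (fun lam => ⟪ψ, compressedEvolution K HR V I W lam t a ψ'⟫_ℂ) (𝓝[>] 0)
          (𝓝 ⟪ψ, B t a ψ'⟫_ℂ) := by
      intro t a hat ψ hψ ψ' hψ'
      have e1 : ⟪ψ, B t a ψ'⟫_ℂ = _ := hU.inner_interaction hat
        (integrable_of_mem_boundedSupport hψ) (integrable_of_mem_boundedSupport hψ')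
      rw [e1]
      exact tendsto_inner_compressedEvolution hK hHR hV hreg hψ hψ' hat
    intro t a ψ hψ ψ' hψ'
    rcases le_total a t with hat | hta
    · exact h1 t a hat ψ hψ ψ' hψ'
    · have h2 := (Complex.continuous_conj.tendsto _).comp (h1 a t hta ψ' hψ' ψ hψ)
      rw [conj_inner_of_adjoint_eq (hBadj t a)] at h2
      exact h2.congr fun lam =>
        conj_inner_of_adjoint_eq (adjoint_compressedEvolution hK hHR lam t a) ψ ψ'
  have hstrong : ∀ t a ψ, Tendsto (fun lam => compressedEvolution K HR V I W lam t a ψ) (𝓝[>] 0)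
      (𝓝 (B t a ψ)) := fun t a ψ =>
    tendsto_of_tendsto_inner_of_contraction (by
      filter_upwards [self_mem_nhdsWithin] with lam hlam x
      exact norm_compressedEvolution_le hK hHR hreg hlam t a x) (hBu t a)
      dense_boundedSupport_snd (hweak t a) ψ
  refine fun ψ => ⟨hstrong t a ψ, ?_⟩
  have h3 := (hstrong a t ψ).congr fun lam =>
    (congrArg (fun T => T ψ) (adjoint_compressedEvolution hK hHR lam t a)).symm
  have h4 : B a t ψ = adjoint (B t a) ψ := congrArg (fun T => T ψ) (hBadj t a).symm
  exact h4 ▸ h3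

end Limit

end WeakCoupling

end

theorem mainTheorem4 {𝒦 ℋ : Type*}
    [NormedAddCommGroup 𝒦] [InnerProductSpace ℂ 𝒦] [CompleteSpace 𝒦] [FiniteDimensional ℂ 𝒦]
    [NormedAddCommGroup ℋ] [InnerProductSpace ℂ ℋ] [CompleteSpace ℋ]
    (K : 𝒦 →L[ℂ] 𝒦) (hK : IsSelfAdjoint K)
    (HR : ℋ →ₗ.[ℂ] ℋ) (hHR : IsSelfAdjoint HR)
    (V : 𝒦 →L[ℂ] ℋ)
    (hV : Integrable fun t : ℝ => ‖adjoint V ∘L WeakCoupling.expI HR t ∘L V‖)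
    (𝔥 : spectrum ℝ K → Type*) [∀ k, NormedAddCommGroup (𝔥 k)]
    [∀ k, InnerProductSpace ℂ (𝔥 k)] [∀ k, CompleteSpace (𝔥 k)]
    (I : spectrum ℝ K → Set ℝ)
    (W : ∀ k, Lp (𝔥 k) 2 (volume.restrict (I k)) →ₗᵢ[ℂ] ℋ)
    (v : ∀ k, ℝ → 𝒦 →L[ℂ] 𝔥 k)
    (hreg : WeakCoupling.IsRegularNearSpectrum HR V I W v) :
    ∃ U : ℝ → WithLp 2 (𝒦 × Lp (PiLp 2 𝔥) 2 (volume : Measure ℝ)) →L[ℂ]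
        WithLp 2 (𝒦 × Lp (PiLp 2 𝔥) 2 (volume : Measure ℝ)),
      WeakCoupling.IsSingularFriedrichsGroup
        (WeakCoupling.levelShift K HR V) (WeakCoupling.nu v) U ∧
      WeakCoupling.IsDilation (WeakCoupling.levelShift K HR V) U ∧
      ∀ t t₀ : ℝ, WeakCoupling.StrongStarTendsto
        (fun lam : ℝ =>
          adjoint (WeakCoupling.identification I W lam) ∘L
            WeakCoupling.expI (WeakCoupling.friedrichs K HR V 0) (-(t / lam ^ 2)) ∘L
            WeakCoupling.expI (WeakCoupling.friedrichs K HR V lam) ((t - t₀) / lam ^ 2) ∘L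
            WeakCoupling.expI (WeakCoupling.friedrichs K HR V 0) (t₀ / lam ^ 2) ∘L
            WeakCoupling.identification I W lam)
        (𝓝[>] 0)
        (WeakCoupling.expZR t ∘L U (t - t₀) ∘L WeakCoupling.expZR (-t₀)) := by
  have hΥ : ∀ b, 2 * (⟪b, WeakCoupling.levelShift K HR V b⟫_ℂ).im =
      -‖WeakCoupling.nu v b‖ ^ 2 := WeakCoupling.two_mul_im_inner_levelShift hHR hV hreg
  have hex := WeakCoupling.exists_singularFriedrichsGroup hΥ
  refine hex.imp fun U hU => ⟨hU, hU.isDilation, fun t t₀ => ?_⟩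
  exact WeakCoupling.strongStarTendsto_compressedEvolution hK hHR hV hreg hU t t₀
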